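/- Fix $\omega>0$, $b>0$, $h>0$, $h_1>0$ and constants $0<\rho_{r_0}\le\rho_{r_1}$, $0<\rho_{i_0}\le\rho_{i_1}$. Let $\mathcal S=\mathbb R/2\pi\mathbb Z$, $\Omega=\mathcal S\times(-b,0)$, $\Gamma_0=\mathcal S\times\{0\}$, $\Gamma_b=\mathcal S\times\{-b\}$, $K=[-\tfrac12,\tfrac12]$, and $$\mathcal A=\{\rho\in L^\infty(\Omega;\mathbb C):\ \rho_{r_0}\le\operatorname{Re}\rho\le\rho_{r_1},\ \rho_{i_0}\le\operatorname{Im}\rho\le\rho_{i_1}\ \text{a.e.}\}.$$ Let $\beta(\xi)=\sqrt{\omega^2-\xi^2}$ if $\omega^2>\xi^2$ and $\beta(\xi)=i\sqrt{\xi^2-\omega^2}$ otherwise. For $\alpha\in K$ let $T_\alpha w=\sum_{n\in\mathbb Z} i\beta(n+\alpha)\hat w(n)e^{inx}$ (with $\hat w(n)=\frac1{2\pi}\int_0^{2\pi}w e^{-inx}dx$) and $$g_\alpha(x)=\frac{-i}{\pi}\sum_{n\in\mathbb Z}e^{i\beta(n+\alpha)h}e^{inx}.$$ For $\rho\in\mathcal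 A$ and $\alpha\in K$ consider the problem $$\Delta u+2i\alpha\,\partial_x u-\alpha^2u+\omega^2\rho u=0\ \text{ in }\Omega,\qquad \partial_yu-T_\alpha u=2g_\alpha\ \text{ on }\Gamma_0,\qquad \partial_yu+T_\alpha u=0\ \text{ on }\Gamma_b .$$ A weak solution is a function $u\in H^1(\Omega)$ such that, for all $v\in H^1(\Omega)$, $$\int_\Omega\nabla u\cdot\overline{\nabla v}-\omega^2\int_\Omega\rho u\bar v+\alpha^2\int_\Omega u\bar v-2i\alpha\int_\Omega(\partial_xu)\bar v-\int_{\Gamma_0}(T_\alpha u)\bar v-\int_{\Gamma_b}(T_\alpha u)\bar v=2\int_{\Gamma_0}g_\alpha\bar v ,$$ where boundary values are traces and the integrals over $\Gamma_0,\Gamma_b$ on the left are $H^{-1/2}$-$H^{1/2}$ duality pairings. **Theorem 3.1.** (a) For every $\rho\in\mathcal A$ and $\alpha\in K$ there is exactly one weak solution $u_\alpha\in H^1(\Omega)$, and it has uniquely determined traces on $\Gamma_0$ and $\Gamma_b$. Put $F(\rho,\alpha)=u_\alpha|_{\Gamma_b}\in L^2(\Gamma_b)$. For every $\rho\in\mathcal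 A$ the map $\alpha\mapsto F(\rho,\alpha)$ is (strongly) measurable from $K$ to $L^2(\Gamma_b)$. (b) Let $(q_\alpha)_{\alpha\in K}$ be any (strongly) measurable family in $L^2(\Gamma_b)$, and let $$J(\rho)=\frac12\int_{-1/2}^{1/2}\|F(\rho,\alpha)-q_\alpha\|_{L^2(\Gamma_b)}^2\,d\alpha\in[0,\infty].$$ Then the design problem $\inf_{\rho\in\mathcal A}J(\rho)$ has a solution: there is $\rho'\in\mathcal A$ with $J(\rho')=\inf_{\rho\in\mathcal A}J(\rho)$. If $\int_{-1/2}^{1/2}\|q_\alpha\|_{L^2}^2\,d\alpha<\infty$, then $J(\rho)<\infty$ for every $\rho\in\mathcal A$. (c) The Bloch components $q_\alpha(x)=\frac1\pi\sum_{n\in\mathbb Z}\overline{e^{i\beta(n+\alpha)h_1}/\beta(n+\alpha)}\;e^{inx}$ of the mirror image $q(x)=H_0^{(2)}(\omega\sqrt{x^2+h_1^2})$, which are defined for almost every $\alpha\in K$, form such a measurable family in $L^2(\Gamma_b)$; so the design problem with this target has a solution in the sense of (b). -/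

import Mathlib

open MeasureTheory Set Filter Topology
open scoped ENNReal ComplexConjugate

noncomputable section

namespace Slab

/-- The periodic domain (circle) `𝒮 = ℝ / 2πℤ`; its volume is Lebesgue measure, of total mass `2π`. -/
abbrev S : Type := AddCircle (2 * Real.pi)

instance factTwoPiPos : Fact (0 < 2 * Real.pi) := ⟨Real.two_pi_pos⟩

/-- Lebesgue measure on the periodic slab `Ω = 𝒮 × (-b, 0)`. -/
def vol (b : ℝ) : Measure (S × ℝ) :=
  (volume : Measure (S × ℝ)).restrict (univ ×ˢ Ioo (-b) 0)

/-- `L²(Ω)`, complex valued. -/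
abbrev L2Omega (b : ℝ) : Type := Lp ℂ 2 (vol b)

/-- `L^∞(Ω)`, complex valued. -/
abbrev LinfOmega (b : ℝ) : Type := Lp ℂ ∞ (vol b)

/-- `L²` of the boundary circles `Γ₀ = {y = 0}` and `Γ_b = {y = -b}`, both identified with `𝒮`. -/
abbrev L2Gamma : Type := Lp ℂ 2 (volume : Measure S)

/-! ### Smooth functions on `𝒮 × ℝ` and their classical derivatives -/

/-- `φ` is `C^∞` on `𝒮 × ℝ`: its `2π`-periodic lift to `ℝ × ℝ` is `C^∞`. -/
def IsSmooth (φ : S × ℝ → ℂ) : Prop :=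
  ContDiff ℝ ((⊤ : ℕ∞) : WithTop ℕ∞) (fun p : ℝ × ℝ => φ ((p.1 : S), p.2))

/-- Classical partial derivative `∂φ/∂x` on `𝒮 × ℝ`. -/
def partialX (φ : S × ℝ → ℂ) (z : S × ℝ) : ℂ :=
  deriv (fun t : ℝ => φ (z.1 + (t : S), z.2)) 0

/-- Classical partial derivative `∂φ/∂y` on `𝒮 × ℝ`. -/
def partialY (φ : S × ℝ → ℂ) (z : S × ℝ) : ℂ :=
  deriv (fun t : ℝ => φ (z.1, t)) z.2

/-- Test functions `φ ∈ C_c^∞(Ω)`. -/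
def IsTest (b : ℝ) (φ : S × ℝ → ℂ) : Prop :=
  IsSmooth φ ∧ HasCompactSupport φ ∧ tsupport φ ⊆ univ ×ˢ Ioo (-b) 0

/-! ### The Sobolev space `H¹(Ω)` and boundary traces -/

/-- An element of `H¹(Ω)`: a function in `L²(Ω)` together with its weak partial derivatives, which
lie in `L²(Ω)` (and are uniquely determined by the function). -/
@[ext]
structure H1 (b : ℝ) where
  /-- the function -/
  val : L2Omega b
  /-- its weak derivative in `x` -/
  dx : L2Omega b
  /-- its weak derivative in `y` -/
  dy : L2Omega b
  weak_dx : ∀ φ : S × ℝ → ℂ, IsTest b φ →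
    ∫ z, val z * partialX φ z ∂(vol b) = -∫ z, dx z * φ z ∂(vol b)
  weak_dy : ∀ φ : S × ℝ → ℂ, IsTest b φ →
    ∫ z, val z * partialY φ z ∂(vol b) = -∫ z, dy z * φ z ∂(vol b)

/-- `τ₀, τ_b ∈ L²(𝒮)` are the traces `u|_{Γ₀}`, `u|_{Γ_b}` of `u ∈ H¹(Ω)`: the boundary values for
which the Gauss-Green formula `∫_Ω ∂_y(u φ) = ∫_{Γ₀} u φ - ∫_{Γ_b} u φ` holds for all functions `φ`
that are smooth up to the boundary. -/
def IsTrace {b : ℝ} (u : H1 b) (τ₀ τb : L2Gamma) : Prop :=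
  ∀ φ : S × ℝ → ℂ, IsSmooth φ →
    (∫ z, u.val z * partialY φ z ∂(vol b)) + (∫ z, u.dy z * φ z ∂(vol b)) =
      (∫ x : S, τ₀ x * φ (x, 0)) - ∫ x : S, τb x * φ (x, -b)

/-! ### The scattering problem -/

/-- `β(ξ) = √(ω² - ξ²)` if the argument is positive, and `β(ξ) = i √(ξ² - ω²)` otherwise. -/
def beta (ω ξ : ℝ) : ℂ :=
  if 0 < ω ^ 2 - ξ ^ 2 then (Real.sqrt (ω ^ 2 - ξ ^ 2) : ℂ)
  else Complex.I * (Real.sqrt (ξ ^ 2 - ω ^ 2) : ℂ)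

/-- `g_α(x) = (-i/π) ∑ₙ e^{i β(n+α) h} e^{inx}`, the Bloch component of `∂_y u_i` on `{y = 0}`, where
`u_i` is the field of a point source at `(0, h)`. (Mathlib's `fourier n x` is `e^{inx}` here.) -/
def gData (ω h α : ℝ) (x : S) : ℂ :=
  (-Complex.I / Real.pi) *
    ∑' n : ℤ, Complex.exp (Complex.I * beta ω (n + α) * h) * fourier n x

/-- `t = ∫_Γ (T_α w) conj v` for the Dirichlet-to-Neumann operator
`T_α w = ∑ₙ i β(n+α) ŵ(n) e^{inx}`. For traces `w, v` of `H¹(Ω)` functions this is the duality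
pairing of `H^{-1/2}` and `H^{1/2}`, the sum of the convergent series
`2π ∑ₙ i β(n+α) ŵ(n) conj (v̂(n))`. -/
def IsDtNPairing (ω α : ℝ) (w v : L2Gamma) (t : ℂ) : Prop :=
  HasSum (fun n : ℤ => 2 * (Real.pi : ℂ) *
    (Complex.I * beta ω (n + α) * fourierCoeff (w : S → ℂ) n *
      conj (fourierCoeff (v : S → ℂ) n))) t

/-- `u ∈ H¹(Ω)` is a weak solution of
`Δ_α u + ω² ρ u = 0` in `Ω`, `(∂_y - T_α) u = 2 g_α` on `Γ₀`, `(∂_y + T_α) u = 0` on `Γ_b`, where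
`Δ_α = Δ + 2iα ∂_x - α²`; that is, `a(u, v) = b(v)` for all `v ∈ H¹(Ω)`. -/
def IsWeakSolution (ω h α : ℝ) {b : ℝ} (ρ : LinfOmega b) (u : H1 b) : Prop :=
  ∃ u₀ ub : L2Gamma, IsTrace u u₀ ub ∧
    ∀ v : H1 b, ∃ (v₀ vb : L2Gamma) (t₀ tb : ℂ), IsTrace v v₀ vb ∧
      IsDtNPairing ω α u₀ v₀ t₀ ∧ IsDtNPairing ω α ub vb tb ∧
      (∫ z, (u.dx z * conj (v.dx z) + u.dy z * conj (v.dy z)) ∂(vol b))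
          - (ω : ℂ) ^ 2 * (∫ z, ρ z * u.val z * conj (v.val z) ∂(vol b))
          + (α : ℂ) ^ 2 * (∫ z, u.val z * conj (v.val z) ∂(vol b))
          - 2 * Complex.I * (α : ℂ) * (∫ z, u.dx z * conj (v.val z) ∂(vol b))
          - t₀ - tb
        = 2 * ∫ x : S, gData ω h α x * conj (v₀ x)

/-! ### The design problem -/

/-- The admissible class `𝒜` of dielectric coefficients. -/
def admissible (b r₀ r₁ i₀ i₁ : ℝ) : Set (LinfOmega b) :=
  {ρ | ∀ᵐ z ∂(vol b), (r₀ ≤ (ρ z).re ∧ (ρ z).re ≤ r₁) ∧ (i₀ ≤ (ρ z).im ∧ (ρ z).im ≤ i₁)}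

/-- The first Brillouin zone `K = [-1/2, 1/2]`. -/
def K : Set ℝ := Icc (-(1 / 2)) (1 / 2)

open Classical in
/-- `F(ρ, α) = u_α|_{Γ_b}`, where `u_α` is the weak solution for `ρ` (and `0` if there is none). -/
def F (ω b h : ℝ) (ρ : LinfOmega b) (α : ℝ) : L2Gamma :=
  if H : ∃ τb : L2Gamma, ∃ (u : H1 b) (τ₀ : L2Gamma),
      IsWeakSolution ω h α ρ u ∧ IsTrace u τ₀ τb
  then H.choose else 0

/-- `J(ρ) = ½ ∫_{-1/2}^{1/2} ‖F(ρ, α) - q_α‖²_{L²(Γ_b)} dα ∈ [0, ∞]`. -/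
def J (ω b h : ℝ) (q : ℝ → L2Gamma) (ρ : LinfOmega b) : ℝ≥0∞ :=
  (1 / 2) * ∫⁻ α in K, ‖F ω b h ρ α - q α‖ₑ ^ 2

/-- The Bloch components `q_α(x) = (1/π) ∑ₙ conj (e^{i β(n+α) h₁} / β(n+α)) e^{inx}` of the mirror
image `q(x) = H₀⁽²⁾(ω √(x² + h₁²))`. (The series makes sense except at the isolated values of `α`
for which `β(n+α) = 0` for some `n`.) -/
def mirrorTarget (ω h₁ α : ℝ) (x : S) : ℂ :=
  (1 / Real.pi : ℂ) *
    ∑' n : ℤ, conj (Complex.exp (Complex.I * beta ω (n + α) * h₁) / beta ω (n + α)) * fourier n x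

end Slab

end

noncomputable section

namespace Slab

/-! ### Functions on the slab -/

/-! The weak formulation becomes an equation `opA u = rhs` in the Hilbert space `V b`, a copy of
H¹(Ω) closed in L²(Ω)³. The delicate terms are the boundary pairings, since β(n+α) grows like |n|.
They are bounded because the H¹ norm controls √(1+|n|) times the Fourier coefficients of both traces
in ℓ² (`traceSeq`, the H^{1/2} trace theorem); in these coordinates T_α is a bounded multiplier
(`dtn`).

Absorption makes the form a(u,u) coercive: Im ρ ≥ i₀ > 0 lets -Im a(u,u) control the L² norm of u,
the boundary terms have a favourable sign because Re β, Im β ≥ 0, and Re a plus a multiple of -Im a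
dominates the H¹ norm (`coer_mul_le`). The constant depends on neither ρ ∈ 𝒜 nor α ∈ K. Lax-Milgram
(`bijective_of_coercive`) gives existence and uniqueness, and the uniform constant turns continuity
of the data in α into continuity of α ↦ u_α on the compact set K; hence F is measurable and bounded
there.

The minimum comes from the direct method. A minimizing sequence has a weakly convergent subsequence,
and its limit ρ' is admissible because the constraints are convex (`exists_admissible_limit`). With
ι : H¹ → L² the inclusion, u_k and u' the solutions for ρ_k and ρ', and A_k the operator for ρ_k,
one has A_k(u_k - u') = ω² ι*((ρ_k - ρ')u'). The adjoint ι* is compact, by Rellich's theorem in the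
explicit cosine basis, so u_k → u' in norm (`tendsto_sol`). Fatou's lemma then gives lower
semicontinuity of J with no integrability of q.

For the mirror image, exponential decay makes the Fourier series converge absolutely, so the family
is a pointwise limit of measurable finite sums. -/

instance isFiniteMeasure_vol (b : ℝ) : IsFiniteMeasure (vol b) := by
  refine ⟨?_⟩
  rw [vol, Measure.restrict_apply_univ, Measure.volume_eq_prod, Measure.prod_prod]
  exact ENNReal.mul_lt_top (measure_lt_top _ _) (by simp)

lemma vol_eq_prod (b : ℝ) :
    vol b = (volume : Measure S).prod (volume.restrict (Ioo (-b) 0)) := by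
  rw [vol, Measure.volume_eq_prod, ← Measure.prod_restrict, Measure.restrict_univ]

lemma ae_vol_mem (b : ℝ) : ∀ᵐ z ∂(vol b), z.2 ∈ Ioo (-b) 0 := by
  have := ae_restrict_mem (μ := (volume : Measure (S × ℝ)))
    ((MeasurableSet.univ : MeasurableSet (univ : Set S)).prod
      (measurableSet_Ioo (a := -b) (b := 0)))
  filter_upwards [this] with z hz using hz.2

lemma exists_bound_of_continuous (b : ℝ) {φ : S × ℝ → ℂ} (hφ : Continuous φ) :
    ∃ C, 0 ≤ C ∧ ∀ z : S × ℝ, z.2 ∈ Icc (-b) 0 → ‖φ z‖ ≤ C := by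
  have hK : IsCompact ((univ : Set S) ×ˢ Icc (-b) 0) := isCompact_univ.prod isCompact_Icc
  obtain ⟨C, hC⟩ := hK.exists_bound_of_continuousOn hφ.continuousOn
  exact ⟨max C 0, le_max_right _ _, fun z hz => (hC z ⟨mem_univ _, hz⟩).trans (le_max_left _ _)⟩

lemma memLp_of_continuous (b : ℝ) {φ : S × ℝ → ℂ} (hφ : Continuous φ) (p : ℝ≥0∞) :
    MemLp φ p (vol b) := by
  obtain ⟨C, -, hC⟩ := exists_bound_of_continuous b hφ
  refine MemLp.of_bound hφ.aestronglyMeasurable C ?_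
  filter_upwards [ae_vol_mem b] with z hz using hC z ⟨hz.1.le, hz.2.le⟩

/-- The class in `L²(Ω)` of a continuous function. -/
def toL2 (b : ℝ) (φ : C(S × ℝ, ℂ)) : L2Omega b :=
  (memLp_of_continuous b φ.continuous 2).toLp φ

lemma coeFn_toL2 (b : ℝ) (φ : C(S × ℝ, ℂ)) : toL2 b φ =ᵐ[vol b] φ := MemLp.coeFn_toLp _

lemma inner_toL2 (b : ℝ) (φ : C(S × ℝ, ℂ)) (f : L2Omega b) :
    inner ℂ (toL2 b φ) f = ∫ z, f z * conj (φ z) ∂(vol b) := by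
  rw [L2.inner_def]
  refine integral_congr_ae ?_
  filter_upwards [coeFn_toL2 b φ] with z hz
  rw [hz]; rfl

lemma inner_toL2_star (b : ℝ) (φ : C(S × ℝ, ℂ)) (f : L2Omega b) :
    inner ℂ (toL2 b (star φ)) f = ∫ z, f z * φ z ∂(vol b) := by
  simp [inner_toL2]

lemma integrable_Lp (b : ℝ) (f : L2Omega b) : Integrable f (vol b) :=
  (Lp.memLp f).integrable (by norm_num)

/-! ### Smooth functions -/

/-- Lets continuity on 𝒮 × ℝ be checked on the periodic lift, where smoothness is defined. -/
lemma isOpenQuotientMap_coe :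
    IsOpenQuotientMap (fun p : ℝ × ℝ => ((p.1 : S), p.2)) :=
  QuotientAddGroup.isOpenQuotientMap_mk.prodMap IsOpenQuotientMap.id

lemma continuous_iff_lift {φ : S × ℝ → ℂ} :
    Continuous φ ↔ Continuous (fun p : ℝ × ℝ => φ ((p.1 : S), p.2)) :=
  isOpenQuotientMap_coe.continuous_comp_iff.symm

lemma IsSmooth.continuous {φ : S × ℝ → ℂ} (hφ : IsSmooth φ) : Continuous φ :=
  continuous_iff_lift.2 (ContDiff.continuous hφ)

lemma partialX_coe (φ : S × ℝ → ℂ) (x y : ℝ) :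
    partialX φ ((x : S), y) = deriv (fun t : ℝ => φ ((t : S), y)) x := by
  have := deriv_comp_const_add (f := fun t : ℝ => φ ((t : S), y)) x 0
  simpa [partialX] using this

lemma IsSmooth.hasDerivAt_lift_x {φ : S × ℝ → ℂ} (hφ : IsSmooth φ) (x y : ℝ) :
    HasDerivAt (fun t : ℝ => φ ((t : S), y))
      (fderiv ℝ (fun p : ℝ × ℝ => φ ((p.1 : S), p.2)) (x, y) (1, 0)) x := by
  have h1 : HasFDerivAt (fun p : ℝ × ℝ => φ ((p.1 : S), p.2)) _ (x, y) :=
    ((ContDiff.differentiable hφ (by simp)) (x, y)).hasFDerivAt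
  exact h1.comp_hasDerivAt x ((hasDerivAt_id x).prodMk (hasDerivAt_const x y))

lemma IsSmooth.hasDerivAt_lift_y {φ : S × ℝ → ℂ} (hφ : IsSmooth φ) (x y : ℝ) :
    HasDerivAt (fun t : ℝ => φ ((x : S), t))
      (fderiv ℝ (fun p : ℝ × ℝ => φ ((p.1 : S), p.2)) (x, y) (0, 1)) y := by
  have h1 : HasFDerivAt (fun p : ℝ × ℝ => φ ((p.1 : S), p.2)) _ (x, y) :=
    ((ContDiff.differentiable hφ (by simp)) (x, y)).hasFDerivAt
  exact h1.comp_hasDerivAt y ((hasDerivAt_const y x).prodMk (hasDerivAt_id y))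

lemma IsSmooth.hasDerivAt_y {φ : S × ℝ → ℂ} (hφ : IsSmooth φ) (x : S) (y : ℝ) :
    HasDerivAt (fun t : ℝ => φ (x, t)) (partialY φ (x, y)) y := by
  obtain ⟨x, rfl⟩ := QuotientAddGroup.mk_surjective x
  exact (hφ.hasDerivAt_lift_y x y).differentiableAt.hasDerivAt

lemma IsSmooth.hasDerivAt_x {φ : S × ℝ → ℂ} (hφ : IsSmooth φ) (x y : ℝ) :
    HasDerivAt (fun t : ℝ => φ ((t : S), y)) (partialX φ ((x : S), y)) x := by
  rw [partialX_coe]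
  exact (hφ.hasDerivAt_lift_x x y).differentiableAt.hasDerivAt

lemma IsSmooth.continuous_partialX {φ : S × ℝ → ℂ} (hφ : IsSmooth φ) :
    Continuous (partialX φ) := by
  rw [continuous_iff_lift]
  have : (fun p : ℝ × ℝ => partialX φ ((p.1 : S), p.2)) =
      fun p => fderiv ℝ (fun p : ℝ × ℝ => φ ((p.1 : S), p.2)) p (1, 0) := by
    ext p
    exact (hφ.hasDerivAt_x p.1 p.2).unique (hφ.hasDerivAt_lift_x p.1 p.2)
  rw [this]
  exact (ContDiff.continuous_fderiv hφ (by simp)).clm_apply continuous_const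

lemma IsSmooth.continuous_partialY {φ : S × ℝ → ℂ} (hφ : IsSmooth φ) :
    Continuous (partialY φ) := by
  rw [continuous_iff_lift]
  have : (fun p : ℝ × ℝ => partialY φ ((p.1 : S), p.2)) =
      fun p => fderiv ℝ (fun p : ℝ × ℝ => φ ((p.1 : S), p.2)) p (0, 1) := by
    ext p
    exact (hφ.hasDerivAt_y p.1 p.2).unique (hφ.hasDerivAt_lift_y p.1 p.2)
  rw [this]
  exact (ContDiff.continuous_fderiv hφ (by simp)).clm_apply continuous_const

lemma IsSmooth.mul_snd {φ : S × ℝ → ℂ} (hφ : IsSmooth φ) {ψ : ℝ → ℂ}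
    (hψ : ContDiff ℝ ((⊤ : ℕ∞) : WithTop ℕ∞) ψ) : IsSmooth (fun z => φ z * ψ z.2) :=
  ContDiff.mul hφ (hψ.comp contDiff_snd)

lemma IsSmooth.restrict_snd {φ : S × ℝ → ℂ} (hφ : IsSmooth φ) (y₀ : ℝ) :
    IsSmooth (fun z => φ (z.1, y₀)) :=
  ContDiff.comp (g := fun p : ℝ × ℝ => φ ((p.1 : S), p.2)) hφ
    (f := fun p : ℝ × ℝ => (p.1, y₀)) (by fun_prop)

lemma IsSmooth.sub {φ χ : S × ℝ → ℂ} (hφ : IsSmooth φ) (hχ : IsSmooth χ) :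
    IsSmooth (fun z => φ z - χ z) :=
  ContDiff.sub hφ hχ

lemma IsSmooth.partialX_mul_snd {φ : S × ℝ → ℂ} (hφ : IsSmooth φ) (ψ : ℝ → ℂ) (z : S × ℝ) :
    partialX (fun z => φ z * ψ z.2) z = partialX φ z * ψ z.2 := by
  obtain ⟨x, y⟩ := z
  obtain ⟨x, rfl⟩ := QuotientAddGroup.mk_surjective x
  have := (hφ.hasDerivAt_x x y).mul_const (ψ y)
  exact (partialX_coe _ x y).trans this.deriv

lemma IsSmooth.partialY_mul_snd {φ : S × ℝ → ℂ} (hφ : IsSmooth φ) {ψ : ℝ → ℂ}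
    (hψ : Differentiable ℝ ψ) (z : S × ℝ) :
    partialY (fun z => φ z * ψ z.2) z = partialY φ z * ψ z.2 + φ z * deriv ψ z.2 := by
  exact ((hφ.hasDerivAt_y z.1 z.2).mul (hψ z.2).hasDerivAt).deriv

lemma IsSmooth.partialY_sub {φ χ : S × ℝ → ℂ} (hφ : IsSmooth φ) (hχ : IsSmooth χ) (z : S × ℝ) :
    partialY (fun z => φ z - χ z) z = partialY φ z - partialY χ z :=
  ((hφ.hasDerivAt_y z.1 z.2).sub (hχ.hasDerivAt_y z.1 z.2)).deriv

lemma partialY_restrict_snd (φ : S × ℝ → ℂ) (y₀ : ℝ) (z : S × ℝ) :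
    partialY (fun z => φ (z.1, y₀)) z = 0 := by
  simp [partialY]

lemma fourier_coe_eq (n : ℤ) (x : ℝ) :
    (fourier n (x : S) : ℂ) = Complex.exp (Complex.I * n * x) := by
  rw [fourier_coe_apply]
  congr 1
  have : (Real.pi : ℂ) ≠ 0 := by exact_mod_cast Real.pi_ne_zero
  push_cast
  field_simp

lemma isSmooth_fourier (n : ℤ) : IsSmooth (fun z => (fourier n z.1 : ℂ)) := by
  have : (fun p : ℝ × ℝ => (fourier n (p.1 : S) : ℂ)) =
      fun p => Complex.exp (Complex.I * n * (p.1 : ℝ)) := by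
    ext p; exact fourier_coe_eq n p.1
  simp only [IsSmooth, this]
  have : ContDiff ℝ ((⊤ : ℕ∞) : WithTop ℕ∞) (fun p : ℝ × ℝ => (p.1 : ℂ)) :=
    Complex.ofRealCLM.contDiff.comp contDiff_fst
  fun_prop

lemma partialX_fourier (n : ℤ) (z : S × ℝ) :
    partialX (fun z => (fourier n z.1 : ℂ)) z = Complex.I * n * fourier n z.1 := by
  obtain ⟨x, y⟩ := z
  obtain ⟨x, rfl⟩ := QuotientAddGroup.mk_surjective x
  refine (partialX_coe _ x y).trans ?_
  have : HasDerivAt (fun t : ℝ => Complex.exp (Complex.I * n * t))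
      (Complex.exp (Complex.I * n * x) * (Complex.I * n * 1)) x :=
    ((Complex.ofRealCLM.hasDerivAt (x := x)).const_mul (Complex.I * n)).cexp
  simp only [fourier_coe_eq]
  rw [this.deriv]
  ring

lemma partialY_fourier (n : ℤ) (z : S × ℝ) :
    partialY (fun z => (fourier n z.1 : ℂ)) z = 0 := by
  simp [partialY]

/-! ### Weak derivatives tested with functions that are not compactly supported -/

lemma tendsto_integral_mul (b : ℝ) (f : L2Omega b) (φ : ℕ → S × ℝ → ℂ) (g : S × ℝ → ℂ) (C : ℝ)
    (hφ : ∀ k, Continuous (φ k)) (hC : ∀ k z, z.2 ∈ Ioo (-b) 0 → ‖φ k z‖ ≤ C)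
    (hg : ∀ z, z.2 ∈ Ioo (-b) 0 → Tendsto (fun k => φ k z) atTop (𝓝 (g z))) :
    Tendsto (fun k => ∫ z, f z * φ k z ∂(vol b)) atTop (𝓝 (∫ z, f z * g z ∂(vol b))) := by
  refine tendsto_integral_of_dominated_convergence (fun z => ‖f z‖ * C) ?_ ?_ ?_ ?_
  · exact fun k => (Lp.aestronglyMeasurable f).mul (hφ k).aestronglyMeasurable
  · exact (integrable_Lp b f).norm.mul_const C
  · intro k
    filter_upwards [ae_vol_mem b] with z hz
    rw [norm_mul]
    exact mul_le_mul_of_nonneg_left (hC k z hz) (norm_nonneg _)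
  · filter_upwards [ae_vol_mem b] with z hz
    exact (hg z hz).const_mul _

/-- A cutoff function vanishing near `y = 0` and `y = -b`. -/
def cutoff (b : ℝ) (k : ℕ) (y : ℝ) : ℝ := Real.smoothTransition (k * (-(y * (y + b))) - 1)

lemma contDiff_cutoff (b : ℝ) (k : ℕ) : ContDiff ℝ ((⊤ : ℕ∞) : WithTop ℕ∞) (cutoff b k) :=
  Real.smoothTransition.contDiff.comp (by fun_prop)

lemma contDiff_cutoff_complex (b : ℝ) (k : ℕ) :
    ContDiff ℝ ((⊤ : ℕ∞) : WithTop ℕ∞) (fun y => (cutoff b k y : ℂ)) :=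
  Complex.ofRealCLM.contDiff.comp (contDiff_cutoff b k)

/-- From some k on the cutoff is identically 1 near the given point, so its value and its derivative
both stabilize. -/
lemma eventually_cutoff_arg (b : ℝ) {y : ℝ} (hy : y ∈ Ioo (-b) 0) :
    ∀ᶠ k : ℕ in atTop, 1 < k * (-(y * (y + b))) - 1 := by
  have hd : 0 < -(y * (y + b)) := by nlinarith [hy.1, hy.2]
  have := (tendsto_natCast_atTop_atTop (R := ℝ)).atTop_mul_const hd
  filter_upwards [this.eventually_gt_atTop 2] with k hk
  linarith

lemma norm_cutoff_le (b : ℝ) (k : ℕ) (y : ℝ) : ‖(cutoff b k y : ℂ)‖ ≤ 1 := by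
  rw [Complex.norm_real, cutoff, Real.norm_of_nonneg (Real.smoothTransition.nonneg _)]
  exact Real.smoothTransition.le_one _

lemma tendsto_cutoff {b y : ℝ} (hy : y ∈ Ioo (-b) 0) :
    Tendsto (fun k => (cutoff b k y : ℂ)) atTop (𝓝 1) := by
  refine tendsto_const_nhds.congr' ?_
  filter_upwards [eventually_cutoff_arg b hy] with k hk
  rw [cutoff, Real.smoothTransition.one_of_one_le hk.le, Complex.ofReal_one]

lemma isTest_cutoff_mul {b : ℝ} (hb : 0 < b) {φ : S × ℝ → ℂ} (hφ : IsSmooth φ) (k : ℕ) :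
    IsTest b (fun z => φ z * (cutoff b k z.2 : ℂ)) := by
  -- `Real.smoothTransition` vanishes for nonpositive arguments, so the support lies in a closed set
  -- that stays away from both circles.
  have hsub : tsupport (fun z : S × ℝ => φ z * (cutoff b k z.2 : ℂ)) ⊆
      {z | 1 ≤ k * (-(z.2 * (z.2 + b)))} := by
    refine closure_minimal ?_ (isClosed_le continuous_const (by fun_prop))
    intro z hz
    by_contra hcon
    apply hz
    have hcon' : ¬ (1 : ℝ) ≤ k * (-(z.2 * (z.2 + b))) := hcon
    have : cutoff b k z.2 = 0 := Real.smoothTransition.zero_of_nonpos (by linarith)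
    simp [this]
  have hsub' : {z : S × ℝ | 1 ≤ k * (-(z.2 * (z.2 + b)))} ⊆ univ ×ˢ Ioo (-b) 0 := by
    intro z hz
    have hz : (1 : ℝ) ≤ k * (-(z.2 * (z.2 + b))) := hz
    refine ⟨mem_univ _, ?_⟩
    have h0 : 0 < -(z.2 * (z.2 + b)) := by
      by_contra hcon
      push Not at hcon
      have : (k : ℝ) * (-(z.2 * (z.2 + b))) ≤ 0 :=
        mul_nonpos_of_nonneg_of_nonpos (Nat.cast_nonneg k) hcon
      linarith
    constructor <;> nlinarith
  refine ⟨hφ.mul_snd (contDiff_cutoff_complex b k), ?_, hsub.trans hsub'⟩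
  refine HasCompactSupport.of_support_subset_isCompact
    (isCompact_univ.prod (isCompact_Icc (a := -b) (b := 0))) ?_
  exact (subset_tsupport _).trans (hsub.trans (hsub'.trans
    (prod_mono_right Ioo_subset_Icc_self)))

/-- The cutoff depends on y alone and passes through ∂ₓ, so φ need not vanish on the boundary. -/
lemma H1.integral_partialX {b : ℝ} (hb : 0 < b) (u : H1 b) {φ : S × ℝ → ℂ} (hφ : IsSmooth φ) :
    ∫ z, u.val z * partialX φ z ∂(vol b) = -∫ z, u.dx z * φ z ∂(vol b) := by
  have hχ1 := norm_cutoff_le b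
  have hχ : ∀ y ∈ Ioo (-b) 0, Tendsto (fun k => (cutoff b k y : ℂ)) atTop (𝓝 1) :=
    fun y hy => tendsto_cutoff hy
  have key : ∀ (f : L2Omega b) {φ : S × ℝ → ℂ}, Continuous φ →
      Tendsto (fun k => ∫ z, f z * (φ z * (cutoff b k z.2 : ℂ)) ∂(vol b)) atTop
        (𝓝 (∫ z, f z * φ z ∂(vol b))) := by
    intro f φ hφ
    obtain ⟨C, hC0, hC⟩ := exists_bound_of_continuous b hφ
    refine tendsto_integral_mul b f _ φ C (fun k => ?_) (fun k z hz => ?_) (fun z hz => ?_)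
    · exact hφ.mul ((contDiff_cutoff_complex b k).continuous.comp continuous_snd)
    · rw [norm_mul]
      exact (mul_le_of_le_one_right (norm_nonneg _) (hχ1 _ _)).trans (hC z ⟨hz.1.le, hz.2.le⟩)
    · simpa using (hχ z.2 hz).const_mul (φ z)
  refine tendsto_nhds_unique (key u.val hφ.continuous_partialX) ?_
  refine (key u.dx hφ.continuous).neg.congr fun k => ?_
  rw [← u.weak_dx _ (isTest_cutoff_mul hb hφ k)]
  simp only [hφ.partialX_mul_snd (fun y => (cutoff b k y : ℂ))]

/-- The derivative lives where 1 ≤ t ≤ 2. With t = k d and d = -y(y+b), this bounds the derivative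
of the cutoff by Mb/d uniformly in k. -/
lemma exists_bound_deriv_smoothTransition :
    ∃ M, 0 ≤ M ∧ ∀ t : ℝ, ‖deriv Real.smoothTransition (t - 1) * t‖ ≤ M := by
  have hcont : Continuous (deriv Real.smoothTransition) :=
    (Real.smoothTransition.contDiff (n := 1)).continuous_deriv le_rfl
  have h0 : ∀ s : ℝ, s < 0 ∨ 1 < s → deriv Real.smoothTransition s = 0 := by
    rintro s (hs | hs)
    · have : Real.smoothTransition =ᶠ[𝓝 s] fun _ => 0 := by
        filter_upwards [Iio_mem_nhds hs] with r hr
        exact Real.smoothTransition.zero_of_nonpos (le_of_lt hr)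
      rw [this.deriv_eq]; simp
    · have : Real.smoothTransition =ᶠ[𝓝 s] fun _ => 1 := by
        filter_upwards [Ioi_mem_nhds hs] with r hr
        exact Real.smoothTransition.one_of_one_le (le_of_lt hr)
      rw [this.deriv_eq]; simp
  obtain ⟨M, hM⟩ := (isCompact_Icc (a := (1 : ℝ)) (b := 2)).exists_bound_of_continuousOn
    (f := fun t => deriv Real.smoothTransition (t - 1) * t) (by fun_prop)
  refine ⟨max M 0, le_max_right _ _, fun t => ?_⟩
  by_cases ht : t ∈ Icc (1 : ℝ) 2
  · exact (hM t ht).trans (le_max_left _ _)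
  · rw [h0 (t - 1)]
    · simp
    · by_contra hcon
      push Not at hcon
      exact ht ⟨by linarith, by linarith⟩

lemma hasDerivAt_cutoff (b : ℝ) (k : ℕ) (y : ℝ) :
    HasDerivAt (cutoff b k)
      (deriv Real.smoothTransition (k * (-(y * (y + b))) - 1) * (k * (-(2 * y + b)))) y := by
  have h1 : HasDerivAt (fun y : ℝ => k * (-(y * (y + b))) - 1) (k * (-(2 * y + b))) y := by
    have := ((((hasDerivAt_id y).mul ((hasDerivAt_id y).add_const b)).neg).const_mul
      (k : ℝ)).sub_const 1
    refine this.congr_deriv ?_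
    simp only [id]
    ring
  have h2 := ((Real.smoothTransition.contDiff (n := 1)).differentiable (by simp)
    (k * (-(y * (y + b))) - 1)).hasDerivAt
  exact h2.comp y h1

lemma deriv_cutoff_complex (b : ℝ) (k : ℕ) (y : ℝ) :
    deriv (fun y => (cutoff b k y : ℂ)) y = (deriv (cutoff b k) y : ℝ) := by
  have := (hasDerivAt_cutoff b k y).differentiableAt.hasDerivAt.ofReal_comp
  exact this.deriv

/-- Smooth functions vanishing on both boundary circles are bounded by the distance to them. -/
lemma IsSmooth.exists_bound_dist {b : ℝ} (hb : 0 < b) {φ : S × ℝ → ℂ} (hφ : IsSmooth φ)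
    (h0 : ∀ x, φ (x, 0) = 0) (h1 : ∀ x, φ (x, -b) = 0) :
    ∃ C, 0 ≤ C ∧ ∀ z : S × ℝ, z.2 ∈ Ioo (-b) 0 → ‖φ z‖ * b ≤ C * (-(z.2 * (z.2 + b))) := by
  obtain ⟨C, hC0, hC⟩ := exists_bound_of_continuous b hφ.continuous_partialY
  have key : ∀ (x : S), ∀ y ∈ Icc (-b) 0, ∀ y' ∈ Icc (-b) 0,
      ‖φ (x, y) - φ (x, y')‖ ≤ C * ‖y - y'‖ := by
    intro x y hy y' hy'
    exact (convex_Icc (-b) 0).norm_image_sub_le_of_norm_hasDerivWithin_le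
      (f := fun t => φ (x, t)) (f' := fun t => partialY φ (x, t))
      (fun t _ => (hφ.hasDerivAt_y x t).hasDerivWithinAt) (fun t ht => hC (x, t) ht) hy' hy
  refine ⟨2 * C, by positivity, fun z hz => ?_⟩
  have hz' : z.2 ∈ Icc (-b) 0 := ⟨hz.1.le, hz.2.le⟩
  have e0 := key z.1 z.2 hz' 0 ⟨by linarith, le_rfl⟩
  have e1 := key z.1 z.2 hz' (-b) ⟨le_rfl, by linarith⟩
  rw [h0, sub_zero, sub_zero, Real.norm_of_nonpos hz.2.le] at e0
  rw [h1, sub_zero, Real.norm_of_nonneg (by linarith [hz.1])] at e1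
  have := hz.1
  have := hz.2
  nlinarith

/-- Differentiating the cutoff χ_k produces the term φ χ_k'. Since φ vanishes on both circles, |φ| ≤
C d/b with d = -y(y+b), while |χ_k'| ≤ M b/d; the product is bounded uniformly in k and tends to 0
pointwise. -/
lemma H1.integral_partialY {b : ℝ} (hb : 0 < b) (u : H1 b) {φ : S × ℝ → ℂ} (hφ : IsSmooth φ)
    (h0 : ∀ x, φ (x, 0) = 0) (h1 : ∀ x, φ (x, -b) = 0) :
    ∫ z, u.val z * partialY φ z ∂(vol b) = -∫ z, u.dy z * φ z ∂(vol b) := by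
  have hχ1 := norm_cutoff_le b
  have hχ : ∀ y ∈ Ioo (-b) 0, Tendsto (fun k => (cutoff b k y : ℂ)) atTop (𝓝 1) :=
    fun y hy => tendsto_cutoff hy
  have hχd : ∀ k, Continuous fun y => deriv (fun y => (cutoff b k y : ℂ)) y := fun k =>
    (contDiff_cutoff_complex b k).continuous_deriv (by simp)
  obtain ⟨M, hM0, hM⟩ := exists_bound_deriv_smoothTransition
  obtain ⟨C, hC0, hC⟩ := hφ.exists_bound_dist hb h0 h1
  obtain ⟨C', hC'0, hC'⟩ := exists_bound_of_continuous b hφ.continuous_partialY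
  obtain ⟨C'', hC''0, hC''⟩ := exists_bound_of_continuous b hφ.continuous
  have lim1 : Tendsto (fun k => ∫ z, u.val z *
      (partialY φ z * (cutoff b k z.2 : ℂ) + φ z * deriv (fun y => (cutoff b k y : ℂ)) z.2)
        ∂(vol b)) atTop (𝓝 (∫ z, u.val z * partialY φ z ∂(vol b))) := by
    refine tendsto_integral_mul b u.val _ _ (C' + C * M) (fun k => ?_) (fun k z hz => ?_)
      (fun z hz => ?_)
    · exact (hφ.continuous_partialY.mul
        ((contDiff_cutoff_complex b k).continuous.comp continuous_snd)).add
        (hφ.continuous.mul ((hχd k).comp continuous_snd))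
    · refine (norm_add_le _ _).trans (add_le_add ?_ ?_)
      · rw [norm_mul]
        exact (mul_le_of_le_one_right (norm_nonneg _) (hχ1 _ _)).trans (hC' z ⟨hz.1.le, hz.2.le⟩)
      · rw [deriv_cutoff_complex, (hasDerivAt_cutoff b k z.2).deriv, norm_mul, Complex.norm_real]
        set d := -(z.2 * (z.2 + b)) with hd
        have hdpos : 0 < d := by rw [hd]; nlinarith [hz.1, hz.2]
        have e1 := hM (k * d)
        have e2 : |-(2 * z.2 + b)| ≤ b := abs_le.2 ⟨by linarith [hz.2], by linarith [hz.1]⟩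
        have e3 : ‖deriv Real.smoothTransition (k * d - 1) * (k * (-(2 * z.2 + b)))‖ * d ≤
            M * b := by
          calc ‖deriv Real.smoothTransition (k * d - 1) * (k * (-(2 * z.2 + b)))‖ * d
              = ‖deriv Real.smoothTransition (k * d - 1) * (k * d)‖ * |-(2 * z.2 + b)| := by
                simp only [norm_mul, Real.norm_eq_abs, abs_of_pos hdpos]; ring
            _ ≤ M * b := mul_le_mul e1 e2 (abs_nonneg _) hM0
        have e4 := hC z hz
        rw [← hd] at e4
        set D := ‖deriv Real.smoothTransition (k * d - 1) * (k * (-(2 * z.2 + b)))‖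
        have hD : 0 ≤ D := norm_nonneg _
        have e5 : (‖φ z‖ * D) * (b * d) ≤ (C * M) * (b * d) := by
          calc (‖φ z‖ * D) * (b * d) = (‖φ z‖ * b) * (D * d) := by ring
            _ ≤ (C * d) * (M * b) := mul_le_mul e4 e3 (by positivity) (by positivity)
            _ = _ := by ring
        exact le_of_mul_le_mul_right e5 (by positivity)
    · have e1 := (hχ z.2 hz).const_mul (partialY φ z)
      have e2 : Tendsto (fun k => φ z * deriv (fun y => (cutoff b k y : ℂ)) z.2) atTop (𝓝 0) := by
        refine tendsto_const_nhds.congr' ?_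
        filter_upwards [eventually_cutoff_arg b hz] with k hk
        rw [deriv_cutoff_complex, (hasDerivAt_cutoff b k z.2).deriv]
        have : Real.smoothTransition =ᶠ[𝓝 (k * (-(z.2 * (z.2 + b))) - 1)] fun _ => 1 := by
          filter_upwards [Ioi_mem_nhds hk] with r hr
          exact Real.smoothTransition.one_of_one_le (le_of_lt hr)
        rw [this.deriv_eq]
        simp
      simpa using e1.add e2
  have lim2 : Tendsto (fun k => ∫ z, u.dy z * (φ z * (cutoff b k z.2 : ℂ)) ∂(vol b)) atTop
      (𝓝 (∫ z, u.dy z * φ z ∂(vol b))) := by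
    refine tendsto_integral_mul b u.dy _ φ C'' (fun k => ?_) (fun k z hz => ?_) (fun z hz => ?_)
    · exact hφ.continuous.mul ((contDiff_cutoff_complex b k).continuous.comp continuous_snd)
    · rw [norm_mul]
      exact (mul_le_of_le_one_right (norm_nonneg _) (hχ1 _ _)).trans (hC'' z ⟨hz.1.le, hz.2.le⟩)
    · simpa using (hχ z.2 hz).const_mul (φ z)
  refine tendsto_nhds_unique lim1 (lim2.neg.congr fun k => ?_)
  rw [← u.weak_dy _ (isTest_cutoff_mul hb hφ k)]
  simp only [hφ.partialY_mul_snd ((contDiff_cutoff_complex b k).differentiable (by simp))]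

/-! ### Bessel's inequality for orthogonal families -/

/-- The space `ℓ²` of Fourier coefficients. -/
abbrev Seq : Type := lp (fun _ : ℤ => ℂ) 2

/-- Bessel's inequality without normalization. For w = ∑ cᵢ fᵢ and A = ∑ |cᵢ|² one has ⟨w, u⟩ = A
and ‖w‖² ≤ C² A, so Cauchy-Schwarz gives A² ≤ C² A ‖u‖². -/
lemma sum_norm_inner_sq_le {H ι : Type*} [NormedAddCommGroup H] [InnerProductSpace ℂ H]
    {f : ι → H} {C : ℝ} (hf : Pairwise fun i j => inner ℂ (f i) (f j) = 0)
    (hC : ∀ i, ‖f i‖ ≤ C) (u : H) (s : Finset ι) :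
    ∑ i ∈ s, ‖inner ℂ (f i) u‖ ^ 2 ≤ C ^ 2 * ‖u‖ ^ 2 := by
  classical
  set c : ι → ℂ := fun i => inner ℂ (f i) u with hc
  set A := ∑ i ∈ s, ‖c i‖ ^ 2 with hA
  have hA0 : 0 ≤ A := by positivity
  set w : H := ∑ i ∈ s, c i • f i with hw
  have h1 : inner ℂ w u = (A : ℂ) := by
    rw [hw, sum_inner, hA]
    push_cast
    refine Finset.sum_congr rfl fun i _ => ?_
    rw [inner_smul_left, Complex.conj_mul']
  have h2 : ‖w‖ ^ 2 ≤ C ^ 2 * A := by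
    have : ((‖w‖ ^ 2 : ℝ) : ℂ) = ((∑ i ∈ s, ‖c i‖ ^ 2 * ‖f i‖ ^ 2 : ℝ) : ℂ) := by
      have e := inner_self_eq_norm_sq_to_K (𝕜 := ℂ) w
      push_cast
      refine e.symm.trans ?_
      conv_lhs => rw [hw, sum_inner]
      refine Finset.sum_congr rfl fun i hi => ?_
      rw [inner_sum, Finset.sum_eq_single_of_mem i hi]
      · rw [inner_smul_left, inner_smul_right, ← mul_assoc, Complex.conj_mul',
          inner_self_eq_norm_sq_to_K]
        rfl
      · intro j _ hj
        rw [inner_smul_left, inner_smul_right, hf hj.symm]; simp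
    have h3 := Complex.ofReal_injective this
    rw [h3, hA, Finset.mul_sum]
    refine Finset.sum_le_sum fun i _ => ?_
    rw [mul_comm]
    exact mul_le_mul_of_nonneg_right (pow_le_pow_left₀ (norm_nonneg _) (hC i) 2) (by positivity)
  have h4 : A ≤ ‖w‖ * ‖u‖ := by
    have := norm_inner_le_norm (𝕜 := ℂ) w u
    rwa [h1, Complex.norm_real, Real.norm_of_nonneg hA0] at this
  have h5 : A * A ≤ (C ^ 2 * ‖u‖ ^ 2) * A := by
    calc A * A ≤ (‖w‖ * ‖u‖) * (‖w‖ * ‖u‖) := mul_self_le_mul_self hA0 h4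
      _ = ‖w‖ ^ 2 * ‖u‖ ^ 2 := by ring
      _ ≤ (C ^ 2 * A) * ‖u‖ ^ 2 := by gcongr
      _ = _ := by ring
  rcases hA0.eq_or_lt with h | h
  · rw [← h]; positivity
  · exact le_of_mul_le_mul_right h5 h

/-- The coefficient map `u ↦ (⟨fₙ, u⟩)ₙ` of a bounded orthogonal family. -/
def besselCLM {H : Type*} [NormedAddCommGroup H] [InnerProductSpace ℂ H]
    (f : ℤ → H) (C : ℝ) (hf : Pairwise fun i j => inner ℂ (f i) (f j) = 0)
    (hC : ∀ i, ‖f i‖ ≤ C) : H →L[ℂ] Seq :=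
  LinearMap.mkContinuous
    { toFun := fun u => ⟨fun n => inner ℂ (f n) u, memℓp_gen'
        (C := C ^ 2 * ‖u‖ ^ 2) (fun s => by
          simpa using sum_norm_inner_sq_le hf hC u s)⟩
      map_add' := fun u v => by ext n; exact inner_add_right _ _ _
      map_smul' := fun a u => by ext n; exact inner_smul_right _ _ _ } |C| (fun u => by
    refine lp.norm_le_of_forall_sum_le (by norm_num) (by positivity) fun s => ?_
    have := sum_norm_inner_sq_le hf hC u s
    simpa [mul_pow] using this)

lemma sum_norm_mul_rpow_le {m : ℤ → ℂ} {C : ℝ} (hC : ∀ n, ‖m n‖ ≤ C) (u : Seq) (s : Finset ℤ) :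
    ∑ n ∈ s, ‖m n * u n‖ ^ (2 : ℝ≥0∞).toReal ≤ (|C| * ‖u‖) ^ (2 : ℝ≥0∞).toReal := by
  rw [Real.mul_rpow (abs_nonneg _) (norm_nonneg _)]
  refine le_trans ?_ (mul_le_mul_of_nonneg_left
    (lp.sum_rpow_le_norm_rpow (by norm_num) u s) (by positivity))
  rw [Finset.mul_sum]
  refine Finset.sum_le_sum fun n _ => ?_
  rw [norm_mul, Real.mul_rpow (norm_nonneg _) (norm_nonneg _)]
  gcongr
  exact (hC n).trans (le_abs_self C)

/-- The diagonal operator on `ℓ²` with bounded multiplier `m`. -/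
def diagCLM (m : ℤ → ℂ) (C : ℝ) (hC : ∀ n, ‖m n‖ ≤ C) : Seq →L[ℂ] Seq :=
  LinearMap.mkContinuous
    { toFun := fun u => ⟨fun n => m n * u n, memℓp_gen' (sum_norm_mul_rpow_le hC u)⟩
      map_add' := fun u v => by ext n; exact mul_add _ _ _
      map_smul' := fun a u => by ext n; simp; ring } |C| (fun u =>
    lp.norm_le_of_forall_sum_le (by norm_num) (by positivity) (sum_norm_mul_rpow_le hC u))

lemma norm_le_of_forall_norm_apply_le {m : ℤ → ℂ} {C : ℝ} (hC : ∀ n, ‖m n‖ ≤ C) (hC0 : 0 ≤ C)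
    (u w : Seq) (hw : ∀ n, w n = m n * u n) : ‖w‖ ≤ C * ‖u‖ := by
  refine lp.norm_le_of_forall_sum_le (by norm_num) (by positivity) fun s => ?_
  have := sum_norm_mul_rpow_le hC u s
  rw [abs_of_nonneg hC0] at this
  simpa only [hw] using this

/-! ### Tensor products of exponentials and functions of `y` -/

/-- The function `e^{inx} ψ(y)`. -/
def tens (n : ℤ) (ψ : C(ℝ, ℂ)) : C(S × ℝ, ℂ) :=
  ⟨fun z => fourier n z.1 * ψ z.2, by fun_prop⟩

@[simp] lemma tens_apply (n : ℤ) (ψ : C(ℝ, ℂ)) (z : S × ℝ) :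
    tens n ψ z = fourier n z.1 * ψ z.2 := rfl

lemma integral_fourier (n : ℤ) :
    ∫ x : S, (fourier n x : ℂ) = if n = 0 then 2 * (Real.pi : ℂ) else 0 := by
  have h := AddCircle.integral_haarAddCircle (T := 2 * Real.pi)
    (f := fun x : S => (fourier n x : ℂ))
  have h2 := fourierCoeff_fourier (T := 2 * Real.pi) n
  have h3 := congrFun h2 0
  rw [fourierCoeff] at h3
  simp only [neg_zero, fourier_zero, one_smul] at h3
  have h4 : ∫ x : S, (fourier n x : ℂ) =
      (2 * Real.pi : ℝ) • ∫ x : S, (fourier n x : ℂ) ∂AddCircle.haarAddCircle := by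
    rw [h, smul_smul, mul_inv_cancel₀ (by positivity), one_smul]
  rw [h4]
  have h5 : ∫ x : S, (fourier n x : ℂ) ∂AddCircle.haarAddCircle = if n = 0 then 1 else 0 := by
    refine Eq.trans h3 ?_
    by_cases hn : n = 0
    · subst hn; simp
    · simp [hn, Ne.symm hn]
  rw [h5]
  split_ifs <;> simp

lemma integral_conj_fourier_mul (n m : ℤ) :
    ∫ x : S, conj (fourier n x : ℂ) * fourier m x = if n = m then 2 * (Real.pi : ℂ) else 0 := by
  have : ∀ x : S, conj (fourier n x : ℂ) * fourier m x = fourier (m - n) x := by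
    intro x
    rw [← fourier_neg, ← fourier_add]
    congr 2; ring
  simp only [this, integral_fourier, sub_eq_zero, eq_comm]

lemma inner_toL2_tens (b : ℝ) (n m : ℤ) (ψ χ : C(ℝ, ℂ)) :
    inner ℂ (toL2 b (tens n ψ)) (toL2 b (tens m χ)) =
      (if n = m then 2 * (Real.pi : ℂ) else 0) * ∫ y in Ioo (-b) 0, conj (ψ y) * χ y := by
  have h1 : inner ℂ (toL2 b (tens n ψ)) (toL2 b (tens m χ)) =
      ∫ z, (conj (fourier n z.1 : ℂ) * fourier m z.1) * (conj (ψ z.2) * χ z.2) ∂(vol b) := by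
    rw [inner_toL2]
    refine integral_congr_ae ?_
    filter_upwards [coeFn_toL2 b (tens m χ)] with z hz
    rw [hz]
    simp only [tens_apply, map_mul]
    ring
  rw [h1, ← integral_conj_fourier_mul, vol_eq_prod]
  exact integral_prod_mul (fun x : S => conj (fourier n x : ℂ) * fourier m x)
    (fun y : ℝ => conj (ψ y) * χ y)

lemma inner_toL2_tens_of_ne (b : ℝ) {n m : ℤ} (h : n ≠ m) (ψ χ : C(ℝ, ℂ)) :
    inner ℂ (toL2 b (tens n ψ)) (toL2 b (tens m χ)) = 0 := by
  simp [inner_toL2_tens, h]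

lemma norm_toL2_tens_sq (b : ℝ) (n : ℤ) (ψ : C(ℝ, ℂ)) :
    ‖toL2 b (tens n ψ)‖ ^ 2 = 2 * Real.pi * ∫ y in Ioo (-b) 0, ‖ψ y‖ ^ 2 := by
  have h := inner_self_eq_norm_sq_to_K (𝕜 := ℂ) (toL2 b (tens n ψ))
  rw [inner_toL2_tens] at h
  simp only [if_true, Complex.conj_mul'] at h
  have h2 : (∫ y in Ioo (-b) 0, ((‖ψ y‖ : ℂ)) ^ 2) = ((∫ y in Ioo (-b) 0, ‖ψ y‖ ^ 2 : ℝ) : ℂ) := by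
    rw [← integral_complex_ofReal]; simp
  rw [h2] at h
  have : ((‖toL2 b (tens n ψ)‖ ^ 2 : ℝ) : ℂ) =
      ((2 * Real.pi * ∫ y in Ioo (-b) 0, ‖ψ y‖ ^ 2 : ℝ) : ℂ) := by
    push_cast
    exact h.symm
  exact Complex.ofReal_injective this

/-! ### The Sobolev space as a Hilbert space -/

/-- The ambient space of `H¹(Ω)`: triples of functions in `L²(Ω)`. -/
abbrev Triple (b : ℝ) : Type := PiLp 2 (fun _ : Fin 3 => L2Omega b)

/-- The functional `f ↦ ∫ fᵢ φ' + ∫ fⱼ φ` on triples. -/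
def weakFunctional (b : ℝ) (j : Fin 3) (φ' φ : C(S × ℝ, ℂ)) : Triple b →L[ℂ] ℂ :=
  (innerSL ℂ (toL2 b (star φ'))).comp (PiLp.proj 2 (fun _ : Fin 3 => L2Omega b) 0) +
    (innerSL ℂ (toL2 b (star φ))).comp (PiLp.proj 2 (fun _ : Fin 3 => L2Omega b) j)

lemma weakFunctional_apply (b : ℝ) (j : Fin 3) (φ' φ : C(S × ℝ, ℂ)) (f : Triple b) :
    weakFunctional b j φ' φ f =
      (∫ z, f 0 z * φ' z ∂(vol b)) + ∫ z, f j z * φ z ∂(vol b) := by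
  rw [← inner_toL2_star, ← inner_toL2_star]; rfl

/-- `H¹(Ω)` as a closed subspace of the Hilbert space of triples `(u, ∂ₓu, ∂_y u)`. -/
def V (b : ℝ) : Submodule ℂ (Triple b) :=
  (⨅ φ : {φ : S × ℝ → ℂ // IsTest b φ}, (weakFunctional b 1
      ⟨partialX φ, φ.2.1.continuous_partialX⟩ ⟨φ, φ.2.1.continuous⟩).ker) ⊓
    ⨅ φ : {φ : S × ℝ → ℂ // IsTest b φ}, (weakFunctional b 2
      ⟨partialY φ, φ.2.1.continuous_partialY⟩ ⟨φ, φ.2.1.continuous⟩).ker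

lemma mem_V_iff {b : ℝ} {f : Triple b} : f ∈ V b ↔
    (∀ φ : S × ℝ → ℂ, IsTest b φ →
      ∫ z, f 0 z * partialX φ z ∂(vol b) = -∫ z, f 1 z * φ z ∂(vol b)) ∧
    (∀ φ : S × ℝ → ℂ, IsTest b φ →
      ∫ z, f 0 z * partialY φ z ∂(vol b) = -∫ z, f 2 z * φ z ∂(vol b)) := by
  simp [V, Submodule.mem_iInf, weakFunctional_apply, eq_neg_iff_add_eq_zero]

lemma isClosed_V (b : ℝ) : IsClosed (V b : Set (Triple b)) := by
  rw [V, Submodule.coe_inf, Submodule.coe_iInf, Submodule.coe_iInf]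
  exact (isClosed_iInter fun φ => ContinuousLinearMap.isClosed_ker _).inter
    (isClosed_iInter fun φ => ContinuousLinearMap.isClosed_ker _)

instance completeSpace_V (b : ℝ) : CompleteSpace (V b) := (isClosed_V b).completeSpace_coe

/-- The `H¹` function given by an element of the Hilbert space. -/
def toH1 {b : ℝ} (u : V b) : H1 b :=
  ⟨u.1 0, u.1 1, u.1 2, (mem_V_iff.1 u.2).1, (mem_V_iff.1 u.2).2⟩

/-- The element of the Hilbert space given by an `H¹` function. -/
def H1.toV {b : ℝ} (u : H1 b) : V b :=
  ⟨WithLp.toLp 2 ![u.val, u.dx, u.dy], mem_V_iff.2 ⟨u.weak_dx, u.weak_dy⟩⟩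

lemma toH1_toV {b : ℝ} (u : H1 b) : toH1 u.toV = u := rfl

/-- The inclusion of `H¹(Ω)` into `L²(Ω)`. -/
def valL (b : ℝ) : V b →L[ℂ] L2Omega b :=
  (PiLp.proj 2 (fun _ : Fin 3 => L2Omega b) 0).comp (V b).subtypeL

/-- The derivative in `x` on `H¹(Ω)`. -/
def dxL (b : ℝ) : V b →L[ℂ] L2Omega b :=
  (PiLp.proj 2 (fun _ : Fin 3 => L2Omega b) 1).comp (V b).subtypeL

/-- The derivative in `y` on `H¹(Ω)`. -/
def dyL (b : ℝ) : V b →L[ℂ] L2Omega b :=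
  (PiLp.proj 2 (fun _ : Fin 3 => L2Omega b) 2).comp (V b).subtypeL

lemma toH1_val {b : ℝ} (u : V b) : (toH1 u).val = valL b u := rfl
lemma toH1_dx {b : ℝ} (u : V b) : (toH1 u).dx = dxL b u := rfl
lemma toH1_dy {b : ℝ} (u : V b) : (toH1 u).dy = dyL b u := rfl

lemma norm_sq_V {b : ℝ} (u : V b) :
    ‖u‖ ^ 2 = ‖valL b u‖ ^ 2 + ‖dxL b u‖ ^ 2 + ‖dyL b u‖ ^ 2 := by
  have := PiLp.norm_sq_eq_of_L2 (fun _ : Fin 3 => L2Omega b) u.1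
  rw [Fin.sum_univ_three] at this
  exact this

/-! ### Multiplication operators and functions of `x` alone -/

/-- Multiplication by an `L^∞` function on `L²(Ω)`. -/
def mulL {b : ℝ} (ρ : LinfOmega b) : L2Omega b →L[ℂ] L2Omega b :=
  (ContinuousLinearMap.mul ℂ ℂ).holderL (vol b) ∞ 2 2 ρ

lemma coeFn_mulL {b : ℝ} (ρ : LinfOmega b) (f : L2Omega b) :
    mulL ρ f =ᵐ[vol b] fun z => ρ z * f z :=
  (ContinuousLinearMap.mul ℂ ℂ).coeFn_holder ρ f

/-- The class in `L^∞(Ω)` of a continuous function. -/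
def toLinf (b : ℝ) (χ : C(S × ℝ, ℂ)) : LinfOmega b :=
  (memLp_of_continuous b χ.continuous ∞).toLp χ

lemma coeFn_toLinf (b : ℝ) (χ : C(S × ℝ, ℂ)) : toLinf b χ =ᵐ[vol b] χ := MemLp.coeFn_toLp _

lemma inner_toL2_mulL (b : ℝ) (ψ χ : C(S × ℝ, ℂ)) (f : L2Omega b) :
    inner ℂ (toL2 b ψ) (mulL (toLinf b χ) f) = ∫ z, f z * (χ z * conj (ψ z)) ∂(vol b) := by
  rw [inner_toL2]
  refine integral_congr_ae ?_
  filter_upwards [coeFn_mulL (toLinf b χ) f, coeFn_toLinf b χ] with z h1 h2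
  rw [h1, h2]; ring

lemma eLpNorm_comp_fst_vol (b : ℝ) {f : S → ℂ} (hf : AEStronglyMeasurable f volume) :
    eLpNorm (fun z : S × ℝ => f z.1) 2 (vol b) =
      ENNReal.ofReal b ^ (1 / (2 : ℝ)) * eLpNorm f 2 volume := by
  have hmap : (vol b).map Prod.fst = ENNReal.ofReal b • (volume : Measure S) := by
    rw [vol_eq_prod, Measure.map_fst_prod]
    simp
  have h1 : AEStronglyMeasurable f ((vol b).map Prod.fst) := by
    rw [hmap]; exact hf.smul_measure _
  have h2 := eLpNorm_map_measure (p := 2) h1 measurable_fst.aemeasurable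
  rw [hmap, eLpNorm_smul_measure_of_ne_top (by norm_num)] at h2
  rw [← Function.comp_def, ← h2]
  simp

/-- The pull-back `f ↦ ((x, y) ↦ f x)` from `L²(𝒮)` to `L²(Ω)`. -/
def pullFst (b : ℝ) : L2Gamma →L[ℂ] L2Omega b :=
  have hmem : ∀ f : L2Gamma, MemLp (fun z : S × ℝ => f z.1) 2 (vol b) := fun f => by
    rw [vol_eq_prod]; exact (Lp.memLp f).comp_fst _
  have hqmp : Measure.QuasiMeasurePreserving (Prod.fst : S × ℝ → S) (vol b) volume := by
    rw [vol_eq_prod]; exact Measure.quasiMeasurePreserving_fst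
  LinearMap.mkContinuous
    { toFun := fun f => (hmem f).toLp _
      map_add' := fun f g => by
        rw [← MemLp.toLp_add]
        exact MemLp.toLp_congr _ ((hmem f).add (hmem g)) (hqmp.ae_eq_comp (Lp.coeFn_add f g))
      map_smul' := fun a f => by
        rw [RingHom.id_apply, ← MemLp.toLp_const_smul]
        exact MemLp.toLp_congr _ ((hmem f).const_smul a) (hqmp.ae_eq_comp (Lp.coeFn_smul a f)) }
    (ENNReal.ofReal b ^ (1 / (2 : ℝ))).toReal (fun f => by
      change ‖(hmem f).toLp _‖ ≤ _
      rw [Lp.norm_toLp]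
      rw [eLpNorm_comp_fst_vol b (Lp.aestronglyMeasurable f), ENNReal.toReal_mul, Lp.norm_def])

lemma coeFn_pullFst (b : ℝ) (f : L2Gamma) : pullFst b f =ᵐ[vol b] fun z => f z.1 :=
  MemLp.coeFn_toLp (by rw [vol_eq_prod]; exact (Lp.memLp f).comp_fst _)

/-- The class in `L²(𝒮)` of a continuous function. -/
def toL2S : C(S, ℂ) →L[ℂ] L2Gamma := ContinuousMap.toLp 2 volume ℂ

lemma coeFn_toL2S (φ : C(S, ℂ)) : toL2S φ =ᵐ[volume] φ := ContinuousMap.coeFn_toLp _ _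

lemma inner_toL2S (φ : C(S, ℂ)) (f : L2Gamma) :
    inner ℂ (toL2S φ) f = ∫ x, f x * conj (φ x) := by
  rw [L2.inner_def]
  refine integral_congr_ae ?_
  filter_upwards [coeFn_toL2S φ] with z hz
  rw [hz]; rfl

lemma pullFst_toL2S (b : ℝ) (φ : C(S, ℂ)) :
    pullFst b (toL2S φ) = toL2 b (φ.comp ContinuousMap.fst) := by
  have hqmp : Measure.QuasiMeasurePreserving (Prod.fst : S × ℝ → S) (vol b) volume := by
    rw [vol_eq_prod]; exact Measure.quasiMeasurePreserving_fst
  refine Lp.ext ?_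
  filter_upwards [coeFn_pullFst b (toL2S φ), coeFn_toL2 b (φ.comp ContinuousMap.fst),
    hqmp.ae_eq_comp (coeFn_toL2S φ)] with z h1 h2 h3
  rw [h1, h2]
  exact h3

lemma integral_adjoint_pullFst (b : ℝ) (χ : C(S × ℝ, ℂ)) (f : L2Omega b) (φ : C(S, ℂ)) :
    ∫ x, (pullFst b).adjoint (mulL (toLinf b χ) f) x * φ x =
      ∫ z, f z * (χ z * φ z.1) ∂(vol b) := by
  have h1 := inner_toL2S (star φ) ((pullFst b).adjoint (mulL (toLinf b χ) f))
  rw [ContinuousLinearMap.adjoint_inner_right, pullFst_toL2S, inner_toL2_mulL] at h1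
  simpa using h1.symm

/-! ### Traces -/

lemma integrable_mul_continuous (b : ℝ) (f : L2Omega b) {φ : S × ℝ → ℂ} (hφ : Continuous φ) :
    Integrable (fun z => f z * φ z) (vol b) := by
  obtain ⟨C, hC0, hC⟩ := exists_bound_of_continuous b hφ
  refine (integrable_Lp b f).mul_bdd (c := C) hφ.aestronglyMeasurable ?_
  filter_upwards [ae_vol_mem b] with z hz using hC z ⟨hz.1.le, hz.2.le⟩

lemma integrable_mul_continuous_S (f : L2Gamma) {φ : S → ℂ} (hφ : Continuous φ) :
    Integrable (fun x => f x * φ x) := by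
  obtain ⟨C, hC⟩ := isCompact_univ.exists_bound_of_continuousOn hφ.continuousOn
  exact ((Lp.memLp f).integrable (by norm_num)).mul_bdd (c := C) hφ.aestronglyMeasurable
    (ae_of_all _ fun x => hC x (mem_univ _))

/-- The function `c + d y` on the slab. -/
def affY (c d : ℝ) : C(S × ℝ, ℂ) := ⟨fun z => ((c + d * z.2 : ℝ) : ℂ), by fun_prop⟩

lemma contDiff_affine (c d : ℝ) :
    ContDiff ℝ ((⊤ : ℕ∞) : WithTop ℕ∞) (fun y : ℝ => ((c + d * y : ℝ) : ℂ)) :=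
  Complex.ofRealCLM.contDiff.comp (contDiff_const.add (contDiff_const.mul contDiff_id))

/-- The trace `u ↦ u|_{Γ₀}` on `H¹(Ω)`. -/
def traceTop (b : ℝ) : V b →L[ℂ] L2Gamma :=
  -- The adjoint of `pullFst` integrates over y, so this is ∫ ∂_y((1 + y/b) u) dy; the weight is 1
  -- on the upper circle and 0 on the lower one.
  (pullFst b).adjoint.comp ((mulL (toLinf b (affY b⁻¹ 0))).comp (valL b)) +
    (pullFst b).adjoint.comp ((mulL (toLinf b (affY 1 b⁻¹))).comp (dyL b))

/-- The trace `u ↦ u|_{Γ_b}` on `H¹(Ω)`. -/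
def traceBot (b : ℝ) : V b →L[ℂ] L2Gamma :=
  -- Now the weight is y/b, equal to 0 on the upper circle and -1 on the lower one; the sign cancels
  -- that of the lower endpoint.
  (pullFst b).adjoint.comp ((mulL (toLinf b (affY b⁻¹ 0))).comp (valL b)) +
    (pullFst b).adjoint.comp ((mulL (toLinf b (affY 0 b⁻¹))).comp (dyL b))

lemma integral_add_adjoint_pullFst (b : ℝ) (χ₁ χ₂ : C(S × ℝ, ℂ)) (f₁ f₂ : L2Omega b)
    (φ : C(S, ℂ)) :
    ∫ x, ((pullFst b).adjoint (mulL (toLinf b χ₁) f₁) +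
        (pullFst b).adjoint (mulL (toLinf b χ₂) f₂) : L2Gamma) x * φ x =
      (∫ z, f₁ z * (χ₁ z * φ z.1) ∂(vol b)) + ∫ z, f₂ z * (χ₂ z * φ z.1) ∂(vol b) := by
  rw [← integral_adjoint_pullFst, ← integral_adjoint_pullFst, ← integral_add
    (integrable_mul_continuous_S _ φ.continuous) (integrable_mul_continuous_S _ φ.continuous)]
  refine integral_congr_ae ?_
  filter_upwards [Lp.coeFn_add ((pullFst b).adjoint (mulL (toLinf b χ₁) f₁))
    ((pullFst b).adjoint (mulL (toLinf b χ₂) f₂))] with x hx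
  rw [hx, Pi.add_apply, add_mul]

/-- Subtracting from φ the affine interpolation in y of its boundary values leaves a function
vanishing on both circles, for which `H1.integral_partialY` applies. The interpolant accounts for
exactly the two trace integrals. -/
lemma isTrace_trace {b : ℝ} (hb : 0 < b) (u : V b) :
    IsTrace (toH1 u) (traceTop b u) (traceBot b u) := by
  intro φ hφ
  have hb' : (b : ℂ) ≠ 0 := by exact_mod_cast hb.ne'
  let φ₀ : C(S, ℂ) := ⟨fun x => φ (x, 0), hφ.continuous.comp (by fun_prop)⟩
  let φ₁ : C(S, ℂ) := ⟨fun x => φ (x, -b), hφ.continuous.comp (by fun_prop)⟩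
  have hs₀ : IsSmooth (fun z => φ (z.1, 0)) := hφ.restrict_snd 0
  have hs₁ : IsSmooth (fun z => φ (z.1, -b)) := hφ.restrict_snd (-b)
  have ha := contDiff_affine
  have had : ∀ c d y : ℝ, deriv (fun y : ℝ => ((c + d * y : ℝ) : ℂ)) y = d := fun c d y => by
    have : HasDerivAt (fun y : ℝ => c + d * y) d y := by
      simpa using ((hasDerivAt_id y).const_mul d).const_add c
    exact this.ofReal_comp.deriv
  have hm₀ := hs₀.mul_snd (ha 1 b⁻¹)
  have hm₁ := hs₁.mul_snd (ha 0 (-b⁻¹))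
  have hint := (toH1 u).integral_partialY hb ((hφ.sub hm₀).sub hm₁) (by intro x; simp)
    (by intro x; simp [hb'])
  have hd : ∀ z, partialY (fun z => φ z - φ (z.1, 0) * ((1 + b⁻¹ * z.2 : ℝ) : ℂ) -
      φ (z.1, -b) * ((0 + -b⁻¹ * z.2 : ℝ) : ℂ)) z =
      partialY φ z - affY b⁻¹ 0 z * φ₀ z.1 + affY b⁻¹ 0 z * φ₁ z.1 := by
    intro z
    rw [(hφ.sub hm₀).partialY_sub hm₁, hφ.partialY_sub hm₀,
      hs₀.partialY_mul_snd ((ha 1 b⁻¹).differentiable (by simp)),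
      hs₁.partialY_mul_snd ((ha 0 (-b⁻¹)).differentiable (by simp)),
      had, had, partialY_restrict_snd, partialY_restrict_snd]
    simp [affY, φ₀, φ₁]
    ring
  have hd' : ∀ z, φ z - φ (z.1, 0) * ((1 + b⁻¹ * z.2 : ℝ) : ℂ) -
      φ (z.1, -b) * ((0 + -b⁻¹ * z.2 : ℝ) : ℂ) =
      φ z - affY 1 b⁻¹ z * φ₀ z.1 + affY 0 b⁻¹ z * φ₁ z.1 := by
    intro z
    simp [affY, φ₀, φ₁]
    ring
  have split : ∀ (f : L2Omega b) (φ χ₀ χ₁ : S × ℝ → ℂ), Continuous φ → Continuous χ₀ →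
      Continuous χ₁ → ∫ z, f z * (φ z - χ₀ z + χ₁ z) ∂(vol b) = (∫ z, f z * φ z ∂(vol b)) -
        (∫ z, f z * χ₀ z ∂(vol b)) + ∫ z, f z * χ₁ z ∂(vol b) := by
    intro f φ χ₀ χ₁ h h₀ h₁
    rw [← integral_sub (integrable_mul_continuous b f h) (integrable_mul_continuous b f h₀)]
    refine Eq.trans (integral_congr_ae (ae_of_all _ fun z => ?_))
      (integral_add ((integrable_mul_continuous b f h).sub (integrable_mul_continuous b f h₀))
        (integrable_mul_continuous b f h₁))
    ring
  simp only [hd] at hint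
  simp only [hd'] at hint
  rw [split (toH1 u).val (partialY φ) (fun z => affY b⁻¹ 0 z * φ₀ z.1)
      (fun z => affY b⁻¹ 0 z * φ₁ z.1) hφ.continuous_partialY (by fun_prop) (by fun_prop),
    split (toH1 u).dy φ (fun z => affY 1 b⁻¹ z * φ₀ z.1)
      (fun z => affY 0 b⁻¹ z * φ₁ z.1) hφ.continuous (by fun_prop) (by fun_prop)] at hint
  have e0 := integral_add_adjoint_pullFst b (affY b⁻¹ 0) (affY 1 b⁻¹) (valL b u) (dyL b u) φ₀
  have e1 := integral_add_adjoint_pullFst b (affY b⁻¹ 0) (affY 0 b⁻¹) (valL b u) (dyL b u) φ₁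
  have e0' : ∫ x, traceTop b u x * φ (x, 0) = _ := e0
  have e1' : ∫ x, traceBot b u x * φ (x, -b) = _ := e1
  rw [e0', e1']
  simp only [toH1_val, toH1_dy] at hint ⊢
  linear_combination hint

lemma two_pi_mul_fourierCoeff (f : S → ℂ) (n : ℤ) :
    2 * (Real.pi : ℂ) * fourierCoeff f n = ∫ x, f x * fourier (-n) x := by
  rw [fourierCoeff, AddCircle.integral_haarAddCircle]
  rw [Complex.real_smul]
  have : (2 * (Real.pi : ℂ)) * ((2 * Real.pi : ℝ)⁻¹ : ℝ) = 1 := by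
    have : (Real.pi : ℂ) ≠ 0 := by exact_mod_cast Real.pi_ne_zero
    push_cast
    field_simp
  rw [← mul_assoc, this, one_mul]
  simp [mul_comm]

lemma eq_of_forall_fourierCoeff_eq {f g : L2Gamma}
    (h : ∀ n, fourierCoeff (f : S → ℂ) n = fourierCoeff (g : S → ℂ) n) : f = g := by
  have hf : MemLp f 2 (AddCircle.haarAddCircle (T := 2 * Real.pi)) :=
    memLp_haarAddCircle_iff.2 (Lp.memLp f)
  have hg : MemLp g 2 (AddCircle.haarAddCircle (T := 2 * Real.pi)) :=
    memLp_haarAddCircle_iff.2 (Lp.memLp g)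
  have h1 : hf.toLp f = hg.toLp g := by
    apply (fourierBasis (T := 2 * Real.pi)).repr.injective
    ext n
    rw [fourierBasis_repr, fourierBasis_repr, fourierCoeff_congr_ae hf.coeFn_toLp,
      fourierCoeff_congr_ae hg.coeFn_toLp, h]
  have h2 : f =ᵐ[AddCircle.haarAddCircle (T := 2 * Real.pi)] g := (MemLp.toLp_eq_toLp_iff _ _).1 h1
  refine Lp.ext ?_
  have h3 : (volume : Measure S) ≪ AddCircle.haarAddCircle := by
    rw [AddCircle.volume_eq_smul_haarAddCircle]
    exact Measure.AbsolutelyContinuous.rfl.smul_left _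
  exact h3.ae_le h2

/-- Taking ψ equal to 1 on one circle and 0 on the other reads off a single coefficient of a single
trace. Affine ψ gives uniqueness; high powers, concentrated near the boundary, give the weighted
trace estimate. -/
lemma IsTrace.fourierCoeff_eq {b : ℝ} {u : H1 b} {τ₀ τb : L2Gamma} (h : IsTrace u τ₀ τb)
    (n : ℤ) {ψ : ℝ → ℂ} (hψ : ContDiff ℝ ((⊤ : ℕ∞) : WithTop ℕ∞) ψ) :
    (∫ z, u.val z * (fourier (-n) z.1 * deriv ψ z.2) ∂(vol b)) +
      (∫ z, u.dy z * (fourier (-n) z.1 * ψ z.2) ∂(vol b)) =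
      2 * (Real.pi : ℂ) * fourierCoeff (τ₀ : S → ℂ) n * ψ 0 -
        2 * (Real.pi : ℂ) * fourierCoeff (τb : S → ℂ) n * ψ (-b) := by
  have h1 := h _ ((isSmooth_fourier (-n)).mul_snd hψ)
  simp only [(isSmooth_fourier (-n)).partialY_mul_snd (hψ.differentiable (by simp)),
    partialY_fourier, zero_mul, zero_add, ← mul_assoc] at h1
  rw [integral_mul_const, integral_mul_const, ← two_pi_mul_fourierCoeff,
    ← two_pi_mul_fourierCoeff] at h1
  simpa only [mul_assoc] using h1

lemma IsTrace.unique {b : ℝ} (hb : 0 < b) {u : H1 b} {τ₀ τb τ₀' τb' : L2Gamma}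
    (h : IsTrace u τ₀ τb) (h' : IsTrace u τ₀' τb') : τ₀ = τ₀' ∧ τb = τb' := by
  have hb' : (b : ℂ) ≠ 0 := by exact_mod_cast hb.ne'
  have hpi : (2 * (Real.pi : ℂ)) ≠ 0 := by
    have : (Real.pi : ℂ) ≠ 0 := by exact_mod_cast Real.pi_ne_zero
    simp [this]
  have ha := contDiff_affine
  constructor <;> refine eq_of_forall_fourierCoeff_eq fun n => ?_
  · have e := (h.fourierCoeff_eq n (ha 1 b⁻¹)).symm.trans (h'.fourierCoeff_eq n (ha 1 b⁻¹))
    simpa [hb', hpi] using e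
  · have e := (h.fourierCoeff_eq n (ha 0 b⁻¹)).symm.trans (h'.fourierCoeff_eq n (ha 0 b⁻¹))
    simpa [hb', hpi] using e

/-! ### Weighted Fourier coefficients of traces -/

/-- The weight `1 + |n|`. -/
def wt (n : ℤ) : ℝ := n.natAbs + 1

lemma wt_pos (n : ℤ) : 0 < wt n := by unfold wt; positivity

lemma one_le_wt (n : ℤ) : 1 ≤ wt n := by unfold wt; linarith [Nat.cast_nonneg (α := ℝ) n.natAbs]

lemma wt_eq (n : ℤ) : wt n = |(n : ℝ)| + 1 := by
  rw [wt, Nat.cast_natAbs]; push_cast; ring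

/-- The function `(c + d y) ^ k`. -/
def powY (c d : ℝ) (k : ℕ) : C(ℝ, ℂ) := ⟨fun y => (((c + d * y) ^ k : ℝ) : ℂ), by fun_prop⟩

lemma contDiff_powY (c d : ℝ) (k : ℕ) :
    ContDiff ℝ ((⊤ : ℕ∞) : WithTop ℕ∞) (powY c d k) :=
  Complex.ofRealCLM.contDiff.comp ((contDiff_const.add (contDiff_const.mul contDiff_id)).pow k)

lemma hasDerivAt_affine_pow (c d : ℝ) (k : ℕ) (y : ℝ) :
    HasDerivAt (fun y : ℝ => (c + d * y) ^ k) (k * (c + d * y) ^ (k - 1) * d) y := by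
  have : HasDerivAt (fun y : ℝ => c + d * y) d y := by
    simpa using ((hasDerivAt_id y).const_mul d).const_add c
  exact this.fun_pow k

lemma deriv_powY (c d : ℝ) (k : ℕ) (y : ℝ) :
    deriv (powY c d (k + 1)) y = ((k + 1) * d : ℂ) * powY c d k y := by
  have := (hasDerivAt_affine_pow c d (k + 1) y).ofReal_comp.deriv
  refine this.trans ?_
  simp [powY]
  ring

/-- `s = true` stands for the upper boundary `y = 0`, and `s = false` for the lower one; the affine
function `sideC s + sideD b s * y` is `1` on this boundary and `0` on the other one. -/
def sideC (s : Bool) : ℝ := if s then 1 else 0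

/-- See `sideC`. -/
def sideD (b : ℝ) (s : Bool) : ℝ := if s then b⁻¹ else -b⁻¹

/-- The factor 1/(2k+1) is what pays for the weights in `famP` and `famQ`. -/
lemma integral_norm_powY_sq {b : ℝ} (hb : 0 < b) (s : Bool) (k : ℕ) :
    ∫ y in Ioo (-b) 0, ‖powY (sideC s) (sideD b s) k y‖ ^ 2 = b / (2 * k + 1) := by
  have h1 : ∀ y, ‖powY (sideC s) (sideD b s) k y‖ ^ 2 = (sideC s + sideD b s * y) ^ (2 * k) := by
    intro y
    simp only [powY, ContinuousMap.coe_mk, Complex.norm_real, Real.norm_eq_abs, sq_abs]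
    ring
  simp only [h1]
  rw [← integral_Ioc_eq_integral_Ioo, ← intervalIntegral.integral_of_le (by linarith)]
  have hd : sideD b s ≠ 0 := by cases s <;> simp [sideD, hb.ne']
  have hk : (2 * (k : ℝ) + 1) ≠ 0 := by positivity
  have h2 : ∀ y ∈ uIcc (-b) 0, HasDerivAt
      (fun y : ℝ => (sideC s + sideD b s * y) ^ (2 * k + 1) * ((2 * k + 1) * sideD b s)⁻¹)
      ((sideC s + sideD b s * y) ^ (2 * k)) y := by
    intro y _
    refine ((hasDerivAt_affine_pow (sideC s) (sideD b s) (2 * k + 1) y).mul_const _).congr_deriv ?_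
    push_cast
    field_simp
  rw [intervalIntegral.integral_eq_sub_of_hasDerivAt h2
    (Continuous.intervalIntegrable (by fun_prop) _ _)]
  cases s <;> simp [sideC, sideD, hb.ne', mul_comm, div_eq_mul_inv]

/-- The orthogonal family `(1 + |n|)^{-1/2} e^{inx} ψₙ'(y)`, where `ψₙ = (c + d y)^{|n| + 1}`. -/
def famP (b : ℝ) (s : Bool) (n : ℤ) : L2Omega b :=
  (((Real.sqrt (wt n))⁻¹ * (wt n * sideD b s) : ℝ) : ℂ) •
    toL2 b (tens n (powY (sideC s) (sideD b s) n.natAbs))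

/-- The orthogonal family `(1 + |n|)^{1/2} e^{inx} ψₙ(y)`, where `ψₙ = (c + d y)^{|n| + 1}`. -/
def famQ (b : ℝ) (s : Bool) (n : ℤ) : L2Omega b :=
  ((Real.sqrt (wt n) : ℝ) : ℂ) •
    toL2 b (tens n (powY (sideC s) (sideD b s) (n.natAbs + 1)))

lemma pairwise_famP (b : ℝ) (s : Bool) :
    Pairwise fun i j => inner ℂ (famP b s i) (famP b s j) = 0 := by
  intro i j h
  simp only [famP, inner_smul_left, inner_smul_right, inner_toL2_tens_of_ne b h, mul_zero]

lemma pairwise_famQ (b : ℝ) (s : Bool) :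
    Pairwise fun i j => inner ℂ (famQ b s i) (famQ b s j) = 0 := by
  intro i j h
  simp only [famQ, inner_smul_left, inner_smul_right, inner_toL2_tens_of_ne b h, mul_zero]

lemma norm_famP_le {b : ℝ} (hb : 0 < b) (s : Bool) (n : ℤ) :
    ‖famP b s n‖ ≤ Real.sqrt (2 * Real.pi / b) := by
  refine Real.le_sqrt_of_sq_le ?_
  have hw := wt_pos n
  have hD : sideD b s ^ 2 = (b ^ 2)⁻¹ := by cases s <;> simp [sideD]
  rw [famP, norm_smul, mul_pow, norm_toL2_tens_sq, integral_norm_powY_sq hb, Complex.norm_real,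
    Real.norm_eq_abs, sq_abs, mul_pow, mul_pow, inv_pow, Real.sq_sqrt hw.le, hD]
  have h1 : wt n ≤ 2 * (n.natAbs : ℝ) + 1 := by
    unfold wt; linarith [Nat.cast_nonneg (α := ℝ) n.natAbs]
  have h2 : (0 : ℝ) < 2 * (n.natAbs : ℝ) + 1 := by positivity
  have h3 : (wt n)⁻¹ * (wt n ^ 2 * (b ^ 2)⁻¹) * (2 * Real.pi * (b / (2 * (n.natAbs : ℝ) + 1))) =
      (2 * Real.pi / b) * (wt n / (2 * (n.natAbs : ℝ) + 1)) := by
    field_simp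
  rw [h3]
  exact mul_le_of_le_one_right (by positivity) ((div_le_one h2).2 h1)

lemma norm_famQ_le {b : ℝ} (hb : 0 < b) (s : Bool) (n : ℤ) :
    ‖famQ b s n‖ ≤ Real.sqrt (2 * Real.pi * b) := by
  refine Real.le_sqrt_of_sq_le ?_
  have hw := wt_pos n
  rw [famQ, norm_smul, mul_pow, norm_toL2_tens_sq, integral_norm_powY_sq hb, Complex.norm_real,
    Real.norm_eq_abs, sq_abs, Real.sq_sqrt hw.le]
  have h1 : wt n ≤ 2 * ((n.natAbs + 1 : ℕ) : ℝ) + 1 := by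
    unfold wt; push_cast; linarith [Nat.cast_nonneg (α := ℝ) n.natAbs]
  have h2 : (0 : ℝ) < 2 * ((n.natAbs + 1 : ℕ) : ℝ) + 1 := by positivity
  have h3 : wt n * (2 * Real.pi * (b / (2 * ((n.natAbs + 1 : ℕ) : ℝ) + 1))) =
      (2 * Real.pi * b) * (wt n / (2 * ((n.natAbs + 1 : ℕ) : ℝ) + 1)) := by
    field_simp
  rw [h3]
  exact mul_le_of_le_one_right (by positivity) ((div_le_one h2).2 h1)

lemma norm_neg_I_mul_sign_le (n : ℤ) : ‖-Complex.I * (Int.sign n : ℂ)‖ ≤ 1 := by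
  rcases lt_trichotomy n 0 with h | h | h
  · simp [Int.sign_eq_neg_one_of_neg h]
  · simp [h]
  · simp [Int.sign_eq_one_of_pos h]

/-- The trace operator `H¹(Ω) → ℓ²` with the coordinates `2π (1 + |n|)^{1/2} τ̂(n)` (up to a sign
for the lower boundary). -/
def traceSeq {b : ℝ} (hb : 0 < b) (s : Bool) : V b →L[ℂ] Seq :=
  -- The functions √(1+|n|) e^{inx} ψₙ' are unbounded in L². Writing 1 + |n| = 1 + (-i sign n)(in)
  -- trades the excess factor for the x-derivative, so the bounded family `famP` suffices.
  (besselCLM (famP b s) _ (pairwise_famP b s) (norm_famP_le hb s)).comp (valL b) +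
    (diagCLM (fun n => -Complex.I * (Int.sign n : ℂ)) 1 norm_neg_I_mul_sign_le).comp
      ((besselCLM (famP b s) _ (pairwise_famP b s) (norm_famP_le hb s)).comp (dxL b)) +
    (besselCLM (famQ b s) _ (pairwise_famQ b s) (norm_famQ_le hb s)).comp (dyL b)

lemma inner_tens_eq (b : ℝ) (n : ℤ) (ψ : C(ℝ, ℂ)) (f : L2Omega b) :
    inner ℂ (toL2 b (tens n ψ)) f = ∫ z, f z * (fourier (-n) z.1 * conj (ψ z.2)) ∂(vol b) := by
  rw [inner_toL2]
  simp

lemma inner_tens_dxL {b : ℝ} (hb : 0 < b) (u : V b) (n : ℤ) {ψ : C(ℝ, ℂ)}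
    (hψ : ContDiff ℝ ((⊤ : ℕ∞) : WithTop ℕ∞) ψ) :
    inner ℂ (toL2 b (tens n ψ)) (dxL b u) =
      Complex.I * n * inner ℂ (toL2 b (tens n ψ)) (valL b u) := by
  have hs := (isSmooth_fourier (-n)).mul_snd (ψ := fun y => conj (ψ y))
    (Complex.conjCLE.contDiff.comp hψ)
  have h := (toH1 u).integral_partialX hb hs
  simp only [(isSmooth_fourier (-n)).partialX_mul_snd (fun y => conj (ψ y)),
    partialX_fourier] at h
  rw [inner_tens_eq, inner_tens_eq, ← toH1_val, ← toH1_dx, ← neg_inj, ← h,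
    ← integral_const_mul, ← integral_neg]
  refine integral_congr_ae (ae_of_all _ fun z => ?_)
  push_cast
  ring

lemma conj_powY (c d : ℝ) (k : ℕ) (y : ℝ) : conj (powY c d k y) = powY c d k y :=
  Complex.conj_ofReal _

/-- Since ∂ₓ multiplies the n-th mode by in, the two `famP` terms combine to (1+|n|)^{-1/2}(1+|n|) =
(1+|n|)^{1/2}. What remains is the left side of `IsTrace.fourierCoeff_eq` for ψₙ, times this weight.
-/
lemma traceSeq_apply {b : ℝ} (hb : 0 < b) (s : Bool) (u : V b) (n : ℤ) :
    traceSeq hb s u n = (Real.sqrt (wt n) : ℂ) *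
      ((∫ z, valL b u z * (fourier (-n) z.1 *
          deriv (powY (sideC s) (sideD b s) (n.natAbs + 1)) z.2) ∂(vol b)) +
        ∫ z, dyL b u z * (fourier (-n) z.1 *
          powY (sideC s) (sideD b s) (n.natAbs + 1) z.2) ∂(vol b)) := by
  have h0 : traceSeq hb s u n = inner ℂ (famP b s n) (valL b u) +
      (-Complex.I * (Int.sign n : ℂ)) * inner ℂ (famP b s n) (dxL b u) +
      inner ℂ (famQ b s n) (dyL b u) := rfl
  have hsw : (Real.sqrt (wt n) : ℂ) * (Real.sqrt (wt n) : ℂ) = (wt n : ℂ) := by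
    rw [← Complex.ofReal_mul, Real.mul_self_sqrt (wt_pos n).le]
  have hs0 : (Real.sqrt (wt n) : ℂ) ≠ 0 := by
    exact_mod_cast (Real.sqrt_pos.2 (wt_pos n)).ne'
  have hsgn : (Int.sign n : ℂ) * n = (wt n : ℂ) - 1 := by
    have : ((Int.sign n * n : ℤ) : ℂ) = ((n.natAbs : ℤ) : ℂ) := by
      rw [Int.sign_mul_self_eq_natAbs]
    push_cast [wt] at this ⊢
    rw [this]; simp
  rw [h0, famP, famQ]
  simp only [inner_smul_left, Complex.conj_ofReal]
  rw [inner_tens_dxL hb u n (contDiff_powY _ _ _), inner_tens_eq, inner_tens_eq]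
  simp only [conj_powY, deriv_powY]
  have h1 : ∫ z, valL b u z * (fourier (-n) z.1 * (((n.natAbs : ℂ) + 1) * (sideD b s : ℂ) *
      powY (sideC s) (sideD b s) n.natAbs z.2)) ∂(vol b) = (wt n : ℂ) * (sideD b s : ℂ) *
      ∫ z, valL b u z * (fourier (-n) z.1 * powY (sideC s) (sideD b s) n.natAbs z.2) ∂(vol b) := by
    rw [← integral_const_mul]
    refine integral_congr_ae (ae_of_all _ fun z => ?_)
    simp only [wt]
    push_cast
    ring
  rw [h1]
  set A := ∫ z, valL b u z * (fourier (-n) z.1 * powY (sideC s) (sideD b s) n.natAbs z.2) ∂(vol b)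
  set B := ∫ z, dyL b u z * (fourier (-n) z.1 *
    powY (sideC s) (sideD b s) (n.natAbs + 1) z.2) ∂(vol b)
  push_cast
  have h2 : -Complex.I * (Int.sign n : ℂ) * ((Real.sqrt (wt n) : ℂ)⁻¹ * (wt n * sideD b s) *
      (Complex.I * n * A)) = ((Int.sign n : ℂ) * n) * ((Real.sqrt (wt n) : ℂ)⁻¹ *
        (wt n * sideD b s) * A) := by
    linear_combination (-(Int.sign n : ℂ) * n * ((Real.sqrt (wt n) : ℂ)⁻¹ *
        (wt n * sideD b s) * A)) * Complex.I_sq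
  rw [h2, hsgn]
  have h3 : (wt n : ℂ) * (Real.sqrt (wt n) : ℂ)⁻¹ = Real.sqrt (wt n) := by
    rw [← hsw]; field_simp
  linear_combination (wt n * sideD b s * A) * h3

lemma traceSeq_true {b : ℝ} (hb : 0 < b) (u : V b) (n : ℤ) :
    traceSeq hb true u n = 2 * (Real.pi : ℂ) * (Real.sqrt (wt n) : ℂ) *
      fourierCoeff (traceTop b u : S → ℂ) n := by
  have h := (isTrace_trace hb u).fourierCoeff_eq n
    (contDiff_powY (sideC true) (sideD b true) (n.natAbs + 1))
  rw [traceSeq_apply]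
  rw [toH1_val, toH1_dy] at h
  rw [h]
  have hb' : (b : ℂ) ≠ 0 := by exact_mod_cast hb.ne'
  simp [powY, sideC, sideD, hb']
  ring

lemma traceSeq_false {b : ℝ} (hb : 0 < b) (u : V b) (n : ℤ) :
    traceSeq hb false u n = -(2 * (Real.pi : ℂ) * (Real.sqrt (wt n) : ℂ) *
      fourierCoeff (traceBot b u : S → ℂ) n) := by
  have h := (isTrace_trace hb u).fourierCoeff_eq n
    (contDiff_powY (sideC false) (sideD b false) (n.natAbs + 1))
  rw [traceSeq_apply]
  rw [toH1_val, toH1_dy] at h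
  rw [h]
  have hb' : (b : ℂ) ≠ 0 := by exact_mod_cast hb.ne'
  simp [powY, sideC, sideD, hb']
  ring

/-! ### The cosine basis of `L²(Ω)` -/

/-- The function `cos (jπy/b)`. -/
def cosY (b : ℝ) (j : ℤ) : C(ℝ, ℂ) := ⟨fun y => (Real.cos (j * Real.pi / b * y) : ℂ), by fun_prop⟩

/-- The function `sin (jπy/b)`. -/
def sinY (b : ℝ) (j : ℤ) : C(ℝ, ℂ) := ⟨fun y => (Real.sin (j * Real.pi / b * y) : ℂ), by fun_prop⟩

lemma conj_cosY (b : ℝ) (j : ℤ) (y : ℝ) : conj (cosY b j y) = cosY b j y := Complex.conj_ofReal _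

lemma conj_sinY (b : ℝ) (j : ℤ) (y : ℝ) : conj (sinY b j y) = sinY b j y := Complex.conj_ofReal _

lemma cosY_neg (b : ℝ) (j : ℤ) : cosY b (-j) = cosY b j := by
  ext y
  simp only [cosY, ContinuousMap.coe_mk]
  rw [← Real.cos_neg]
  congr 2
  push_cast; ring

lemma cosY_mul_cosY (b : ℝ) (i j : ℤ) (y : ℝ) :
    cosY b i y * cosY b j y = (1 / 2 : ℂ) * (cosY b (i - j) y + cosY b (i + j) y) := by
  simp only [cosY, ContinuousMap.coe_mk]
  have h1 : ((i - j : ℤ) : ℝ) * Real.pi / b * y =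
      i * Real.pi / b * y - j * Real.pi / b * y := by push_cast; ring
  have h2 : ((i + j : ℤ) : ℝ) * Real.pi / b * y =
      i * Real.pi / b * y + j * Real.pi / b * y := by push_cast; ring
  rw [h1, h2, Real.cos_sub, Real.cos_add]
  push_cast
  ring

lemma sinY_mul_sinY (b : ℝ) (i j : ℤ) (y : ℝ) :
    sinY b i y * sinY b j y = (1 / 2 : ℂ) * (cosY b (i - j) y - cosY b (i + j) y) := by
  simp only [cosY, sinY, ContinuousMap.coe_mk]
  have h1 : ((i - j : ℤ) : ℝ) * Real.pi / b * y =
      i * Real.pi / b * y - j * Real.pi / b * y := by push_cast; ring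
  have h2 : ((i + j : ℤ) : ℝ) * Real.pi / b * y =
      i * Real.pi / b * y + j * Real.pi / b * y := by push_cast; ring
  rw [h1, h2, Real.cos_sub, Real.cos_add]
  push_cast
  ring

lemma hasDerivAt_sinY (b : ℝ) (j : ℤ) (y : ℝ) :
    HasDerivAt (sinY b j) (((j * Real.pi / b : ℝ) : ℂ) * cosY b j y) y := by
  have h : HasDerivAt (fun y : ℝ => j * Real.pi / b * y) (j * Real.pi / b) y := by
    simpa using (hasDerivAt_id y).const_mul (j * Real.pi / b)
  refine (h.sin.ofReal_comp).congr_deriv ?_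
  simp only [cosY, ContinuousMap.coe_mk]
  push_cast
  ring

lemma contDiff_sinY (b : ℝ) (j : ℤ) :
    ContDiff ℝ ((⊤ : ℕ∞) : WithTop ℕ∞) (sinY b j) :=
  Complex.ofRealCLM.contDiff.comp (Real.contDiff_sin.comp (contDiff_const.mul contDiff_id))

lemma contDiff_cosY (b : ℝ) (j : ℤ) :
    ContDiff ℝ ((⊤ : ℕ∞) : WithTop ℕ∞) (cosY b j) :=
  Complex.ofRealCLM.contDiff.comp (Real.contDiff_cos.comp (contDiff_const.mul contDiff_id))

lemma sinY_zero (b : ℝ) (j : ℤ) : sinY b j 0 = 0 := by simp [sinY]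

lemma sinY_neg_b {b : ℝ} (hb : 0 < b) (j : ℤ) : sinY b j (-b) = 0 := by
  have : (j : ℝ) * Real.pi / b * -b = -(j * Real.pi) := by field_simp
  simp only [sinY, ContinuousMap.coe_mk, this, Real.sin_neg, Real.sin_int_mul_pi]
  simp

lemma integral_cosY {b : ℝ} (hb : 0 < b) (j : ℤ) :
    ∫ y in Ioo (-b) 0, cosY b j y = if j = 0 then (b : ℂ) else 0 := by
  rw [← integral_Ioc_eq_integral_Ioo, ← intervalIntegral.integral_of_le (by linarith)]
  split_ifs with h
  · subst h
    simp [cosY]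
  · have hc : ((j * Real.pi / b : ℝ) : ℂ) ≠ 0 := by
      have : (j : ℝ) ≠ 0 := by exact_mod_cast h
      have : (j * Real.pi / b : ℝ) ≠ 0 := by positivity
      exact_mod_cast this
    have h2 : ∀ y ∈ uIcc (-b) 0, HasDerivAt
        (fun y => (((j * Real.pi / b : ℝ) : ℂ))⁻¹ * sinY b j y) (cosY b j y) y := by
      intro y _
      refine ((hasDerivAt_sinY b j y).const_mul _).congr_deriv ?_
      rw [← mul_assoc, inv_mul_cancel₀ hc, one_mul]
    rw [intervalIntegral.integral_eq_sub_of_hasDerivAt h2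
      ((cosY b j).continuous.intervalIntegrable _ _), sinY_zero, sinY_neg_b hb]
    simp

lemma integrableOn_cosY (b : ℝ) (j : ℤ) : IntegrableOn (cosY b j) (Ioo (-b) 0) :=
  ((cosY b j).continuous.integrableOn_Icc).mono_set Ioo_subset_Icc_self

lemma integral_cosY_mul {b : ℝ} (hb : 0 < b) (i j : ℕ) :
    ∫ y in Ioo (-b) 0, conj (cosY b i y) * cosY b j y =
      if i = j then (if i = 0 then (b : ℂ) else b / 2) else 0 := by
  simp only [conj_cosY, cosY_mul_cosY]
  rw [integral_const_mul, integral_add (integrableOn_cosY _ _) (integrableOn_cosY _ _),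
    integral_cosY hb, integral_cosY hb]
  by_cases h : i = j
  · subst h
    by_cases h0 : i = 0
    · subst h0; simp; ring
    · have : ¬ ((i : ℤ) + i = 0) := by omega
      simp [h0, this]; ring
  · have h1 : ¬ ((i : ℤ) - j = 0) := by omega
    have h2 : ¬ ((i : ℤ) + j = 0) := by omega
    simp [h1, h2, h]

lemma integral_sinY_mul {b : ℝ} (hb : 0 < b) (i j : ℕ) :
    ∫ y in Ioo (-b) 0, conj (sinY b i y) * sinY b j y =
      if i = j then (if i = 0 then (0 : ℂ) else b / 2) else 0 := by
  simp only [conj_sinY, sinY_mul_sinY]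
  rw [integral_const_mul, integral_sub (integrableOn_cosY _ _) (integrableOn_cosY _ _),
    integral_cosY hb, integral_cosY hb]
  by_cases h : i = j
  · subst h
    by_cases h0 : i = 0
    · subst h0; simp
    · have : ¬ ((i : ℤ) + i = 0) := by omega
      simp [h0, this]; ring
  · have h1 : ¬ ((i : ℤ) - j = 0) := by omega
    have h2 : ¬ ((i : ℤ) + j = 0) := by omega
    simp [h1, h2, h]

/-- The norm of the function `e^{inx} cos (mπy/b)` in `L²(Ω)`. -/
def cosNorm (b : ℝ) (m : ℕ) : ℝ := Real.sqrt (2 * Real.pi * (if m = 0 then b else b / 2))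

lemma cosNorm_pos {b : ℝ} (hb : 0 < b) (m : ℕ) : 0 < cosNorm b m := by
  refine Real.sqrt_pos.2 ?_
  have := Real.pi_pos
  split_ifs <;> positivity

lemma cosNorm_sq {b : ℝ} (hb : 0 < b) (m : ℕ) :
    cosNorm b m * cosNorm b m = 2 * Real.pi * (if m = 0 then b else b / 2) := by
  refine Real.mul_self_sqrt ?_
  have := Real.pi_pos
  split_ifs <;> positivity

/-- The normalized functions `e^{inx} cos (mπy/b)`. -/
def cosVec (b : ℝ) (p : ℤ × ℕ) : L2Omega b :=
  (((cosNorm b p.2)⁻¹ : ℝ) : ℂ) • toL2 b (tens p.1 (cosY b p.2))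

/-- The functions `e^{inx} sin (mπy/b)`, normalized like `cosVec`. -/
def sinVec (b : ℝ) (p : ℤ × ℕ) : L2Omega b :=
  (((cosNorm b p.2)⁻¹ : ℝ) : ℂ) • toL2 b (tens p.1 (sinY b p.2))

lemma inner_cosVec {b : ℝ} (hb : 0 < b) (p q : ℤ × ℕ) :
    inner ℂ (cosVec b p) (cosVec b q) = if p = q then 1 else 0 := by
  rw [cosVec, cosVec, inner_smul_left, inner_smul_right, Complex.conj_ofReal, inner_toL2_tens,
    integral_cosY_mul hb]
  by_cases h : p = q
  · subst h
    have h1 := cosNorm_sq hb p.2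
    have h2 := (cosNorm_pos hb p.2).ne'
    simp only [if_true]
    have h3 : (2 * (Real.pi : ℂ) * if p.2 = 0 then (b : ℂ) else b / 2) =
        ((cosNorm b p.2 * cosNorm b p.2 : ℝ) : ℂ) := by
      rw [h1]; split_ifs <;> push_cast <;> ring
    rw [h3, ← Complex.ofReal_mul, ← Complex.ofReal_mul, ← Complex.ofReal_one]
    congr 1
    field_simp
  · rw [if_neg h]
    by_cases h1 : p.1 = q.1
    · have h2 : p.2 ≠ q.2 := fun h2 => h (Prod.ext h1 h2)
      simp [h2]
    · simp [h1]

lemma pairwise_sinVec {b : ℝ} (hb : 0 < b) :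
    Pairwise fun p q => inner ℂ (sinVec b p) (sinVec b q) = 0 := by
  intro p q h
  simp only [sinVec, inner_smul_left, inner_smul_right, Complex.conj_ofReal, inner_toL2_tens,
    integral_sinY_mul hb]
  by_cases h1 : p.1 = q.1
  · have h2 : p.2 ≠ q.2 := fun h2 => h (Prod.ext h1 h2)
    simp [h2]
  · simp [h1]

lemma norm_sinVec_le {b : ℝ} (hb : 0 < b) (p : ℤ × ℕ) : ‖sinVec b p‖ ≤ 1 := by
  have h := inner_self_eq_norm_sq_to_K (𝕜 := ℂ) (sinVec b p)
  have h1 := cosNorm_sq hb p.2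
  have h2 := (cosNorm_pos hb p.2)
  -- The sine with m = 0 is zero; all others have the same norm as the cosine.
  have key : inner ℂ (sinVec b p) (sinVec b p) = ((if p.2 = 0 then (0 : ℝ) else 1 : ℝ) : ℂ) := by
    rw [sinVec, inner_smul_left, inner_smul_right, Complex.conj_ofReal, inner_toL2_tens,
      integral_sinY_mul hb]
    simp only [if_true]
    by_cases h0 : p.2 = 0
    · simp [h0]
    · simp only [h0, if_false] at h1 ⊢
      have h3 : (2 * (Real.pi : ℂ) * (b / 2)) = ((cosNorm b p.2 * cosNorm b p.2 : ℝ) : ℂ) := by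
        rw [h1]; push_cast; ring
      rw [h3, ← Complex.ofReal_mul, ← Complex.ofReal_mul]
      congr 1
      field_simp
  rw [key] at h
  have h4 : (if p.2 = 0 then (0 : ℝ) else 1) = ‖sinVec b p‖ ^ 2 := by
    apply Complex.ofReal_injective
    rw [h]; simp
  have h5 : ‖sinVec b p‖ ^ 2 ≤ 1 := by
    rw [← h4]; split_ifs <;> norm_num
  exact (sq_le_one_iff₀ (norm_nonneg _)).1 h5

lemma orthonormal_cosVec {b : ℝ} (hb : 0 < b) : Orthonormal ℂ (cosVec b) := by
  classical
  rw [orthonormal_iff_ite]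
  exact inner_cosVec hb

/-! ### Completeness -/

/-- The closed slab. -/
abbrev ClosedSlab (b : ℝ) : Type := S × Icc (-b) 0

/-- The function `e^{inx} cos (jπy/b)` on the closed slab. -/
def trig (b : ℝ) (p : ℤ × ℤ) : C(ClosedSlab b, ℂ) :=
  ⟨fun z => fourier p.1 z.1 * cosY b p.2 z.2, by fun_prop⟩

/-- This closes the span under products. Allowing frequencies in y of both signs avoids a case
distinction for the difference. -/
lemma trig_mul (b : ℝ) (p q : ℤ × ℤ) :
    trig b p * trig b q = (1 / 2 : ℂ) • (trig b (p.1 + q.1, p.2 - q.2) +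
      trig b (p.1 + q.1, p.2 + q.2)) := by
  ext z
  have := cosY_mul_cosY b p.2 q.2 z.2
  simp only [trig, ContinuousMap.mul_apply, ContinuousMap.coe_mk, ContinuousMap.smul_apply,
    ContinuousMap.add_apply, smul_eq_mul, fourier_add]
  linear_combination (fourier p.1 z.1 * fourier q.1 z.1) * this

lemma trig_span_mul (b : ℝ) (f g : C(ClosedSlab b, ℂ)) (hf : f ∈ Submodule.span ℂ (range (trig b)))
    (hg : g ∈ Submodule.span ℂ (range (trig b))) :
    f * g ∈ Submodule.span ℂ (range (trig b)) := by
  have h := Submodule.mul_mem_mul hf hg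
  rw [Submodule.span_mul_span] at h
  refine Submodule.span_le.2 ?_ h
  rintro _ ⟨_, ⟨p, rfl⟩, _, ⟨q, rfl⟩, rfl⟩
  change trig b p * trig b q ∈ _
  rw [trig_mul]
  exact Submodule.smul_mem _ _ (Submodule.add_mem _ (Submodule.subset_span ⟨_, rfl⟩)
    (Submodule.subset_span ⟨_, rfl⟩))

/-- The star subalgebra of trigonometric polynomials on the closed slab. -/
def trigAlgebra (b : ℝ) : StarSubalgebra ℂ C(ClosedSlab b, ℂ) where
  toSubalgebra := (Submodule.span ℂ (range (trig b))).toSubalgebra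
    (Submodule.subset_span ⟨(0, 0), by ext z; simp [trig, cosY]⟩) (trig_span_mul b)
  star_mem' := by
    intro f hf
    change star f ∈ Submodule.span ℂ (range (trig b))
    replace hf : f ∈ Submodule.span ℂ (range (trig b)) := hf
    induction hf using Submodule.span_induction with
    | mem x hx =>
      obtain ⟨p, rfl⟩ := hx
      refine Submodule.subset_span ⟨(-p.1, p.2), ?_⟩
      ext z
      simp [trig, conj_cosY]
    | zero => simp
    | add x y _ _ hx hy => rw [star_add]; exact Submodule.add_mem _ hx hy
    | smul a x _ hx => rw [star_smul]; exact Submodule.smul_mem _ _ hx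

/-- e^{ix} separates points of the circle, and cos(πy/b) is injective on [-b, 0], a half period. -/
lemma trigAlgebra_separatesPoints {b : ℝ} (hb : 0 < b) : (trigAlgebra b).SeparatesPoints := by
  intro z w hzw
  by_cases h1 : z.1 = w.1
  · refine ⟨_, ⟨trig b (0, 1), Submodule.subset_span ⟨_, rfl⟩, rfl⟩, ?_⟩
    have h2 : (z.2 : ℝ) ≠ w.2 := fun h => hzw (Prod.ext h1 (Subtype.ext h))
    simp only [trig, cosY, ContinuousMap.coe_mk, fourier_zero, one_mul, Int.cast_one]
    intro h
    have h3 := Complex.ofReal_injective h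
    rw [← Real.cos_neg, ← Real.cos_neg (Real.pi / b * w.2)] at h3
    have hm : ∀ y : Icc (-b) 0, -(Real.pi / b * (y : ℝ)) ∈ Icc 0 Real.pi := by
      intro y
      have hpb : 0 < Real.pi / b := by positivity
      refine ⟨by nlinarith [y.2.2], ?_⟩
      have : -(Real.pi / b * (y : ℝ)) ≤ Real.pi / b * b := by nlinarith [y.2.1]
      rwa [div_mul_cancel₀ _ hb.ne'] at this
    have h4 := Real.injOn_cos (hm z.2) (hm w.2) h3
    apply h2
    have hpb : Real.pi / b ≠ 0 := by positivity
    exact mul_left_cancel₀ hpb (neg_injective h4)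
  · refine ⟨_, ⟨trig b (1, 0), Submodule.subset_span ⟨_, rfl⟩, rfl⟩, ?_⟩
    simp only [trig, cosY, ContinuousMap.coe_mk, fourier_one, Int.cast_zero, zero_mul, zero_div,
      Real.cos_zero, Complex.ofReal_one, mul_one]
    intro h
    exact h1 (AddCircle.injective_toCircle Real.two_pi_pos.ne' (Subtype.ext h))

/-- The functional `φ ↦ ∫_Ω f φ` on continuous functions on the closed slab. -/
def slabFunctional {b : ℝ} (hb : 0 < b) (f : L2Omega b) : C(ClosedSlab b, ℂ) →L[ℂ] ℂ :=
  have hc : ∀ φ : C(ClosedSlab b, ℂ),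
      Continuous fun z : S × ℝ => φ (z.1, projIcc (-b) 0 (by linarith) z.2) := fun φ => by fun_prop
  LinearMap.mkContinuous
    { toFun := fun φ => ∫ z, f z * φ (z.1, projIcc (-b) 0 (by linarith) z.2) ∂(vol b)
      map_add' := fun φ ψ => by
        rw [← integral_add (integrable_mul_continuous b f (hc φ))
          (integrable_mul_continuous b f (hc ψ))]
        simp [mul_add]
      map_smul' := fun a φ => by
        rw [RingHom.id_apply, smul_eq_mul, ← integral_const_mul]
        refine integral_congr_ae (ae_of_all _ fun z => ?_)
        simp; ring }
    (∫ z, ‖f z‖ ∂(vol b)) (fun φ => by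
      rw [← integral_mul_const]
      refine norm_integral_le_of_norm_le ((integrable_Lp b f).norm.mul_const _)
        (ae_of_all _ fun z => ?_)
      rw [norm_mul]
      exact mul_le_mul_of_nonneg_left (φ.norm_coe_le_norm _) (norm_nonneg _))

lemma slabFunctional_eq {b : ℝ} (hb : 0 < b) (f : L2Omega b) (φ : C(ClosedSlab b, ℂ))
    (g : S × ℝ → ℂ) (hg : ∀ z (hz : z.2 ∈ Icc (-b) 0), g z = φ (z.1, ⟨z.2, hz⟩)) :
    slabFunctional hb f φ = ∫ z, f z * g z ∂(vol b) := by
  refine integral_congr_ae ?_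
  filter_upwards [ae_vol_mem b] with z hz
  have hz' : z.2 ∈ Icc (-b) 0 := ⟨hz.1.le, hz.2.le⟩
  simp only [hg z hz', projIcc_of_mem _ hz']

/-- By Stone-Weierstrass, the functional φ ↦ ∫ f φ vanishes on a dense subalgebra of the continuous
functions on the closed slab, hence on all of them; restrictions of bounded continuous functions are
dense in L². -/
lemma eq_zero_of_forall_inner_cosVec {b : ℝ} (hb : 0 < b) (f : L2Omega b)
    (h : ∀ p, inner ℂ (cosVec b p) f = 0) : f = 0 := by
  have h1 : ∀ p, slabFunctional hb f (trig b p) = 0 := by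
    intro p
    have h2 := h (-p.1, p.2.natAbs)
    rw [cosVec, inner_smul_left, mul_eq_zero] at h2
    have h3 := h2.resolve_left (by
      rw [Complex.conj_ofReal]
      exact_mod_cast (inv_pos.2 (cosNorm_pos hb _)).ne')
    rw [inner_tens_eq] at h3
    rw [slabFunctional_eq hb f (trig b p) (fun z => fourier p.1 z.1 * cosY b p.2 z.2)
      (fun z hz => rfl), ← h3]
    refine integral_congr_ae (ae_of_all _ fun z => ?_)
    have h4 : cosY b p.2.natAbs = cosY b p.2 := by
      rcases Int.natAbs_eq p.2 with h | h
      · exact congrArg _ h.symm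
      · rw [← cosY_neg]; exact congrArg _ h.symm
    simp only [h4, conj_cosY, neg_neg]
  have h2 : ∀ φ, slabFunctional hb f φ = 0 := by
    have hclosed : IsClosed {φ | slabFunctional hb f φ = 0} :=
      isClosed_eq (slabFunctional hb f).continuous continuous_const
    have htop := ContinuousMap.starSubalgebra_topologicalClosure_eq_top_of_separatesPoints
      (trigAlgebra b) (trigAlgebra_separatesPoints hb)
    intro φ
    have hφ : φ ∈ (trigAlgebra b).topologicalClosure := by rw [htop]; trivial
    refine closure_minimal (s := (trigAlgebra b : Set C(ClosedSlab b, ℂ))) ?_ hclosed hφ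
    intro g hg
    replace hg : g ∈ Submodule.span ℂ (range (trig b)) := hg
    change slabFunctional hb f g = 0
    induction hg using Submodule.span_induction with
    | mem x hx => obtain ⟨p, rfl⟩ := hx; exact h1 p
    | zero => simp
    | add x y _ _ hx hy => rw [map_add, hx, hy, add_zero]
    | smul a x _ hx => rw [map_smul, hx, smul_zero]
  have hdense := BoundedContinuousFunction.toLp_denseRange ℂ (vol b) ℂ
    (p := 2) (by norm_num)
  refine hdense.eq_zero_of_inner_right ℂ fun g => ?_
  let φ : C(ClosedSlab b, ℂ) := ⟨fun z => conj (g (z.1, z.2)), by fun_prop⟩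
  have h3 := slabFunctional_eq hb f φ (fun z => conj (g z)) (fun z hz => rfl)
  rw [h2] at h3
  rw [L2.inner_def, h3]
  refine integral_congr_ae ?_
  filter_upwards [BoundedContinuousFunction.coeFn_toLp (p := 2) (𝕜 := ℂ) (vol b) g] with z hz
  rw [hz]; rfl

/-- The Hilbert basis of `L²(Ω)` given by the functions `e^{inx} cos (mπy/b)`. -/
def cosBasis {b : ℝ} (hb : 0 < b) : HilbertBasis (ℤ × ℕ) ℂ (L2Omega b) :=
  HilbertBasis.mkOfOrthogonalEqBot (orthonormal_cosVec hb) (by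
    rw [Submodule.eq_bot_iff]
    intro f hf
    refine eq_zero_of_forall_inner_cosVec hb f fun p => ?_
    exact (Submodule.mem_orthogonal _ _).1 hf _ (Submodule.subset_span ⟨p, rfl⟩))

lemma coe_cosBasis {b : ℝ} (hb : 0 < b) : ⇑(cosBasis hb) = cosVec b :=
  HilbertBasis.coe_mkOfOrthogonalEqBot _ _

/-! ### Coefficients of `H¹` functions -/

lemma inner_cosVec_dxL {b : ℝ} (hb : 0 < b) (u : V b) (p : ℤ × ℕ) :
    inner ℂ (cosVec b p) (dxL b u) = Complex.I * p.1 * inner ℂ (cosVec b p) (valL b u) := by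
  rw [cosVec, inner_smul_left, inner_smul_left, inner_tens_dxL hb u p.1 (contDiff_cosY _ _)]
  ring

/-- The sines vanish on both circles, so no boundary terms appear even though u has nonzero traces.
This is the reason for expanding u in cosines. -/
lemma inner_sinVec_dyL {b : ℝ} (hb : 0 < b) (u : V b) (p : ℤ × ℕ) :
    inner ℂ (sinVec b p) (dyL b u) =
      -((p.2 * Real.pi / b : ℝ) : ℂ) * inner ℂ (cosVec b p) (valL b u) := by
  rw [cosVec, sinVec, inner_smul_left, inner_smul_left, inner_tens_eq, inner_tens_eq]
  simp only [conj_sinY, conj_cosY]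
  have h := (toH1 u).integral_partialY hb
    ((isSmooth_fourier (-p.1)).mul_snd (contDiff_sinY b p.2))
    (by intro x; simp [sinY_zero]) (by intro x; simp [sinY_neg_b hb])
  simp only [(isSmooth_fourier (-p.1)).partialY_mul_snd
    ((contDiff_sinY b p.2).differentiable (by simp)), partialY_fourier, zero_mul, zero_add,
    (hasDerivAt_sinY b p.2 _).deriv] at h
  rw [← toH1_dy, ← toH1_val, ← neg_neg (∫ z, (toH1 u).dy z * _ ∂(vol b)), ← h]
  have h2 : ∫ z, (toH1 u).val z * (fourier (-p.1) z.1 * ((((p.2 : ℤ) : ℝ) * Real.pi / b : ℝ) *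
      cosY b p.2 z.2)) ∂(vol b) = ((p.2 * Real.pi / b : ℝ) : ℂ) *
      ∫ z, (toH1 u).val z * (fourier (-p.1) z.1 * cosY b p.2 z.2) ∂(vol b) := by
    rw [← integral_const_mul]
    refine integral_congr_ae (ae_of_all _ fun z => ?_)
    push_cast
    ring
  rw [h2]
  ring

/-- By periodicity ∂ₓ is skew: in the basis the inner product is a sum of terms in|c|², all purely
imaginary. -/
lemma re_inner_valL_dxL {b : ℝ} (hb : 0 < b) (u : V b) :
    (inner ℂ (valL b u) (dxL b u)).re = 0 := by
  have h := (cosBasis hb).hasSum_inner_mul_inner (valL b u) (dxL b u)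
  have h2 := Complex.hasSum_re h
  refine h2.unique ?_
  have h3 : (fun p => (inner ℂ (valL b u) (cosBasis hb p) *
      inner ℂ (cosBasis hb p) (dxL b u)).re) = fun _ => 0 := by
    ext p
    rw [coe_cosBasis, inner_cosVec_dxL hb, ← inner_conj_symm]
    have : conj (inner ℂ (cosVec b p) (valL b u)) *
        (Complex.I * p.1 * inner ℂ (cosVec b p) (valL b u)) =
        Complex.I * ((p.1 * ‖inner ℂ (cosVec b p) (valL b u)‖ ^ 2 : ℝ) : ℂ) := by
      push_cast
      rw [← Complex.conj_mul']
      ring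
    rw [this]
    simp [-Complex.ofReal_mul]
  rw [h3]
  exact hasSum_zero

/-- Bessel's inequality twice: for ∂ₓu against the cosines and for ∂_y u against the sines. -/
lemma sum_mul_norm_inner_sq_le {b : ℝ} (hb : 0 < b) (u : V b) (s : Finset (ℤ × ℕ)) :
    ∑ p ∈ s, ((p.1 : ℝ) ^ 2 + (p.2 * Real.pi / b) ^ 2) *
      ‖inner ℂ (cosVec b p) (valL b u)‖ ^ 2 ≤ ‖u‖ ^ 2 := by
  have h1 := sum_norm_inner_sq_le (orthonormal_cosVec hb).2
    (fun p => ((orthonormal_cosVec hb).1 p).le) (dxL b u) s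
  have h2 := sum_norm_inner_sq_le (pairwise_sinVec hb) (norm_sinVec_le hb) (dyL b u) s
  simp only [inner_cosVec_dxL hb, inner_sinVec_dyL hb, norm_mul, norm_neg, Complex.norm_I, one_mul,
    Complex.norm_intCast, Complex.norm_real, Real.norm_eq_abs, mul_pow, sq_abs, one_pow] at h1 h2
  rw [norm_sq_V]
  simp only [add_mul, Finset.sum_add_distrib]
  nlinarith [sq_nonneg ‖valL b u‖]

/-- Rellich's theorem for the slab, in the form of a uniform approximation by finite sums. -/
lemma exists_finset_norm_sub_le {b : ℝ} (hb : 0 < b) {ε : ℝ} (hε : 0 < ε) :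
    ∃ s : Finset (ℤ × ℕ), ∀ u : V b,
      ‖valL b u - ∑ p ∈ s, inner ℂ (cosVec b p) (valL b u) • cosVec b p‖ ≤ ε * ‖u‖ := by
  classical
  -- N is so large that |n| > N or m > N forces n² + (mπ/b)² ≥ ε⁻².
  obtain ⟨N, hN⟩ := exists_nat_gt (max ε⁻¹ (ε⁻¹ * b / Real.pi))
  have hN1 : ε⁻¹ < N := (le_max_left _ _).trans_lt hN
  have hN2 : ε⁻¹ * b / Real.pi < N := (le_max_right _ _).trans_lt hN
  have hN2' : ε⁻¹ < N * Real.pi / b := by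
    rw [lt_div_iff₀ hb]
    rwa [div_lt_iff₀ Real.pi_pos] at hN2
  set s : Finset (ℤ × ℕ) := Finset.Icc (-(N : ℤ)) N ×ˢ Finset.range (N + 1) with hs
  refine ⟨s, fun u => ?_⟩
  have hout : ∀ p ∉ s, 1 ≤ ε ^ 2 * ((p.1 : ℝ) ^ 2 + (p.2 * Real.pi / b) ^ 2) := by
    intro p hp
    have hx : ∀ x : ℝ, ε⁻¹ < x → 1 ≤ ε ^ 2 * x ^ 2 := fun x hx => by
      rw [← mul_pow]
      refine one_le_pow₀ ?_
      rw [inv_lt_iff_one_lt_mul₀' hε] at hx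
      exact hx.le
    have hp' : (N : ℤ) < |p.1| ∨ N < p.2 := by
      by_contra hcon
      push Not at hcon
      apply hp
      rw [hs, Finset.mem_product, Finset.mem_Icc, Finset.mem_range]
      exact ⟨abs_le.1 hcon.1, by omega⟩
    rcases hp' with h | h
    · have h1 : (N : ℝ) < |(p.1 : ℝ)| := by exact_mod_cast h
      have h2 := hx _ (hN1.trans h1)
      rw [sq_abs] at h2
      nlinarith [mul_nonneg (sq_nonneg ε) (sq_nonneg (p.2 * Real.pi / b))]
    · have h1 : (N : ℝ) * Real.pi / b < p.2 * Real.pi / b := by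
        have := Real.pi_pos
        have : (N : ℝ) < p.2 := by exact_mod_cast h
        gcongr
      have h2 := hx _ (hN2'.trans h1)
      nlinarith [mul_nonneg (sq_nonneg ε) (sq_nonneg (p.1 : ℝ))]
  set w := valL b u - ∑ p ∈ s, inner ℂ (cosVec b p) (valL b u) • cosVec b p with hw
  have hcoef : ∀ p, inner ℂ (cosVec b p) w =
      if p ∈ s then 0 else inner ℂ (cosVec b p) (valL b u) := by
    intro p
    rw [hw, inner_sub_right, inner_sum]
    simp only [inner_smul_right, inner_cosVec hb, mul_ite, mul_one, mul_zero]
    rw [Finset.sum_ite_eq]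
    split_ifs <;> simp
  have hsum : HasSum (fun p => ‖inner ℂ (cosVec b p) w‖ ^ 2) (‖w‖ ^ 2) := by
    have h := Complex.hasSum_re ((cosBasis hb).hasSum_inner_mul_inner w w)
    rw [coe_cosBasis] at h
    have e : (inner ℂ w w).re = ‖w‖ ^ 2 := by
      rw [inner_self_eq_norm_sq_to_K]
      simp [← Complex.ofReal_pow]
    rw [e] at h
    convert h using 2 with p
    rw [← inner_conj_symm w, Complex.conj_mul']
    simp [← Complex.ofReal_pow]
  have hle : ‖w‖ ^ 2 ≤ ε ^ 2 * ‖u‖ ^ 2 := by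
    refine hasSum_le_of_sum_le hsum fun t => ?_
    calc ∑ p ∈ t, ‖inner ℂ (cosVec b p) w‖ ^ 2
        ≤ ∑ p ∈ t, ε ^ 2 * (((p.1 : ℝ) ^ 2 + (p.2 * Real.pi / b) ^ 2) *
          ‖inner ℂ (cosVec b p) (valL b u)‖ ^ 2) := by
          refine Finset.sum_le_sum fun p _ => ?_
          rw [hcoef]
          split_ifs with h
          · rw [norm_zero, zero_pow two_ne_zero]; positivity
          · rw [← mul_assoc]
            exact le_mul_of_one_le_left (by positivity) (hout p h)
      _ ≤ ε ^ 2 * ‖u‖ ^ 2 := by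
          rw [← Finset.mul_sum]
          exact mul_le_mul_of_nonneg_left (sum_mul_norm_inner_sq_le hb u t) (by positivity)
  rw [← mul_pow] at hle
  exact (sq_le_sq₀ (norm_nonneg _) (mul_nonneg hε.le (norm_nonneg _))).1 hle

/-! ### The Lax-Milgram theorem for complex Hilbert spaces -/

lemma mul_norm_le_of_coercive {H : Type*} [NormedAddCommGroup H] [InnerProductSpace ℂ H]
    {T : H →L[ℂ] H} {c : ℝ} (hT : ∀ u, c * ‖u‖ ^ 2 ≤ ‖inner ℂ u (T u)‖) (u : H) :
    c * ‖u‖ ≤ ‖T u‖ := by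
  rcases (norm_nonneg u).eq_or_lt with h | h
  · rw [← h, mul_zero]; exact norm_nonneg _
  · have h1 := (hT u).trans (norm_inner_le_norm _ _)
    rw [sq, ← mul_assoc, mul_comm ‖u‖ ‖T u‖] at h1
    exact le_of_mul_le_mul_right h1 h

/-- The lower bound makes T injective with closed range, and a vector y orthogonal to the range has
⟨y, T y⟩ = 0, so y = 0. Only the modulus of the form has to be bounded below. -/
lemma bijective_of_coercive {H : Type*} [NormedAddCommGroup H] [InnerProductSpace ℂ H]
    [CompleteSpace H] {T : H →L[ℂ] H} {c : ℝ} (hc : 0 < c)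
    (hT : ∀ u, c * ‖u‖ ^ 2 ≤ ‖inner ℂ u (T u)‖) : Function.Bijective T := by
  have hbound := mul_norm_le_of_coercive hT
  have hanti : AntilipschitzWith (Real.toNNReal c⁻¹) T := by
    refine T.antilipschitz_of_bound fun u => ?_
    rw [Real.coe_toNNReal _ (inv_nonneg.2 hc.le), inv_mul_eq_div, le_div_iff₀ hc, mul_comm]
    exact hbound u
  refine ⟨hanti.injective, ?_⟩
  have hclosed : IsClosed (T.range : Set H) := by
    rw [LinearMap.coe_range]
    exact hanti.isClosed_range T.uniformContinuous
  have : CompleteSpace T.range := hclosed.completeSpace_coe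
  have htop : T.range = ⊤ := by
    rw [← Submodule.orthogonal_eq_bot_iff, Submodule.eq_bot_iff]
    intro y hy
    have h0 : inner ℂ y (T y) = 0 :=
      Submodule.inner_left_of_mem_orthogonal (LinearMap.mem_range_self _ y) hy
    have h1 := hT y
    rw [h0, norm_zero] at h1
    have h2 : ‖y‖ ^ 2 ≤ 0 := by
      by_contra hcon
      push Not at hcon
      nlinarith
    exact norm_eq_zero.1 (pow_eq_zero_iff two_ne_zero |>.1 (le_antisymm h2 (by positivity)))
  intro y
  have : y ∈ T.range := by rw [htop]; trivial
  exact this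

/-! ### The symbol of the Dirichlet-to-Neumann operator -/

/-- `Real.sqrt` is 0 on negative numbers, so one formula covers both cases and makes continuity and
the signs of Re β and Im β evident. -/
lemma beta_eq (ω ξ : ℝ) : beta ω ξ =
    (Real.sqrt (ω ^ 2 - ξ ^ 2) : ℂ) + Complex.I * (Real.sqrt (ξ ^ 2 - ω ^ 2) : ℂ) := by
  rw [beta]
  split_ifs with h
  · rw [Real.sqrt_eq_zero_of_nonpos (x := ξ ^ 2 - ω ^ 2) (by linarith)]
    simp
  · rw [Real.sqrt_eq_zero_of_nonpos (x := ω ^ 2 - ξ ^ 2) (by linarith)]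
    simp

lemma beta_re (ω ξ : ℝ) : (beta ω ξ).re = Real.sqrt (ω ^ 2 - ξ ^ 2) := by simp [beta_eq]

lemma beta_im (ω ξ : ℝ) : (beta ω ξ).im = Real.sqrt (ξ ^ 2 - ω ^ 2) := by simp [beta_eq]

lemma continuous_beta (ω : ℝ) : Continuous (beta ω) := by
  have : beta ω = fun ξ =>
    (Real.sqrt (ω ^ 2 - ξ ^ 2) : ℂ) + Complex.I * (Real.sqrt (ξ ^ 2 - ω ^ 2) : ℂ) :=
    funext (beta_eq ω)
  rw [this]
  fun_prop

lemma sub_le_beta_im {ω : ℝ} (hω : 0 < ω) (ξ : ℝ) : |ξ| - ω ≤ (beta ω ξ).im := by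
  rw [beta_im]
  by_cases h : |ξ| - ω ≤ 0
  · exact h.trans (Real.sqrt_nonneg _)
  · push Not at h
    refine Real.le_sqrt_of_sq_le ?_
    rw [← sq_abs ξ]
    nlinarith

lemma norm_beta_le {ω : ℝ} (hω : 0 < ω) (ξ : ℝ) : ‖beta ω ξ‖ ≤ ω + |ξ| := by
  rw [beta_eq]
  refine (norm_add_le _ _).trans (add_le_add ?_ ?_)
  · rw [Complex.norm_real, Real.norm_of_nonneg (Real.sqrt_nonneg _)]
    exact Real.sqrt_le_iff.2 ⟨hω.le, by nlinarith [sq_nonneg ξ]⟩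
  · rw [norm_mul, Complex.norm_I, one_mul, Complex.norm_real,
      Real.norm_of_nonneg (Real.sqrt_nonneg _)]
    exact Real.sqrt_le_iff.2 ⟨abs_nonneg _, by rw [sq_abs]; nlinarith [sq_nonneg ω]⟩

lemma abs_sqrt_sub_sqrt_le (x y : ℝ) : |Real.sqrt x - Real.sqrt y| ≤ Real.sqrt |x - y| := by
  have key : ∀ x y : ℝ, Real.sqrt x ≤ Real.sqrt y + Real.sqrt |x - y| := by
    intro x y
    refine Real.sqrt_le_iff.2 ⟨by positivity, ?_⟩
    have h1 := Real.sq_sqrt (abs_nonneg (x - y))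
    have h2 : y ≤ Real.sqrt y ^ 2 := by
      rcases le_total 0 y with h | h
      · rw [Real.sq_sqrt h]
      · exact h.trans (sq_nonneg _)
    nlinarith [le_abs_self (x - y), mul_nonneg (Real.sqrt_nonneg y) (Real.sqrt_nonneg |x - y|)]
  rw [abs_le]
  constructor
  · have := key y x
    rw [abs_sub_comm] at this
    linarith
  · linarith [key x y]

/-- β has square-root singularities at ±ω, so Hölder continuity of order 1/2 takes the place of a
Lipschitz bound. -/
lemma norm_beta_sub_le (ω ξ η : ℝ) :
    ‖beta ω ξ - beta ω η‖ ≤ 2 * Real.sqrt |ξ ^ 2 - η ^ 2| := by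
  have h : beta ω ξ - beta ω η =
      ((Real.sqrt (ω ^ 2 - ξ ^ 2) - Real.sqrt (ω ^ 2 - η ^ 2) : ℝ) : ℂ) +
      Complex.I * ((Real.sqrt (ξ ^ 2 - ω ^ 2) - Real.sqrt (η ^ 2 - ω ^ 2) : ℝ) : ℂ) := by
    rw [beta_eq, beta_eq]; push_cast; ring
  rw [h, two_mul]
  refine (norm_add_le _ _).trans (add_le_add ?_ ?_)
  · rw [Complex.norm_real, Real.norm_eq_abs]
    refine (abs_sqrt_sub_sqrt_le _ _).trans_eq ?_
    rw [abs_sub_comm (ξ ^ 2)]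
    congr 2; ring
  · rw [norm_mul, Complex.norm_I, one_mul, Complex.norm_real, Real.norm_eq_abs]
    refine (abs_sqrt_sub_sqrt_le _ _).trans_eq ?_
    congr 2; ring

/-- The multiplier of the Dirichlet-to-Neumann operator in the weighted coordinates `traceSeq`. -/
def dtnSymbol (ω α : ℝ) (n : ℤ) : ℂ :=
  Complex.I * beta ω (n + α) * ((2 * Real.pi * wt n)⁻¹ : ℝ)

lemma norm_dtnSymbol_le {ω : ℝ} (hω : 0 < ω) (α : ℝ) (n : ℤ) :
    ‖dtnSymbol ω α n‖ ≤ ω + |α| + 1 := by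
  have hw := one_le_wt n
  have h1 : ‖beta ω (n + α)‖ ≤ (ω + |α| + 1) * wt n := by
    refine (norm_beta_le hω _).trans ?_
    have h2 := abs_add_le (n : ℝ) α
    have h3 := wt_eq n
    nlinarith [abs_nonneg α, abs_nonneg (n : ℝ)]
  have h4 : 0 < 2 * Real.pi * wt n := by have := Real.pi_pos; positivity
  rw [dtnSymbol, norm_mul, norm_mul, Complex.norm_I, one_mul, Complex.norm_real,
    Real.norm_of_nonneg (by positivity), ← div_eq_mul_inv, div_le_iff₀ h4]
  refine h1.trans ?_
  have h5 : 1 ≤ 2 * Real.pi := by linarith [Real.pi_gt_three]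
  have h6 : 0 ≤ (ω + |α| + 1) := by positivity
  have h7 : wt n ≤ 2 * Real.pi * wt n := le_mul_of_one_le_left (by linarith) h5
  exact mul_le_mul_of_nonneg_left h7 h6

/-- The Dirichlet-to-Neumann operator in the weighted coordinates `traceSeq`. -/
def dtn {ω : ℝ} (hω : 0 < ω) (α : ℝ) : Seq →L[ℂ] Seq :=
  diagCLM (dtnSymbol ω α) (ω + |α| + 1) (norm_dtnSymbol_le hω α)

/-- Re(iβ) = -Im β ≤ 0 and Im(iβ) = Re β ≥ 0. The form contains -T_α, so both signs help coercivity.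
-/
lemma re_inner_dtn_nonpos {ω : ℝ} (hω : 0 < ω) (α : ℝ) (w : Seq) :
    (inner ℂ w (dtn hω α w)).re ≤ 0 ∧ 0 ≤ (inner ℂ w (dtn hω α w)).im := by
  have h := lp.hasSum_inner (𝕜 := ℂ) w (dtn hω α w)
  have e : ∀ n, inner ℂ (w n) (dtn hω α w n) =
      Complex.I * beta ω (n + α) * (((2 * Real.pi * wt n)⁻¹ * ‖w n‖ ^ 2 : ℝ) : ℂ) := by
    intro n
    change (dtnSymbol ω α n * w n) * conj (w n) = _
    rw [mul_assoc, Complex.mul_conj', dtnSymbol]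
    push_cast
    ring
  simp only [e] at h
  have hpos : ∀ n, 0 ≤ (2 * Real.pi * wt n)⁻¹ * ‖w n‖ ^ 2 := fun n => by
    have := wt_pos n
    have := Real.pi_pos
    positivity
  constructor
  · refine hasSum_le (fun n => ?_) (Complex.hasSum_re h) hasSum_zero
    rw [Complex.re_mul_ofReal]
    simp only [Complex.mul_re, Complex.I_re, Complex.I_im, zero_mul, one_mul, zero_sub, beta_im]
    exact mul_nonpos_of_nonpos_of_nonneg (neg_nonpos.2 (Real.sqrt_nonneg _)) (hpos n)
  · refine hasSum_le (fun n => ?_) hasSum_zero (Complex.hasSum_im h)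
    rw [Complex.im_mul_ofReal]
    simp only [Complex.mul_im, Complex.I_re, Complex.I_im, zero_mul, one_mul, zero_add, beta_re]
    exact mul_nonneg (Real.sqrt_nonneg _) (hpos n)

/-- The two weights 2π√(1+|n|) and the factor (2π(1+|n|))⁻¹ of the symbol leave the single 2π of the
pairing. The unimodular a absorbs the sign in the lower boundary coordinates. -/
lemma isDtNPairing_of_coeff {ω : ℝ} (hω : 0 < ω) (α : ℝ) {f g : L2Gamma} {x y : Seq} {a : ℂ}
    (ha : a * conj a = 1)
    (hx : ∀ n, x n = a * (2 * (Real.pi : ℂ) * (Real.sqrt (wt n) : ℂ) * fourierCoeff (f : S → ℂ) n))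
    (hy : ∀ n, y n = a * (2 * (Real.pi : ℂ) * (Real.sqrt (wt n) : ℂ) *
      fourierCoeff (g : S → ℂ) n)) :
    IsDtNPairing ω α f g (inner ℂ y (dtn hω α x)) := by
  have h := lp.hasSum_inner (𝕜 := ℂ) y (dtn hω α x)
  have e : ∀ n, inner ℂ (y n) (dtn hω α x n) = 2 * (Real.pi : ℂ) *
    (Complex.I * beta ω (n + α) * fourierCoeff (f : S → ℂ) n *
      conj (fourierCoeff (g : S → ℂ) n)) := by
    intro n
    change (dtnSymbol ω α n * x n) * conj (y n) = _
    have h1 : (Real.sqrt (wt n) : ℂ) * (Real.sqrt (wt n) : ℂ) = (wt n : ℂ) := by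
      rw [← Complex.ofReal_mul, Real.mul_self_sqrt (wt_pos n).le]
    have h2 : (wt n : ℂ) ≠ 0 := by exact_mod_cast (wt_pos n).ne'
    have h3 : (Real.pi : ℂ) ≠ 0 := by exact_mod_cast Real.pi_ne_zero
    have h4 : (((2 * Real.pi * wt n)⁻¹ : ℝ) : ℂ) * (2 * Real.pi * wt n) = 1 := by
      push_cast; field_simp
    rw [hx, hy, dtnSymbol]
    simp only [map_mul, Complex.conj_ofReal, map_ofNat]
    calc _ = (a * conj a) * ((((2 * Real.pi * wt n)⁻¹ : ℝ) : ℂ) * (2 * Real.pi *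
          ((Real.sqrt (wt n) : ℂ) * (Real.sqrt (wt n) : ℂ)))) * (2 * (Real.pi : ℂ) *
          (Complex.I * beta ω (n + α) * fourierCoeff (f : S → ℂ) n *
          conj (fourierCoeff (g : S → ℂ) n))) := by ring
      _ = _ := by rw [ha, h1, h4, one_mul, one_mul]
  simp only [e] at h
  exact h

lemma isDtNPairing_traceTop {b ω : ℝ} (hb : 0 < b) (hω : 0 < ω) (α : ℝ) (u v : V b) :
    IsDtNPairing ω α (traceTop b u) (traceTop b v)
      (inner ℂ (traceSeq hb true v) (dtn hω α (traceSeq hb true u))) :=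
  isDtNPairing_of_coeff hω α (a := 1) (by simp) (fun n => by rw [traceSeq_true, one_mul])
    (fun n => by rw [traceSeq_true, one_mul])

lemma isDtNPairing_traceBot {b ω : ℝ} (hb : 0 < b) (hω : 0 < ω) (α : ℝ) (u v : V b) :
    IsDtNPairing ω α (traceBot b u) (traceBot b v)
      (inner ℂ (traceSeq hb false v) (dtn hω α (traceSeq hb false u))) :=
  isDtNPairing_of_coeff hω α (a := -1) (by simp) (fun n => by rw [traceSeq_false, neg_one_mul])
    (fun n => by rw [traceSeq_false, neg_one_mul])

/-- (n+α)² - (n+α')² is only linear in n, so the difference of the β's is of order √(|α-α'|(1+|n|)),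
which the weight absorbs uniformly in n. -/
lemma exists_norm_dtn_sub_le {ω : ℝ} (hω : 0 < ω) {α α' : ℝ} (hα : α ∈ K) (hα' : α' ∈ K)
    (w : Seq) : ‖dtn hω α w - dtn hω α' w‖ ≤ 2 * Real.sqrt (2 * |α - α'|) * ‖w‖ := by
  refine norm_le_of_forall_norm_apply_le (m := fun n => dtnSymbol ω α n - dtnSymbol ω α' n)
    (fun n => ?_) (by positivity) w _ (fun n => (sub_mul _ _ _).symm)
  have hw := one_le_wt n
  have hpi := Real.pi_gt_three
  have h1 : dtnSymbol ω α n - dtnSymbol ω α' n = Complex.I *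
      (beta ω (n + α) - beta ω (n + α')) * (((2 * Real.pi * wt n)⁻¹ : ℝ) : ℂ) := by
    rw [dtnSymbol, dtnSymbol]; ring
  have h2 : |((n : ℝ) + α) ^ 2 - ((n : ℝ) + α') ^ 2| ≤ 2 * |α - α'| * wt n := by
    have e : ((n : ℝ) + α) ^ 2 - ((n : ℝ) + α') ^ 2 = (α - α') * (2 * n + (α + α')) := by ring
    rw [e, abs_mul, mul_comm 2 |α - α'|, mul_assoc]
    refine mul_le_mul_of_nonneg_left ?_ (abs_nonneg (α - α'))
    refine (abs_add_le (2 * (n : ℝ)) (α + α')).trans ?_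
    have h3 : |α + α'| ≤ 1 := abs_le.2 ⟨by linarith [hα.1, hα'.1], by linarith [hα.2, hα'.2]⟩
    rw [abs_mul, abs_two, wt_eq]
    linarith
  have h3 : Real.sqrt |((n : ℝ) + α) ^ 2 - ((n : ℝ) + α') ^ 2| ≤
      Real.sqrt (2 * |α - α'|) * wt n := by
    refine (Real.sqrt_le_sqrt h2).trans ?_
    rw [Real.sqrt_mul (by positivity)]
    refine mul_le_mul_of_nonneg_left ?_ (Real.sqrt_nonneg _)
    exact Real.sqrt_le_iff.2 ⟨by linarith, by nlinarith⟩
  have h4 : 0 < 2 * Real.pi * wt n := by positivity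
  rw [h1, norm_mul, norm_mul, Complex.norm_I, one_mul, Complex.norm_real,
    Real.norm_of_nonneg (by positivity), ← div_eq_mul_inv, div_le_iff₀ h4]
  refine (norm_beta_sub_le _ _ _).trans ?_
  have h5 : wt n ≤ 2 * Real.pi * wt n := le_mul_of_one_le_left (by linarith) (by linarith)
  have h6 := mul_le_mul_of_nonneg_left h5 (Real.sqrt_nonneg (2 * |α - α'|))
  linarith

/-! ### The incident field -/

/-- The function on the circle with absolutely summable Fourier coefficients `c`. -/
def fourierSeries (c : ℤ → ℂ) : C(S, ℂ) := ∑' n, c n • fourier n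

lemma summable_smul_fourier {c : ℤ → ℂ} (hc : Summable fun n => ‖c n‖) :
    Summable fun n => c n • (fourier n : C(S, ℂ)) := by
  refine Summable.of_norm ?_
  simpa only [norm_smul, fourier_norm, mul_one] using hc

lemma fourierSeries_apply {c : ℤ → ℂ} (hc : Summable fun n => ‖c n‖) (x : S) :
    fourierSeries c x = ∑' n, c n * fourier n x := by
  rw [fourierSeries, ← ContinuousMap.tsum_apply (summable_smul_fourier hc)]
  rfl

/-- The exponential factor `e^{iβ(n+α)h}`. -/
def expCoeff (ω h α : ℝ) (n : ℤ) : ℂ := Complex.exp (Complex.I * beta ω (n + α) * h)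

/-- |e^{iβh}| = e^{-h Im β} and Im β ≥ |n+α| - ω, whence geometric decay in |n|. -/
lemma norm_expCoeff_le {ω h : ℝ} (hω : 0 < ω) (hh : 0 < h) (α : ℝ) (n : ℤ) :
    ‖expCoeff ω h α n‖ ≤ Real.exp (h * (ω + |α|)) * Real.exp (-h) ^ n.natAbs := by
  rw [expCoeff, Complex.norm_exp, ← Real.exp_nat_mul, ← Real.exp_add, Real.exp_le_exp]
  rw [Complex.re_mul_ofReal]
  simp only [Complex.mul_re, Complex.I_re, Complex.I_im, zero_mul, one_mul, zero_sub]
  have h1 := sub_le_beta_im hω ((n : ℝ) + α)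
  have h2 : |(n : ℝ)| ≤ |(n : ℝ) + α| + |α| := by
    have := abs_sub (n + α : ℝ) α
    simpa using this
  have h3 : (n.natAbs : ℝ) = |(n : ℝ)| := by rw [Nat.cast_natAbs]; push_cast; rfl
  rw [h3]
  nlinarith

lemma summable_exp_natAbs {h : ℝ} (hh : 0 < h) :
    Summable fun n : ℤ => Real.exp (-h) ^ n.natAbs := by
  have h1 : Real.exp (-h) < 1 := by rw [Real.exp_lt_one_iff]; linarith
  have := summable_geometric_of_lt_one (Real.exp_pos _).le h1
  refine Summable.of_nat_of_neg ?_ ?_ <;> simpa using this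

lemma summable_norm_expCoeff {ω h : ℝ} (hω : 0 < ω) (hh : 0 < h) (α : ℝ) :
    Summable fun n => ‖expCoeff ω h α n‖ :=
  Summable.of_nonneg_of_le (fun _ => norm_nonneg _) (norm_expCoeff_le hω hh α)
    ((summable_exp_natAbs hh).mul_left _)

/-- The boundary datum `g_α` as a continuous function. -/
def gCont (ω h α : ℝ) : C(S, ℂ) := (-Complex.I / Real.pi : ℂ) • fourierSeries (expCoeff ω h α)

lemma gCont_apply {ω h : ℝ} (hω : 0 < ω) (hh : 0 < h) (α : ℝ) (x : S) :
    gCont ω h α x = gData ω h α x := by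
  rw [gCont, ContinuousMap.smul_apply, fourierSeries_apply (summable_norm_expCoeff hω hh α)]
  rfl

lemma continuousOn_gCont {ω h : ℝ} (hω : 0 < ω) (hh : 0 < h) : ContinuousOn (gCont ω h) K := by
  have key : ContinuousOn (fun α => fourierSeries (expCoeff ω h α)) K := ?_
  · exact key.const_smul (-Complex.I / Real.pi : ℂ)
  refine continuousOn_tsum (u := fun n : ℤ => Real.exp (h * (ω + 1)) * Real.exp (-h) ^ n.natAbs)
    (fun n => ?_) ((summable_exp_natAbs hh).mul_left _) (fun n α hα => ?_)
  · refine Continuous.continuousOn ?_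
    have : Continuous fun α => expCoeff ω h α n := by
      have := continuous_beta ω
      unfold expCoeff
      fun_prop
    exact this.smul continuous_const
  · rw [norm_smul, fourier_norm, mul_one]
    refine (norm_expCoeff_le hω hh α n).trans ?_
    have : |α| ≤ 1 := abs_le.2 ⟨by linarith [hα.1], by linarith [hα.2]⟩
    gcongr

/-! ### The operator of the boundary value problem -/

/-- The operator on `H¹(Ω)` that represents the sesquilinear form of the scattering problem. -/
def opA {b ω : ℝ} (hb : 0 < b) (hω : 0 < ω) (ρ : LinfOmega b) (α : ℝ) : V b →L[ℂ] V b :=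
  (dxL b).adjoint.comp (dxL b) + (dyL b).adjoint.comp (dyL b) -
    ((ω : ℂ) ^ 2) • (valL b).adjoint.comp ((mulL ρ).comp (valL b)) +
    ((α : ℂ) ^ 2) • (valL b).adjoint.comp (valL b) -
    (2 * Complex.I * (α : ℂ)) • (valL b).adjoint.comp (dxL b) -
    (traceSeq hb true).adjoint.comp ((dtn hω α).comp (traceSeq hb true)) -
    (traceSeq hb false).adjoint.comp ((dtn hω α).comp (traceSeq hb false))

lemma inner_smul_right_V {b : ℝ} (v w : V b) (c : ℂ) :
    inner ℂ v (c • w) = c * inner ℂ v w := inner_smul_right v w c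

lemma inner_opA {b ω : ℝ} (hb : 0 < b) (hω : 0 < ω) (ρ : LinfOmega b) (α : ℝ) (u v : V b) :
    inner ℂ v (opA hb hω ρ α u) =
      inner ℂ (dxL b v) (dxL b u) + inner ℂ (dyL b v) (dyL b u) -
        (ω : ℂ) ^ 2 * inner ℂ (valL b v) (mulL ρ (valL b u)) +
        (α : ℂ) ^ 2 * inner ℂ (valL b v) (valL b u) -
        2 * Complex.I * (α : ℂ) * inner ℂ (valL b v) (dxL b u) -
        inner ℂ (traceSeq hb true v) (dtn hω α (traceSeq hb true u)) -
        inner ℂ (traceSeq hb false v) (dtn hω α (traceSeq hb false u)) := by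
  simp only [opA, sub_apply, add_apply,
    smul_apply, ContinuousLinearMap.comp_apply, inner_sub_right,
    inner_add_right, inner_smul_right_V, ContinuousLinearMap.adjoint_inner_right]

/-- The right-hand side of the scattering problem. -/
def rhs (b ω h α : ℝ) : V b := (2 : ℂ) • (traceTop b).adjoint (toL2S (gCont ω h α))

lemma inner_rhs {b ω h : ℝ} (hω : 0 < ω) (hh : 0 < h) (α : ℝ) (v : V b) :
    inner ℂ v (rhs b ω h α) = 2 * ∫ x : S, gData ω h α x * conj (traceTop b v x) := by
  rw [rhs, inner_smul_right_V, ContinuousLinearMap.adjoint_inner_right, L2.inner_def]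
  congr 1
  refine integral_congr_ae ?_
  filter_upwards [coeFn_toL2S (gCont ω h α)] with x hx
  rw [hx, gCont_apply hω hh]
  rfl

lemma inner_eq_integral {b : ℝ} (f g : L2Omega b) :
    inner ℂ f g = ∫ z, g z * conj (f z) ∂(vol b) := rfl

lemma inner_mulL {b : ℝ} (ρ : LinfOmega b) (f g : L2Omega b) :
    inner ℂ f (mulL ρ g) = ∫ z, ρ z * g z * conj (f z) ∂(vol b) := by
  rw [inner_eq_integral]
  refine integral_congr_ae ?_
  filter_upwards [coeFn_mulL ρ g] with z hz
  rw [hz]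

/-- Traces and sums of series are unique, so the existentially quantified boundary data in
`IsWeakSolution` must be the values of the trace operators and of `dtn`. The remaining identity is
tested against every v in the Hilbert space. -/
lemma isWeakSolution_iff {b ω h : ℝ} (hb : 0 < b) (hω : 0 < ω) (hh : 0 < h) (ρ : LinfOmega b)
    (α : ℝ) (u : V b) :
    IsWeakSolution ω h α ρ (toH1 u) ↔ opA hb hω ρ α u = rhs b ω h α := by
  have hint : ∀ v : V b, ∫ z, (dxL b u z * conj (dxL b v z) + dyL b u z * conj (dyL b v z)) ∂(vol b)
      = inner ℂ (dxL b v) (dxL b u) + inner ℂ (dyL b v) (dyL b u) := fun v =>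
    integral_add (L2.integrable_inner (𝕜 := ℂ) (dxL b v) (dxL b u))
      (L2.integrable_inner (𝕜 := ℂ) (dyL b v) (dyL b u))
  constructor
  · rintro ⟨u₀, ub, hu, H⟩
    obtain ⟨rfl, rfl⟩ := (isTrace_trace hb u).unique hb hu
    refine ext_inner_left ℂ fun v => ?_
    obtain ⟨v₀, vb, t₀, tb, hv, h₀, hb', heq⟩ := H (toH1 v)
    obtain ⟨rfl, rfl⟩ := (isTrace_trace hb v).unique hb hv
    have e₀ := h₀.unique (isDtNPairing_traceTop hb hω α u v)
    have eb := hb'.unique (isDtNPairing_traceBot hb hω α u v)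
    rw [inner_opA, inner_rhs hω hh, ← heq, ← e₀, ← eb, inner_mulL, ← hint]
    simp only [toH1_val, toH1_dx, toH1_dy, inner_eq_integral]
  · intro H
    refine ⟨_, _, isTrace_trace hb u, fun v => ?_⟩
    obtain ⟨v, rfl⟩ : ∃ w : V b, toH1 w = v := ⟨v.toV, toH1_toV v⟩
    refine ⟨_, _, _, _, isTrace_trace hb v, isDtNPairing_traceTop hb hω α u v,
      isDtNPairing_traceBot hb hω α u v, ?_⟩
    rw [← inner_rhs hω hh, ← H, inner_opA, inner_mulL, ← hint]
    simp only [toH1_val, toH1_dx, toH1_dy, inner_eq_integral]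

/-! ### Coercivity -/

lemma admissible_inner_mulL {b r₀ r₁ i₀ i₁ : ℝ} {ρ : LinfOmega b}
    (hρ : ρ ∈ admissible b r₀ r₁ i₀ i₁) (f : L2Omega b) :
    (inner ℂ f (mulL ρ f)).re ≤ r₁ * ‖f‖ ^ 2 ∧ i₀ * ‖f‖ ^ 2 ≤ (inner ℂ f (mulL ρ f)).im := by
  have hI : Integrable (fun z => ρ z * f z * conj (f z)) (vol b) := by
    refine (L2.integrable_inner (𝕜 := ℂ) f (mulL ρ f)).congr ?_
    filter_upwards [coeFn_mulL ρ f] with z hz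
    rw [hz]; rfl
  have hN : Integrable (fun z => ‖f z‖ ^ 2) (vol b) :=
    (Lp.memLp f).integrable_norm_pow (by norm_num)
  have hn : ‖f‖ ^ 2 = ∫ z, ‖f z‖ ^ 2 ∂(vol b) := by
    have h1 := inner_self_eq_norm_sq_to_K (𝕜 := ℂ) f
    rw [inner_eq_integral] at h1
    simp only [Complex.mul_conj'] at h1
    apply Complex.ofReal_injective
    rw [← integral_complex_ofReal]
    push_cast
    exact h1.symm
  have hz : ∀ z, ρ z * f z * conj (f z) = ρ z * ((‖f z‖ ^ 2 : ℝ) : ℂ) := fun z => by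
    rw [mul_assoc, Complex.mul_conj']; push_cast; rfl
  rw [inner_mulL, hn, ← integral_const_mul, ← integral_const_mul]
  have hre := integral_re hI
  have him := integral_im hI
  simp only [RCLike.re_to_complex, RCLike.im_to_complex] at hre him
  rw [← hre, ← him]
  constructor
  · refine integral_mono_ae hI.re (hN.const_mul _) ?_
    filter_upwards [hρ] with z h
    rw [hz, Complex.re_mul_ofReal]
    exact mul_le_mul_of_nonneg_right h.1.2 (by positivity)
  · refine integral_mono_ae (hN.const_mul _) hI.im ?_
    filter_upwards [hρ] with z h
    rw [hz, Complex.im_mul_ofReal]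
    exact mul_le_mul_of_nonneg_right h.2.1 (by positivity)

lemma inner_self_re_im {H : Type*} [NormedAddCommGroup H] [InnerProductSpace ℂ H] (u : H) :
    (inner ℂ u u).re = ‖u‖ ^ 2 ∧ (inner ℂ u u).im = 0 := by
  rw [inner_self_eq_norm_sq_to_K]
  simp [← Complex.ofReal_pow]

/-- The coercivity constant. -/
def coer (ω r₁ i₀ : ℝ) : ℝ := (2 * (1 + (ω ^ 2 * r₁ + 1) / (ω ^ 2 * i₀)))⁻¹

lemma coer_pos {ω r₁ i₀ : ℝ} (hω : 0 < ω) (hr : 0 < r₁) (hi : 0 < i₀) : 0 < coer ω r₁ i₀ := by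
  unfold coer; positivity

/-- X, Y, Z stand for the norms of u, ∂ₓu, ∂_y u, and p for Im⟨u, ∂ₓu⟩. On K one has |2α| ≤ 1, so
2αp ≥ -(X² + Y²)/2 costs only half of Y²; the negative multiple of X² is repaired by absorption. -/
lemma coer_mul_le_of_bounds {ω r₁ i₀ α X Y Z p N re im : ℝ} (hω : 0 < ω) (hr : 0 < r₁)
    (hi : 0 < i₀) (hα : α ∈ K) (hxn : |p| ≤ X * Y) (hre : re ≤ N) (him : -im ≤ N)
    (h1 : Y ^ 2 + Z ^ 2 - ω ^ 2 * (r₁ * X ^ 2) + α ^ 2 * X ^ 2 + 2 * α * p ≤ re)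
    (h2 : ω ^ 2 * (i₀ * X ^ 2) ≤ -im) :
    coer ω r₁ i₀ * (X ^ 2 + Y ^ 2 + Z ^ 2) ≤ N := by
  have hα1 : |2 * α| ≤ 1 := abs_le.2 ⟨by linarith [hα.1], by linarith [hα.2]⟩
  have hp : -(X * Y) ≤ 2 * α * p := by
    have : |2 * α * p| ≤ 1 * (X * Y) := by
      rw [abs_mul]; exact mul_le_mul hα1 hxn (abs_nonneg _) zero_le_one
    linarith [neg_abs_le (2 * α * p)]
  have Re : Y ^ 2 / 2 + Z ^ 2 - (ω ^ 2 * r₁ + 1 / 2) * X ^ 2 ≤ re := by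
    nlinarith [sq_nonneg (X - Y), sq_nonneg (α * X)]
  -- With this l the absorption term exceeds the deficit (ω² r₁ + 1/2)X² by exactly X²/2.
  set l := (ω ^ 2 * r₁ + 1) / (ω ^ 2 * i₀) with hl
  have hl0 : 0 < l := by positivity
  have hl1 : l * (ω ^ 2 * i₀) = ω ^ 2 * r₁ + 1 := by rw [hl]; field_simp
  have h3 : (X ^ 2 + Y ^ 2 + Z ^ 2) / 2 ≤ re + l * (-im) := by
    have h4 := mul_le_mul_of_nonneg_left h2 hl0.le
    have h5 : l * (ω ^ 2 * (i₀ * X ^ 2)) = (ω ^ 2 * r₁ + 1) * X ^ 2 := by rw [← hl1]; ring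
    rw [h5] at h4
    linarith [sq_nonneg Z]
  have h4 : re + l * (-im) ≤ (1 + l) * N := by
    linarith [mul_le_mul_of_nonneg_left him hl0.le]
  rw [coer, ← hl, inv_mul_le_iff₀ (by positivity)]
  linarith

lemma coer_mul_le {b ω r₀ r₁ i₀ i₁ : ℝ} (hb : 0 < b) (hω : 0 < ω) (hr : 0 < r₁) (hi : 0 < i₀)
    {ρ : LinfOmega b} (hρ : ρ ∈ admissible b r₀ r₁ i₀ i₁) {α : ℝ} (hα : α ∈ K) (u : V b) :
    coer ω r₁ i₀ * ‖u‖ ^ 2 ≤ ‖inner ℂ u (opA hb hω ρ α u)‖ := by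
  set a := inner ℂ u (opA hb hω ρ α u) with ha
  rw [inner_opA] at ha
  obtain ⟨m1, m2⟩ := admissible_inner_mulL hρ (valL b u)
  obtain ⟨t1, t2⟩ := re_inner_dtn_nonpos hω α (traceSeq hb true u)
  obtain ⟨s1, s2⟩ := re_inner_dtn_nonpos hω α (traceSeq hb false u)
  -- Hence -2iα⟨u, ∂ₓu⟩ is the real number 2α Im⟨u, ∂ₓu⟩ and does not disturb the sign of Im a.
  have hx := re_inner_valL_dxL hb u
  have hxn : |(inner ℂ (valL b u) (dxL b u)).im| ≤ ‖valL b u‖ * ‖dxL b u‖ :=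
    (Complex.abs_im_le_norm _).trans (norm_inner_le_norm _ _)
  obtain ⟨n1, n1'⟩ := inner_self_re_im (valL b u)
  obtain ⟨n2, n2'⟩ := inner_self_re_im (dxL b u)
  obtain ⟨n3, n3'⟩ := inner_self_re_im (dyL b u)
  have hω2 : ((ω : ℂ) ^ 2) = ((ω ^ 2 : ℝ) : ℂ) := by push_cast; rfl
  have hα2 : ((α : ℂ) ^ 2) = ((α ^ 2 : ℝ) : ℂ) := by push_cast; rfl
  have h2α : (2 * Complex.I * (α : ℂ)) = Complex.I * ((2 * α : ℝ) : ℂ) := by push_cast; ring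
  have hre := congrArg Complex.re ha
  have him := congrArg Complex.im ha
  rw [hω2, hα2, h2α] at hre him
  simp only [Complex.sub_re, Complex.add_re, Complex.re_ofReal_mul, Complex.sub_im, Complex.add_im,
    Complex.im_ofReal_mul, mul_assoc Complex.I, Complex.I_mul_re, Complex.I_mul_im,
    n1, n2, n3, n1', n2', n3', hx] at hre him
  rw [norm_sq_V]
  set X := ‖valL b u‖
  set Y := ‖dxL b u‖
  set Z := ‖dyL b u‖
  have hX : 0 ≤ X := norm_nonneg _
  have hY : 0 ≤ Y := norm_nonneg _
  refine coer_mul_le_of_bounds hω hr hi hα hxn (Complex.re_le_norm a)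
    ((neg_le_abs _).trans (Complex.abs_im_le_norm a)) ?_ ?_
  · rw [hre]
    linarith [mul_le_mul_of_nonneg_left m1 (sq_nonneg ω)]
  · rw [him]
    linarith [mul_le_mul_of_nonneg_left m2 (sq_nonneg ω)]

/-! ### Solutions of the boundary value problem -/

/-- The weak solution of the boundary value problem, for admissible `ρ` and `α ∈ K`. -/
def sol {b ω : ℝ} (hb : 0 < b) (hω : 0 < ω) (h : ℝ) (ρ : LinfOmega b) (α : ℝ) : V b :=
  Function.invFun (opA hb hω ρ α) (rhs b ω h α)

section Solution

variable {b ω h r₀ r₁ i₀ i₁ : ℝ}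

lemma bijective_opA (hb : 0 < b) (hω : 0 < ω) (hr : 0 < r₁) (hi : 0 < i₀)
    {ρ : LinfOmega b} (hρ : ρ ∈ admissible b r₀ r₁ i₀ i₁) {α : ℝ} (hα : α ∈ K) :
    Function.Bijective (opA hb hω ρ α) :=
  bijective_of_coercive (coer_pos hω hr hi) (coer_mul_le hb hω hr hi hρ hα)

lemma opA_sol (hb : 0 < b) (hω : 0 < ω) (h : ℝ) (hr : 0 < r₁) (hi : 0 < i₀)
    {ρ : LinfOmega b} (hρ : ρ ∈ admissible b r₀ r₁ i₀ i₁) {α : ℝ} (hα : α ∈ K) :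
    opA hb hω ρ α (sol hb hω h ρ α) = rhs b ω h α :=
  Function.invFun_eq ((bijective_opA hb hω hr hi hρ hα).2 _)

lemma coer_mul_norm_le (hb : 0 < b) (hω : 0 < ω) (hr : 0 < r₁) (hi : 0 < i₀)
    {ρ : LinfOmega b} (hρ : ρ ∈ admissible b r₀ r₁ i₀ i₁) {α : ℝ} (hα : α ∈ K) (u : V b) :
    coer ω r₁ i₀ * ‖u‖ ≤ ‖opA hb hω ρ α u‖ :=
  mul_norm_le_of_coercive (coer_mul_le hb hω hr hi hρ hα) u

lemma eq_toH1_sol (hb : 0 < b) (hω : 0 < ω) (hh : 0 < h) (hr : 0 < r₁) (hi : 0 < i₀)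
    {ρ : LinfOmega b} (hρ : ρ ∈ admissible b r₀ r₁ i₀ i₁) {α : ℝ} (hα : α ∈ K) {u : H1 b}
    (hu : IsWeakSolution ω h α ρ u) : u = toH1 (sol hb hω h ρ α) := by
  rw [← toH1_toV u, isWeakSolution_iff hb hω hh] at hu
  rw [← toH1_toV u]
  congr 1
  exact (bijective_opA hb hω hr hi hρ hα).1 (hu.trans (opA_sol hb hω h hr hi hρ hα).symm)

lemma isWeakSolution_sol (hb : 0 < b) (hω : 0 < ω) (hh : 0 < h) (hr : 0 < r₁) (hi : 0 < i₀)
    {ρ : LinfOmega b} (hρ : ρ ∈ admissible b r₀ r₁ i₀ i₁) {α : ℝ} (hα : α ∈ K) :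
    IsWeakSolution ω h α ρ (toH1 (sol hb hω h ρ α)) :=
  (isWeakSolution_iff hb hω hh ρ α _).2 (opA_sol hb hω h hr hi hρ hα)

lemma existsUnique_weakSolution (hb : 0 < b) (hω : 0 < ω) (hh : 0 < h) (hr : 0 < r₁) (hi : 0 < i₀)
    {ρ : LinfOmega b} (hρ : ρ ∈ admissible b r₀ r₁ i₀ i₁) {α : ℝ} (hα : α ∈ K) :
    ∃! p : H1 b × L2Gamma × L2Gamma,
      IsWeakSolution ω h α ρ p.1 ∧ IsTrace p.1 p.2.1 p.2.2 := by
  refine ⟨(toH1 (sol hb hω h ρ α), traceTop b (sol hb hω h ρ α), traceBot b (sol hb hω h ρ α)),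
    ⟨isWeakSolution_sol hb hω hh hr hi hρ hα, isTrace_trace hb _⟩, ?_⟩
  rintro ⟨u, τ₀, τb⟩ ⟨hu, hτ⟩
  have hu := eq_toH1_sol hb hω hh hr hi hρ hα hu
  simp only at hu hτ
  subst hu
  obtain ⟨h1, h2⟩ := hτ.unique hb (isTrace_trace hb _)
  rw [h1, h2]

lemma F_eq (hb : 0 < b) (hω : 0 < ω) (hh : 0 < h) (hr : 0 < r₁) (hi : 0 < i₀)
    {ρ : LinfOmega b} (hρ : ρ ∈ admissible b r₀ r₁ i₀ i₁) {α : ℝ} (hα : α ∈ K) :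
    F ω b h ρ α = traceBot b (sol hb hω h ρ α) := by
  have H : ∃ τb : L2Gamma, ∃ (u : H1 b) (τ₀ : L2Gamma),
      IsWeakSolution ω h α ρ u ∧ IsTrace u τ₀ τb :=
    ⟨_, _, _, isWeakSolution_sol hb hω hh hr hi hρ hα, isTrace_trace hb _⟩
  rw [F, dif_pos H]
  obtain ⟨u, τ₀, hu, hτ⟩ := H.choose_spec
  have hu := eq_toH1_sol hb hω hh hr hi hρ hα hu
  rw [hu] at hτ
  exact (hτ.unique hb (isTrace_trace hb _)).2

/-! ### Dependence on the Bloch parameter -/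

lemma isCompact_K : IsCompact K := isCompact_Icc

lemma measurableSet_K : MeasurableSet K := measurableSet_Icc

lemma continuousOn_rhs (hω : 0 < ω) (hh : 0 < h) : ContinuousOn (rhs b ω h) K := by
  have h1 : ContinuousOn (fun α => (traceTop b).adjoint (toL2S (gCont ω h α))) K :=
    ((traceTop b).adjoint.continuous.comp toL2S.continuous).comp_continuousOn
      (continuousOn_gCont hω hh)
  exact h1.const_smul (2 : ℂ)

lemma continuousOn_dtn (hω : 0 < ω) (w : Seq) : ContinuousOn (fun α => dtn hω α w) K := by
  intro α₀ hα₀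
  rw [ContinuousWithinAt, tendsto_iff_norm_sub_tendsto_zero]
  have h1 : Tendsto (fun α => 2 * Real.sqrt (2 * |α - α₀|) * ‖w‖) (𝓝[K] α₀) (𝓝 0) := by
    have : Continuous fun α => 2 * Real.sqrt (2 * |α - α₀|) * ‖w‖ := by fun_prop
    have := (this.tendsto α₀).mono_left (nhdsWithin_le_nhds (s := K))
    simpa using this
  refine squeeze_zero' (Eventually.of_forall fun _ => norm_nonneg _) ?_ h1
  filter_upwards [self_mem_nhdsWithin] with α hα
  exact exists_norm_dtn_sub_le hω hα hα₀ w

lemma continuousOn_opA (hb : 0 < b) (hω : 0 < ω) (ρ : LinfOmega b) (u : V b) :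
    ContinuousOn (fun α => opA hb hω ρ α u) K := by
  have h1 : ∀ s, ContinuousOn
      (fun α => (traceSeq hb s).adjoint (dtn hω α (traceSeq hb s u))) K := fun s =>
    (traceSeq hb s).adjoint.continuous.comp_continuousOn (continuousOn_dtn hω _)
  have h2 : ∀ (c : ℝ → ℂ) (v : V b), Continuous c → ContinuousOn (fun α => c α • v) K :=
    fun c v hc => (hc.smul continuous_const).continuousOn
  exact (((((continuousOn_const).add (h2 (fun α => (α : ℂ) ^ 2) _ (by fun_prop))).sub
    (h2 (fun α => 2 * Complex.I * (α : ℂ)) _ (by fun_prop))).sub (h1 true)).sub (h1 false))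

/-- The operator at α maps u_α - u_{α₀} to the residual of the fixed vector u_{α₀}. The residual
tends to 0 by strong continuity, and the coercivity constant is independent of α. -/
lemma continuousOn_sol (hb : 0 < b) (hω : 0 < ω) (hh : 0 < h) (hr : 0 < r₁) (hi : 0 < i₀)
    {ρ : LinfOmega b} (hρ : ρ ∈ admissible b r₀ r₁ i₀ i₁) : ContinuousOn (sol hb hω h ρ) K := by
  intro α₀ hα₀
  have hc := coer_pos hω hr hi
  rw [ContinuousWithinAt, tendsto_iff_norm_sub_tendsto_zero]
  have h1 : Tendsto (fun α => (coer ω r₁ i₀)⁻¹ *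
      ‖rhs b ω h α - opA hb hω ρ α (sol hb hω h ρ α₀)‖) (𝓝[K] α₀) (𝓝 0) := by
    have h2 := (((continuousOn_rhs hω hh (b := b)).sub
      (continuousOn_opA hb hω ρ (sol hb hω h ρ α₀))).norm.const_mul (coer ω r₁ i₀)⁻¹) α₀ hα₀
    have h3 := h2.tendsto
    simpa [opA_sol hb hω h hr hi hρ hα₀] using h3
  refine squeeze_zero' (Eventually.of_forall fun _ => norm_nonneg _) ?_ h1
  filter_upwards [self_mem_nhdsWithin] with α hα
  have h2 := coer_mul_norm_le hb hω hr hi hρ hα (sol hb hω h ρ α - sol hb hω h ρ α₀)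
  rw [map_sub, opA_sol hb hω h hr hi hρ hα] at h2
  rw [inv_mul_eq_div, le_div_iff₀ hc, mul_comm]
  exact h2

lemma continuousOn_F (hb : 0 < b) (hω : 0 < ω) (hh : 0 < h) (hr : 0 < r₁) (hi : 0 < i₀)
    {ρ : LinfOmega b} (hρ : ρ ∈ admissible b r₀ r₁ i₀ i₁) : ContinuousOn (F ω b h ρ) K :=
  ((traceBot b).continuous.comp_continuousOn (continuousOn_sol hb hω hh hr hi hρ)).congr
    fun _ hα => F_eq hb hω hh hr hi hρ hα

lemma aestronglyMeasurable_F (hb : 0 < b) (hω : 0 < ω) (hh : 0 < h) (hr : 0 < r₁) (hi : 0 < i₀)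
    {ρ : LinfOmega b} (hρ : ρ ∈ admissible b r₀ r₁ i₀ i₁) :
    AEStronglyMeasurable (F ω b h ρ) (volume.restrict K) :=
  (continuousOn_F hb hω hh hr hi hρ).aestronglyMeasurable measurableSet_K

lemma J_lt_top (hb : 0 < b) (hω : 0 < ω) (hh : 0 < h) (hr : 0 < r₁) (hi : 0 < i₀)
    {ρ : LinfOmega b} (hρ : ρ ∈ admissible b r₀ r₁ i₀ i₁) {q : ℝ → L2Gamma}
    (hq : (∫⁻ α in K, ‖q α‖ₑ ^ 2) < ∞) : J ω b h q ρ < ∞ := by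
  obtain ⟨C, hC⟩ := isCompact_K.exists_bound_of_continuousOn
    (continuousOn_F hb hω hh hr hi hρ)
  have h1 : ∀ α ∈ K, ‖F ω b h ρ α - q α‖ₑ ^ 2 ≤ 4 * ENNReal.ofReal C ^ 2 + 4 * ‖q α‖ₑ ^ 2 := by
    intro α hα
    have h2 : ‖F ω b h ρ α‖ₑ ≤ ENNReal.ofReal C := by
      rw [← ofReal_norm]
      exact ENNReal.ofReal_le_ofReal (hC α hα)
    -- The elementary bound (x+y)² ≤ 4 max(x,y)² ≤ 4x² + 4y² works in [0, ∞] without subtraction.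
    have h3 : ‖F ω b h ρ α - q α‖ₑ ≤ 2 * max (ENNReal.ofReal C) ‖q α‖ₑ := by
      refine enorm_sub_le.trans ?_
      exact (add_le_add (h2.trans (le_max_left _ ‖q α‖ₑ))
        (le_max_right (ENNReal.ofReal C) _)).trans_eq (two_mul _).symm
    calc ‖F ω b h ρ α - q α‖ₑ ^ 2 ≤ (2 * max (ENNReal.ofReal C) ‖q α‖ₑ) ^ 2 := by gcongr
      _ = 4 * max (ENNReal.ofReal C) ‖q α‖ₑ ^ 2 := by rw [mul_pow]; norm_num
      _ ≤ _ := by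
        rcases le_total (ENNReal.ofReal C) ‖q α‖ₑ with h | h
        · rw [max_eq_right h]; exact le_add_self
        · rw [max_eq_left h]; exact le_self_add
  have h2 : ∫⁻ α in K, (4 * ENNReal.ofReal C ^ 2 + 4 * ‖q α‖ₑ ^ 2) < ∞ := by
    rw [lintegral_add_left measurable_const, lintegral_const,
      lintegral_const_mul' 4 _ (by finiteness), Measure.restrict_apply_univ]
    exact ENNReal.add_lt_top.2 ⟨ENNReal.mul_lt_top (by finiteness) isCompact_K.measure_lt_top,
      ENNReal.mul_lt_top (by finiteness) hq⟩
  rw [J]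
  exact ENNReal.mul_lt_top (a := 1 / 2) (by finiteness)
    ((setLIntegral_mono' measurableSet_K h1).trans_lt h2)

end Solution

/-! ### Weak compactness of the admissible class -/

/-- Sequential Banach-Alaoglu in the dual of a separable space, carried back by Riesz
representation. -/
lemma exists_weak_limit {H : Type*} [NormedAddCommGroup H] [InnerProductSpace ℂ H]
    [CompleteSpace H] [TopologicalSpace.SeparableSpace H] {f : ℕ → H} {C : ℝ}
    (hf : ∀ k, ‖f k‖ ≤ C) :
    ∃ (a : H) (φ : ℕ → ℕ), StrictMono φ ∧
      ∀ v, Tendsto (fun k => inner ℂ (f (φ k)) v) atTop (𝓝 (inner ℂ a v)) := by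
  obtain ⟨a, -, φ, hφ, ha⟩ := WeakDual.isSeqCompact_closedBall ℂ H 0 C
    (x := fun k => StrongDual.toWeakDual (InnerProductSpace.toDual ℂ H (f k))) (fun k => by
      simpa using hf k)
  refine ⟨(InnerProductSpace.toDual ℂ H).symm (WeakDual.toStrongDual a), φ, hφ, fun v => ?_⟩
  have h1 := ((WeakDual.eval_continuous (𝕜 := ℂ) v).tendsto a).comp ha
  rw [InnerProductSpace.toDual_symm_apply]
  exact h1

/-- A pointwise bound on l(ρ_k) is inherited by integrals over measurable sets, passes to the limit
there, and is recovered almost everywhere from these integrals. -/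
lemma ae_le_of_weak_limit {b : ℝ} {ρ : ℕ → LinfOmega b} {r : S × ℝ → ℂ}
    (hir : Integrable r (vol b))
    (hlim : ∀ E, MeasurableSet E → Tendsto (fun k => ∫ z in E, ρ k z ∂(vol b)) atTop
      (𝓝 (∫ z in E, r z ∂(vol b)))) (l : ℂ →L[ℝ] ℝ) {C : ℝ}
    (hC : ∀ k, ∀ᵐ z ∂(vol b), l (ρ k z) ≤ C) : ∀ᵐ z ∂(vol b), l (r z) ≤ C := by
  have hi : ∀ k, Integrable (ρ k) (vol b) := fun k => (Lp.memLp (ρ k)).integrable (by simp)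
  refine ae_le_of_forall_setIntegral_le (l.integrable_comp hir) (integrable_const C) ?_
  intro E hE _
  rw [l.integral_comp_comm hir.integrableOn]
  refine le_of_tendsto ((l.continuous.tendsto _).comp (hlim E hE))
    (Eventually.of_forall fun k => ?_)
  change l _ ≤ _
  rw [← l.integral_comp_comm (hi k).integrableOn]
  exact integral_mono_ae (l.integrable_comp (hi k)).integrableOn (integrable_const C)
    (ae_restrict_of_ae (hC k))

lemma admissible_norm_le {b r₀ r₁ i₀ i₁ : ℝ} (hr₀ : 0 < r₀) (hi₀ : 0 < i₀) {ρ : LinfOmega b}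
    (hρ : ρ ∈ admissible b r₀ r₁ i₀ i₁) : ∀ᵐ z ∂(vol b), ‖ρ z‖ ≤ r₁ + i₁ := by
  filter_upwards [hρ] with z hz
  refine (Complex.norm_le_abs_re_add_abs_im _).trans ?_
  rw [abs_of_nonneg (hr₀.le.trans hz.1.1), abs_of_nonneg (hi₀.le.trans hz.2.1)]
  exact add_le_add hz.1.2 hz.2.2

lemma exists_admissible_limit {b r₀ r₁ i₀ i₁ : ℝ} (hr₀ : 0 < r₀) (hr : r₀ ≤ r₁) (hi₀ : 0 < i₀)
    (hi : i₀ ≤ i₁)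
    {ρ : ℕ → LinfOmega b} (hρ : ∀ k, ρ k ∈ admissible b r₀ r₁ i₀ i₁) :
    ∃ ρ' ∈ admissible b r₀ r₁ i₀ i₁, ∃ φ : ℕ → ℕ, StrictMono φ ∧
      ∀ v : L2Omega b, Tendsto (fun k => ∫ z, ρ (φ k) z * v z ∂(vol b)) atTop
        (𝓝 (∫ z, ρ' z * v z ∂(vol b))) := by
  -- Conjugation compensates for the conjugate-linear first slot of the inner product. The pointwise
  -- bounds and the finite measure put the sequence in a ball of L².
  have hmem : ∀ k, MemLp (fun z => conj (ρ k z)) 2 (vol b) := fun k =>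
    MemLp.of_bound (Complex.continuous_conj.comp_aestronglyMeasurable (Lp.aestronglyMeasurable _))
      (r₁ + i₁) (by
        filter_upwards [admissible_norm_le hr₀ hi₀ (hρ k)] with z hz
        rwa [RCLike.norm_conj])
  have : Fact ((2 : ℝ≥0∞) ≠ ∞) := ⟨by norm_num⟩
  have : MeasureTheory.IsSeparable (vol b) := isSeparable_of_sigmaFinite _
  have : SecondCountableTopology (L2Omega b) := Lp.SecondCountableTopology
  obtain ⟨a, φ, hφ, ha⟩ := exists_weak_limit (f := fun k => (hmem k).toLp)
    (C := (measureUnivNNReal (vol b) : ℝ) ^ ((2 : ℝ≥0∞).toReal⁻¹) * (r₁ + i₁)) (fun k => by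
      refine Lp.norm_le_of_ae_bound (by linarith) ?_
      filter_upwards [admissible_norm_le hr₀ hi₀ (hρ k), (hmem k).coeFn_toLp] with z hz hz'
      rw [hz', RCLike.norm_conj]
      exact hz)
  have hlim : ∀ v : L2Omega b, Tendsto (fun k => ∫ z, ρ (φ k) z * v z ∂(vol b)) atTop
      (𝓝 (∫ z, conj (a z) * v z ∂(vol b))) := by
    intro v
    have h1 := ha v
    have h2 : ∀ k, inner ℂ ((hmem (φ k)).toLp) v = ∫ z, ρ (φ k) z * v z ∂(vol b) := by
      intro k
      rw [inner_eq_integral]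
      refine integral_congr_ae ?_
      filter_upwards [(hmem (φ k)).coeFn_toLp] with z hz
      rw [hz, RCLike.conj_conj, mul_comm]
    simp only [h2, inner_eq_integral] at h1
    simpa only [mul_comm] using h1
  have hset : ∀ E, MeasurableSet E → Tendsto (fun k => ∫ z in E, ρ (φ k) z ∂(vol b)) atTop
      (𝓝 (∫ z in E, conj (a z) ∂(vol b))) := by
    intro E hE
    have h1 := hlim (indicatorConstLp 2 hE (measure_ne_top _ _) (1 : ℂ))
    have h2 : ∀ g : S × ℝ → ℂ, ∫ z, g z * (indicatorConstLp 2 hE (measure_ne_top (vol b) _)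
        (1 : ℂ) : L2Omega b) z ∂(vol b) = ∫ z in E, g z ∂(vol b) := by
      intro g
      rw [← integral_indicator hE]
      refine integral_congr_ae ?_
      filter_upwards [indicatorConstLp_coeFn (p := 2) (hs := hE)
        (hμs := measure_ne_top (vol b) E) (c := (1 : ℂ))] with z hz
      rw [hz]
      by_cases h : z ∈ E <;> simp [h]
    simpa only [h2] using h1
  have hint : Integrable (fun z => conj (a z)) (vol b) :=
    (Complex.conjCLE : ℂ →L[ℝ] ℂ).integrable_comp (integrable_Lp b a)
  have had : ∀ k, ∀ᵐ z ∂(vol b), (r₀ ≤ (ρ k z).re ∧ (ρ k z).re ≤ r₁) ∧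
      (i₀ ≤ (ρ k z).im ∧ (ρ k z).im ≤ i₁) := hρ
  -- The admissible rectangle is cut out by four half-planes, given by ±re and ±im.
  have bd := fun (l : ℂ →L[ℝ] ℝ) (C : ℝ) => ae_le_of_weak_limit hint hset l (C := C)
  have b1 := bd Complex.reCLM r₁ fun k => (had (φ k)).mono fun z hz => hz.1.2
  have b2 := bd (-Complex.reCLM) (-r₀) fun k => (had (φ k)).mono fun z hz => neg_le_neg hz.1.1
  have b3 := bd Complex.imCLM i₁ fun k => (had (φ k)).mono fun z hz => hz.2.2
  have b4 := bd (-Complex.imCLM) (-i₀) fun k => (had (φ k)).mono fun z hz => neg_le_neg hz.2.1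
  have hb : ∀ᵐ z ∂(vol b), (r₀ ≤ (conj (a z)).re ∧ (conj (a z)).re ≤ r₁) ∧
      (i₀ ≤ (conj (a z)).im ∧ (conj (a z)).im ≤ i₁) := by
    filter_upwards [b1, b2, b3, b4] with z h1 h2 h3 h4
    exact ⟨⟨neg_le_neg_iff.1 h2, h1⟩, ⟨neg_le_neg_iff.1 h4, h3⟩⟩
  have hinf : MemLp (fun z => conj (a z)) ∞ (vol b) := by
    refine MemLp.of_bound hint.aestronglyMeasurable (r₁ + i₁) ?_
    filter_upwards [hb] with z hz
    refine (Complex.norm_le_abs_re_add_abs_im _).trans ?_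
    rw [abs_of_nonneg (hr₀.le.trans hz.1.1), abs_of_nonneg (hi₀.le.trans hz.2.1)]
    exact add_le_add hz.1.2 hz.2.2
  refine ⟨hinf.toLp, ?_, φ, hφ, fun v => ?_⟩
  · filter_upwards [hb, hinf.coeFn_toLp] with z h1 h2
    rw [h2]
    exact h1
  · have h1 : ∫ z, hinf.toLp _ z * v z ∂(vol b) = ∫ z, conj (a z) * v z ∂(vol b) := by
      refine integral_congr_ae ?_
      filter_upwards [hinf.coeFn_toLp] with z hz
      rw [hz]
    rw [h1]
    exact hlim v

/-! ### Dependence of the solution on the coefficient -/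

lemma norm_valL_le {b : ℝ} (u : V b) : ‖valL b u‖ ≤ ‖u‖ := by
  refine (sq_le_sq₀ (norm_nonneg _) (norm_nonneg _)).1 ?_
  rw [norm_sq_V]
  nlinarith [sq_nonneg ‖dxL b u‖, sq_nonneg ‖dyL b u‖]

/-- The dual form of Rellich's theorem. For v = ι*f one has ‖v‖² = ⟨ιv, f⟩; ιv splits into a finite
cosine sum and a remainder of norm at most ε‖v‖, and one factor ‖v‖ cancels. -/
lemma exists_finset_norm_adjoint_valL_le {b : ℝ} (hb : 0 < b) {ε : ℝ} (hε : 0 < ε) :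
    ∃ s : Finset (ℤ × ℕ), ∀ f : L2Omega b,
      ‖(valL b).adjoint f‖ ≤ ∑ p ∈ s, ‖inner ℂ (cosVec b p) f‖ + ε * ‖f‖ := by
  obtain ⟨s, hs⟩ := exists_finset_norm_sub_le hb hε
  refine ⟨s, fun f => ?_⟩
  set v := (valL b).adjoint f with hv
  rcases (norm_nonneg v).eq_or_lt with h0 | h0
  · rw [← h0]
    positivity
  have h1 : ‖v‖ * ‖v‖ = ‖inner ℂ (valL b v) f‖ := by
    rw [← ContinuousLinearMap.adjoint_inner_right, ← hv, inner_self_eq_norm_sq_to_K, norm_pow,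
      RCLike.norm_ofReal, abs_of_nonneg (norm_nonneg v), sq]
  have h2 : inner ℂ (valL b v) f =
      ∑ p ∈ s, inner ℂ (inner ℂ (cosVec b p) (valL b v) • cosVec b p) f +
        inner ℂ (valL b v - ∑ p ∈ s, inner ℂ (cosVec b p) (valL b v) • cosVec b p) f := by
    rw [inner_sub_left, sum_inner]
    ring
  have h3 : ∀ p, ‖inner ℂ (inner ℂ (cosVec b p) (valL b v) • cosVec b p) f‖ ≤
      ‖v‖ * ‖inner ℂ (cosVec b p) f‖ := by
    intro p
    rw [inner_smul_left, norm_mul, RCLike.norm_conj]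
    refine mul_le_mul_of_nonneg_right ?_ (norm_nonneg _)
    refine (norm_inner_le_norm _ _).trans ?_
    rw [(orthonormal_cosVec hb).1 p, one_mul]
    exact norm_valL_le v
  have h4 : ‖v‖ * ‖v‖ ≤ ‖v‖ * (∑ p ∈ s, ‖inner ℂ (cosVec b p) f‖ + ε * ‖f‖) := by
    rw [h1, h2, mul_add, Finset.mul_sum]
    refine (norm_add_le _ _).trans (add_le_add ?_ ?_)
    · exact (norm_sum_le _ _).trans (Finset.sum_le_sum fun p _ => h3 p)
    · calc _ ≤ _ * ‖f‖ := norm_inner_le_norm _ _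
        _ ≤ (ε * ‖v‖) * ‖f‖ := by gcongr; exact hs v
        _ = _ := by ring
  exact le_of_mul_le_mul_left h4 h0

/-- The adjoint of the embedding `H¹(Ω) → L²(Ω)` maps bounded weak null sequences to null
sequences. -/
lemma tendsto_adjoint_valL {b : ℝ} (hb : 0 < b) {f : ℕ → L2Omega b} {M : ℝ}
    (hM : ∀ k, ‖f k‖ ≤ M)
    (hf : ∀ p, Tendsto (fun k => inner ℂ (cosVec b p) (f k)) atTop (𝓝 0)) :
    Tendsto (fun k => (valL b).adjoint (f k)) atTop (𝓝 0) := by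
  have hM0 : 0 ≤ M := (norm_nonneg _).trans (hM 0)
  rw [Metric.tendsto_atTop']
  intro ε hε
  obtain ⟨s, hs⟩ := exists_finset_norm_adjoint_valL_le hb (ε := ε / (2 * (M + 1))) (by positivity)
  have h1 : Tendsto (fun k => ∑ p ∈ s, ‖inner ℂ (cosVec b p) (f k)‖) atTop (𝓝 0) := by
    simpa using tendsto_finsetSum s fun p _ => (hf p).norm
  obtain ⟨N, hN⟩ := eventually_atTop.1 (h1.eventually_lt_const (half_pos hε))
  refine ⟨N, fun k hk => ?_⟩
  rw [dist_zero_right]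
  have h2 : ε / (2 * (M + 1)) * ‖f k‖ ≤ ε / 2 := by
    calc ε / (2 * (M + 1)) * ‖f k‖ ≤ ε / (2 * (M + 1)) * (M + 1) := by
          gcongr
          linarith [hM k]
      _ = ε / 2 := by field_simp
  linarith [hs (f k), hN k hk.le]

lemma norm_mulL_le {b r₀ r₁ i₀ i₁ : ℝ} (hr₀ : 0 < r₀) (hi₀ : 0 < i₀) {ρ : LinfOmega b}
    (hρ : ρ ∈ admissible b r₀ r₁ i₀ i₁) (g : L2Omega b) : ‖mulL ρ g‖ ≤ (r₁ + i₁) * ‖g‖ := by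
  refine Lp.norm_le_mul_norm_of_ae_le_mul ?_
  filter_upwards [coeFn_mulL ρ g, admissible_norm_le hr₀ hi₀ hρ] with z h1 h2
  rw [h1, norm_mul]
  gcongr

/-- φ is bounded on the slab, so g times the conjugate of φ is an L² test function for the weak
convergence of ρ_k. -/
lemma tendsto_inner_mulL {b : ℝ} {ρ : ℕ → LinfOmega b} {ρ' : LinfOmega b}
    (h : ∀ v : L2Omega b, Tendsto (fun k => ∫ z, ρ k z * v z ∂(vol b)) atTop
      (𝓝 (∫ z, ρ' z * v z ∂(vol b)))) (φ : C(S × ℝ, ℂ)) (g : L2Omega b) :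
    Tendsto (fun k => inner ℂ (toL2 b φ) (mulL (ρ k) g)) atTop
      (𝓝 (inner ℂ (toL2 b φ) (mulL ρ' g))) := by
  have h1 : ∀ χ : LinfOmega b, inner ℂ (toL2 b φ) (mulL χ g) =
      ∫ z, χ z * mulL (toLinf b (star φ)) g z ∂(vol b) := by
    intro χ
    rw [inner_mulL]
    refine integral_congr_ae ?_
    filter_upwards [coeFn_mulL (toLinf b (star φ)) g, coeFn_toLinf b (star φ),
      coeFn_toL2 b φ] with z h1 h2 h3
    rw [h1, h2, h3, mul_assoc, mul_comm (g z)]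
    rfl
  simp only [h1]
  exact h _

section Solution

variable {b ω h r₀ r₁ i₀ i₁ : ℝ}

/-- Both solutions have the same right-hand side, so the operator for ρ_k maps their difference to
ω² ι*((ρ_k - ρ')u) with u fixed. This is a weak null sequence under a compact operator, and the
uniform coercivity inverts the estimate. -/
lemma tendsto_sol (hb : 0 < b) (hω : 0 < ω) (h : ℝ) (hr₀ : 0 < r₀) (hr : 0 < r₁) (hi₀ : 0 < i₀)
    {ρ : ℕ → LinfOmega b} {ρ' : LinfOmega b} (hρ : ∀ k, ρ k ∈ admissible b r₀ r₁ i₀ i₁)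
    (hρ' : ρ' ∈ admissible b r₀ r₁ i₀ i₁)
    (H : ∀ v : L2Omega b, Tendsto (fun k => ∫ z, ρ k z * v z ∂(vol b)) atTop
      (𝓝 (∫ z, ρ' z * v z ∂(vol b)))) {α : ℝ} (hα : α ∈ K) :
    Tendsto (fun k => sol hb hω h (ρ k) α) atTop (𝓝 (sol hb hω h ρ' α)) := by
  set u := sol hb hω h ρ' α with hu
  set g := valL b u with hg
  have hc := coer_pos hω hr hi₀
  have h1 : Tendsto (fun k => (valL b).adjoint (mulL (ρ k) g - mulL ρ' g)) atTop (𝓝 0) := by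
    refine tendsto_adjoint_valL hb (M := (r₁ + i₁) * ‖g‖ + (r₁ + i₁) * ‖g‖) (fun k => ?_)
      (fun p => ?_)
    · exact (norm_sub_le _ _).trans
        (add_le_add (norm_mulL_le hr₀ hi₀ (hρ k) g) (norm_mulL_le hr₀ hi₀ hρ' g))
    · have h2 := ((tendsto_inner_mulL H (tens p.1 (cosY b p.2)) g).sub_const
        (inner ℂ (toL2 b (tens p.1 (cosY b p.2))) (mulL ρ' g))).const_mul
        (((cosNorm b p.2)⁻¹ : ℝ) : ℂ)
      simpa only [cosVec, inner_smul_left, Complex.conj_ofReal, inner_sub_right, sub_self,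
        mul_zero, mul_sub] using h2
  have h2 : ∀ k, coer ω r₁ i₀ * ‖sol hb hω h (ρ k) α - u‖ ≤
      ω ^ 2 * ‖(valL b).adjoint (mulL (ρ k) g - mulL ρ' g)‖ := by
    intro k
    refine (coer_mul_norm_le hb hω hr hi₀ (hρ k) hα _).trans_eq ?_
    have h3 : opA hb hω (ρ k) α (sol hb hω h (ρ k) α - u) =
        ((ω : ℂ) ^ 2) • (valL b).adjoint (mulL (ρ k) g - mulL ρ' g) := by
      rw [map_sub, opA_sol hb hω h hr hi₀ (hρ k) hα, ← opA_sol hb hω h hr hi₀ hρ' hα, ← hu]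
      simp only [opA, sub_apply, add_apply, smul_apply, ContinuousLinearMap.comp_apply, map_sub,
        smul_sub, ← hg]
      abel
    rw [h3, norm_smul, norm_pow, Complex.norm_real, Real.norm_eq_abs, sq_abs]
  rw [tendsto_iff_norm_sub_tendsto_zero]
  refine squeeze_zero (fun _ => norm_nonneg _) (fun k => ?_)
    (g := fun k => (coer ω r₁ i₀)⁻¹ * (ω ^ 2 * ‖(valL b).adjoint (mulL (ρ k) g - mulL ρ' g)‖)) ?_
  · rw [inv_mul_eq_div, le_div_iff₀ hc, mul_comm]
    exact h2 k
  · simpa using (h1.norm.const_mul (ω ^ 2)).const_mul (coer ω r₁ i₀)⁻¹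

/-! ### Existence of an optimal coefficient -/

lemma admissible_nonempty (b : ℝ) (hr : r₀ ≤ r₁) (hi : i₀ ≤ i₁) :
    (admissible b r₀ r₁ i₀ i₁).Nonempty := by
  refine ⟨toLinf b (ContinuousMap.const _ ⟨r₀, i₀⟩), ?_⟩
  filter_upwards [coeFn_toLinf b (ContinuousMap.const _ ⟨r₀, i₀⟩)] with z hz
  rw [hz]
  exact ⟨⟨le_rfl, hr⟩, le_rfl, hi⟩

/-- For each α ∈ K the integrand converges, and Fatou's lemma needs no dominating function, so J may
be infinite. -/
lemma J_le_liminf (hb : 0 < b) (hω : 0 < ω) (hh : 0 < h) (hr₀ : 0 < r₀) (hr : 0 < r₁)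
    (hi₀ : 0 < i₀) {ρ : ℕ → LinfOmega b} {ρ' : LinfOmega b}
    (hρ : ∀ k, ρ k ∈ admissible b r₀ r₁ i₀ i₁) (hρ' : ρ' ∈ admissible b r₀ r₁ i₀ i₁)
    (H : ∀ v : L2Omega b, Tendsto (fun k => ∫ z, ρ k z * v z ∂(vol b)) atTop
      (𝓝 (∫ z, ρ' z * v z ∂(vol b))))
    {q : ℝ → L2Gamma} (hq : AEStronglyMeasurable q (volume.restrict K)) :
    J ω b h q ρ' ≤ liminf (fun k => J ω b h q (ρ k)) atTop := by
  have hJ : ∀ χ, J ω b h q χ = ∫⁻ α in K, (1 / 2) * ‖F ω b h χ α - q α‖ₑ ^ 2 := fun χ => by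
    rw [J, lintegral_const_mul' _ _ (by finiteness)]
  simp only [hJ]
  refine le_trans (le_of_eq ?_) (lintegral_liminf_le' fun k => ?_)
  · refine setLIntegral_congr_fun measurableSet_K fun α hα => ?_
    refine (Tendsto.liminf_eq ?_).symm
    refine ENNReal.Tendsto.const_mul ?_ (Or.inr (by finiteness))
    refine ENNReal.Tendsto.pow ?_
    refine Tendsto.enorm (Tendsto.sub_const ?_ _)
    simp only [F_eq hb hω hh hr hi₀ (hρ _) hα, F_eq hb hω hh hr hi₀ hρ' hα]
    exact ((traceBot b).continuous.tendsto _).comp (tendsto_sol hb hω h hr₀ hr hi₀ hρ hρ' H hα)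
  · exact ((((aestronglyMeasurable_F hb hω hh hr hi₀ (hρ k)).sub hq).enorm).pow_const 2).const_mul _

lemma exists_minimizer (hb : 0 < b) (hω : 0 < ω) (hh : 0 < h) (hr₀ : 0 < r₀) (hr : r₀ ≤ r₁)
    (hi₀ : 0 < i₀) (hi : i₀ ≤ i₁) {q : ℝ → L2Gamma}
    (hq : AEStronglyMeasurable q (volume.restrict K)) :
    ∃ ρ' ∈ admissible b r₀ r₁ i₀ i₁,
      J ω b h q ρ' = ⨅ ρ ∈ admissible b r₀ r₁ i₀ i₁, J ω b h q ρ := by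
  -- The infimum is taken in [0, ∞], so a minimizing sequence exists even if J is identically ∞.
  obtain ⟨t, -, ht, htA⟩ := exists_seq_tendsto_sInf
    ((admissible_nonempty b hr hi).image (J ω b h q)) (OrderBot.bddBelow _)
  choose ρ hρ hJ using htA
  obtain ⟨ρ', hρ', φ, hφ, H⟩ := exists_admissible_limit hr₀ hr hi₀ hi hρ
  refine ⟨ρ', hρ', le_antisymm ?_ (iInf₂_le ρ' hρ')⟩
  rw [← sInf_image]
  have h1 := J_le_liminf hb hω hh hr₀ (hr₀.trans_le hr) hi₀ (fun k => hρ (φ k)) hρ' H hq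
  have h2 := (ht.comp hφ.tendsto_atTop).liminf_eq
  rw [← h2]
  simpa only [Function.comp_def, ← hJ] using h1

end Solution

/-! ### The mirror image -/

/-- The Fourier coefficients of the Bloch components of the mirror image, up to a factor `1/π`. -/
def mirrorCoeff (ω h₁ α : ℝ) (n : ℤ) : ℂ := conj (expCoeff ω h₁ α n / beta ω (n + α))

/-- |β(n+α)| ≥ 1 for all but finitely many n, so dividing by β costs nothing in the tail. A
vanishing β gives the coefficient 0 by the convention z / 0 = 0. -/
lemma summable_norm_mirrorCoeff {ω h₁ : ℝ} (hω : 0 < ω) (hh₁ : 0 < h₁) (α : ℝ) :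
    Summable fun n => ‖mirrorCoeff ω h₁ α n‖ := by
  refine Summable.of_norm_bounded_eventually (summable_norm_expCoeff hω hh₁ α) ?_
  have h1 : {n : ℤ | ¬ ‖‖mirrorCoeff ω h₁ α n‖‖ ≤ ‖expCoeff ω h₁ α n‖} ⊆
      Icc (-⌈ω + 1 + |α|⌉) ⌈ω + 1 + |α|⌉ := by
    intro n hn
    by_contra hcon
    refine hn ?_
    rw [norm_norm, mirrorCoeff, RCLike.norm_conj, norm_div]
    refine div_le_self (norm_nonneg _) ?_
    have h2 : ω + 1 + |α| ≤ |(n : ℝ)| := by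
      have : ⌈ω + 1 + |α|⌉ < |n| := by
        by_contra hle
        exact hcon (abs_le.1 (not_lt.1 hle))
      exact_mod_cast (Int.le_ceil _).trans (Int.cast_le.2 this.le)
    have h3 : |(n : ℝ)| ≤ |(n : ℝ) + α| + |α| := by
      have := abs_sub (n + α : ℝ) α
      simpa using this
    linarith [sub_le_beta_im hω ((n : ℝ) + α), (le_abs_self _).trans (Complex.abs_im_le_norm
      (beta ω (n + α)))]
  exact (finite_Icc _ _).subset h1

lemma measurable_mirrorCoeff (ω h₁ : ℝ) (n : ℤ) : Measurable fun α => mirrorCoeff ω h₁ α n := by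
  have h1 : Continuous fun α : ℝ => beta ω (n + α) :=
    (continuous_beta ω).comp (continuous_const.add continuous_id)
  have h2 : Continuous fun α => expCoeff ω h₁ α n := by
    unfold expCoeff
    fun_prop
  exact Complex.continuous_conj.measurable.comp (h2.measurable.div h1.measurable)

/-- The family of Bloch components of the mirror image. -/
def mirrorFamily (ω h₁ α : ℝ) : L2Gamma :=
  toL2S ((1 / Real.pi : ℂ) • fourierSeries (mirrorCoeff ω h₁ α))

lemma coeFn_mirrorFamily {ω h₁ : ℝ} (hω : 0 < ω) (hh₁ : 0 < h₁) (α : ℝ) :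
    (mirrorFamily ω h₁ α : S → ℂ) =ᵐ[volume] mirrorTarget ω h₁ α := by
  filter_upwards [coeFn_toL2S ((1 / Real.pi : ℂ) • fourierSeries (mirrorCoeff ω h₁ α))] with x hx
  rw [mirrorFamily, hx, ContinuousMap.smul_apply,
    fourierSeries_apply (summable_norm_mirrorCoeff hω hh₁ α)]
  rfl

lemma stronglyMeasurable_mirrorFamily {ω h₁ : ℝ} (hω : 0 < ω) (hh₁ : 0 < h₁) :
    StronglyMeasurable (mirrorFamily ω h₁) := by
  suffices key : StronglyMeasurable fun α => fourierSeries (mirrorCoeff ω h₁ α) from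
    toL2S.continuous.comp_stronglyMeasurable (key.const_smul (1 / Real.pi : ℂ))
  -- The finite partial sums converge in C(𝒮), pointwise in α.
  refine stronglyMeasurable_of_tendsto (f := fun (s : Finset ℤ) α =>
    ∑ n ∈ s, mirrorCoeff ω h₁ α n • (fourier n : C(S, ℂ))) atTop (fun s => ?_)
    (tendsto_pi_nhds.2 fun α =>
      (summable_smul_fourier (summable_norm_mirrorCoeff hω hh₁ α)).hasSum)
  refine Finset.stronglyMeasurable_fun_sum s fun n _ => ?_
  exact (measurable_mirrorCoeff ω h₁ n).stronglyMeasurable.smul_const _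

end Slab

end


/-! ### Well-posedness and existence of an optimal design -/

theorem theorem3p1 (ω b h h₁ r₀ r₁ i₀ i₁ : ℝ)
    (hω : 0 < ω) (hb : 0 < b) (hh : 0 < h) (hh₁ : 0 < h₁)
    (hr₀ : 0 < r₀) (hr : r₀ ≤ r₁) (hi₀ : 0 < i₀) (hi : i₀ ≤ i₁) :
    -- the boundary value problem has exactly one weak solution, with exactly one pair of traces
    (∀ ρ ∈ Slab.admissible b r₀ r₁ i₀ i₁, ∀ α ∈ Slab.K,
      ∃! p : Slab.H1 b × Slab.L2Gamma × Slab.L2Gamma,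
        Slab.IsWeakSolution ω h α ρ p.1 ∧ Slab.IsTrace p.1 p.2.1 p.2.2) ∧
    -- its trace on the lower boundary depends measurably on `α`
    (∀ ρ ∈ Slab.admissible b r₀ r₁ i₀ i₁,
      AEStronglyMeasurable (Slab.F ω b h ρ) (volume.restrict Slab.K)) ∧
    -- for every measurable family of targets the infimum is attained
    (∀ q : ℝ → Slab.L2Gamma, AEStronglyMeasurable q (volume.restrict Slab.K) →
      ((∫⁻ α in Slab.K, ‖q α‖ₑ ^ 2) < ∞ →
        ∀ ρ ∈ Slab.admissible b r₀ r₁ i₀ i₁, Slab.J ω b h q ρ < ∞) ∧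
      ∃ ρ' ∈ Slab.admissible b r₀ r₁ i₀ i₁,
        Slab.J ω b h q ρ' = ⨅ ρ ∈ Slab.admissible b r₀ r₁ i₀ i₁, Slab.J ω b h q ρ) ∧
    -- the Bloch components of the mirror image are such a family
    (∃ q : ℝ → Slab.L2Gamma, AEStronglyMeasurable q (volume.restrict Slab.K) ∧
      (∀ᵐ α ∂(volume.restrict Slab.K), (q α : Slab.S → ℂ) =ᵐ[volume] Slab.mirrorTarget ω h₁ α) ∧
      ∃ ρ' ∈ Slab.admissible b r₀ r₁ i₀ i₁,
        Slab.J ω b h q ρ' = ⨅ ρ ∈ Slab.admissible b r₀ r₁ i₀ i₁, Slab.J ω b h q ρ) := by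
  have hr₁ : 0 < r₁ := hr₀.trans_le hr
  have hmirror := (Slab.stronglyMeasurable_mirrorFamily hω hh₁).aestronglyMeasurable
    (μ := volume.restrict Slab.K)
  exact ⟨fun ρ hρ α hα => Slab.existsUnique_weakSolution hb hω hh hr₁ hi₀ hρ hα,
    fun ρ hρ => Slab.aestronglyMeasurable_F hb hω hh hr₁ hi₀ hρ,
    fun q hq => ⟨fun hfin ρ hρ => Slab.J_lt_top hb hω hh hr₁ hi₀ hρ hfin,
      Slab.exists_minimizer hb hω hh hr₀ hr hi₀ hi hq⟩,
    -- The identity holds for every α: at exceptional values both sides use z / 0 = 0.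
    Slab.mirrorFamily ω h₁, hmirror, ae_of_all _ (Slab.coeFn_mirrorFamily hω hh₁),
    Slab.exists_minimizer hb hω hh hr₀ hr hi₀ hi hmirror⟩
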